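/- **Setting.** Let $n\ge 0$ be an integer, $N=2n+1$, $W>0$, $\lambda_0\in(-2,2)$, $\xi_1,\xi_2\in\mathbb R$, $\rho(\lambda)=\frac1{2\pi}\sqrt{4-\lambda^2}$. Let $\Delta$ be the discrete Laplacian on $\{-n,\dots,n\}$ with Neumann boundary conditions, $J=(-W^2\Delta+1)^{-1}$, and let $H$ be the real symmetric $N\times N$ random matrix whose entries $H_{ij}$, $-n\le i\le j\le n$, are independent centred real Gaussian variables with variance $J_{ij}$ for $i<j$ and $2J_{ii}$ for $i=j$. Put $$F_2(\lambda_1,\lambda_2)=\mathbf E\big\{\det(\lambda_1-H)\det(\lambda_2-H)\big\},\qquad \Lambda_{0,4}=\lambda_0 I_4,\qquad \hat\xi_4=\mathrm{diag}\{\xi_1,\xi_2,\xi_1,\xi_2\}.$$ For $x_j,y_j\in\mathbb R$, $w_{j1},w_{j2}\in\mathbb C$ let $$F_j=\begin{pmatrix}x_j&w_{j1}&0&w_{j2}\\ \overline w_{j1}&y_j&-w_{j2}&0\\ 0&-\overline w_{j2}&x_j&\overline w_{j1}\\ \overline w_{j2}&0&w_{j1}&y_j\end{pmatrix},\qquad dF_j=dx_j\,dy_j\,d\Re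 w_{j1}\,d\Im w_{j1}\,d\Re w_{j2}\,d\Im w_{j2},$$ and let $\det^{1/2}(F_j-i\Lambda_{0,4}/2)=(x_j-\tfrac{i\lambda_0}2)(y_j-\tfrac{i\lambda_0}2)-|w_{j1}|^2-|w_{j2}|^2$ (the quaternion determinant, a polynomial square root of the determinant). **Proposition.** The integrand of $F_2$ is integrable, the two integrals below converge absolutely, and the following two formulas hold. (1) $$F_2\Big(\lambda_0+\tfrac{\xi_1}{N\rho(\lambda_0)},\lambda_0+\tfrac{\xi_2}{N\rho(\lambda_0)}\Big)=-(2\pi^3)^{-N}\,{\det}^{-3}J\int \exp\Big\{-\frac{W^2}4\sum_{j=-n+1}^n\mathrm{Tr}\,(F_j-F_{j-1})^2\Big\}$$ $$\times\exp\Big\{-\frac14\sum_{j=-n}^n\mathrm{Tr}\Big(F_j+\frac{i\Lambda_{0,4}}2+\frac{i\hat\xi_4}{N\rho(\lambda_0)}\Big)^2\Big\}\prod_{j=-n}^n{\det}^{1/2}\Big(F_j-\frac{i\Lambda_{0,4}}2\Big)\prod_{j=-n}^n dF_j .$$ (2) Let $Sp(2)$ be the group of unitary $4\times4$ matrices $P$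 with $PZP^t=Z$, $Z=\begin{pmatrix}0&I_2\\-I_2&0\end{pmatrix}$, let $Sp(1)\times Sp(1)\subset Sp(2)$ be the subgroup of the matrices that are diagonal as $2\times2$ quaternion matrices (all four $2\times 2$ blocks are diagonal), let $\mathring{Sp}(2)=Sp(2)/(Sp(1)\times Sp(1))$, where $P$ and $hP$ are identified for $h\in Sp(1)\times Sp(1)$, and let $\nu$ be its invariant probability measure (the image of the normalized Haar measure of $Sp(2)$). Let $A_{j,4}=\mathrm{diag}\{a_j,b_j,a_j,b_j\}$, $$f(x)=\tfrac12\big(x+\tfrac{i\lambda_0}2\big)^2-\log\big(x-\tfrac{i\lambda_0}2\big),\quad R_k=Q_kQ_{k-1}\cdots Q_{-n+1},\ R_{-n}=I,\quad C(\xi)=\exp\Big\{\frac{\lambda_0(\xi_1+\xi_2)}{2\rho(\lambda_0)}+\frac{\xi_1^2+\xi_2^2}{2N\rho(\lambda_0)^2}\Big\}.$$ Then $$F_2\Big(\lambda_0+\tfrac{\xi_1}{N\rho(\lambda_0)},\lambda_0+\tfrac{\xi_2}{N\rho(\lambda_0)}\Big)=-\frac{C(\xi)\,{\det}^{-3}J}{(24\pi)^N}\int\exp\Big\{-\frac{W^2}4\sum_{j=-n+1}^n\mathrm{Tr}\,(Q_j^*A_{j,4}Q_j-A_{j-1,4})^2\Big\}$$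 $$\times\exp\Big\{-\sum_{j=-n}^n(f(a_j)+f(b_j))-\frac i{2N\rho(\lambda_0)}\sum_{j=-n}^n\mathrm{Tr}\,(R_jP_{-n})^*A_{j,4}(R_jP_{-n})\hat\xi_4\Big\}$$ $$\times\prod_{l=-n}^n(a_l-b_l)^4\;d\nu(P_{-n})\prod_{p=-n+1}^nd\nu(Q_p)\prod_{j=-n}^n da_j\,db_j ,$$ where $a_j,b_j$ run over $\mathbb R$, $P_{-n},Q_{-n+1},\dots,Q_n$ run over $\mathring{Sp}(2)$, and in the integrand each coset is represented by a symplectic matrix chosen by any measurable section $\mathring{Sp}(2)\to Sp(2)$ (possibly a different one for each of the $N$ variables). -/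

import Mathlib

noncomputable section

namespace RBM

open Matrix MeasureTheory

/-! ### The Gaussian band matrix and its characteristic polynomials

The sites `-n, …, n` are indexed by `Fin (2 * n + 1)`: the index `k` stands for the site `k - n`. -/

open Classical in
/-- The discrete Laplacian on `{-n, …, n}` with Neumann boundary conditions:
`-Δ` is the graph Laplacian (degree minus adjacency) of the path. -/
def neumannLaplacian (n : ℕ) : Matrix (Fin (2 * n + 1)) (Fin (2 * n + 1)) ℝ :=
  -(SimpleGraph.pathGraph (2 * n + 1)).lapMatrix ℝ

/-- The covariance `J = (-W² Δ + 1)⁻¹`. -/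
def covJ (n : ℕ) (W : ℝ) : Matrix (Fin (2 * n + 1)) (Fin (2 * n + 1)) ℝ :=
  (-(W ^ 2) • neumannLaplacian n + 1)⁻¹

/-- Positions `i ≤ j` of the independent entries of a symmetric matrix. -/
abbrev UpperIndex (n : ℕ) : Type :=
  {p : Fin (2 * n + 1) × Fin (2 * n + 1) // p.1 ≤ p.2}

/-- The symmetric matrix with the given entries on and above the diagonal. -/
def symMatrix {n : ℕ} (h : UpperIndex n → ℝ) :
    Matrix (Fin (2 * n + 1)) (Fin (2 * n + 1)) ℝ :=
  Matrix.of fun i j => h ⟨(min i j, max i j), min_le_max⟩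

/-- The law `P_N` of the real symmetric band matrix, in terms of the entries on and above the
diagonal: these are independent centred Gaussian variables, of variance `J i j` for `i < j`
and `2 * J i i` on the diagonal. -/
def bandLaw (n : ℕ) (W : ℝ) : Measure (UpperIndex n → ℝ) :=
  Measure.pi fun p => ProbabilityTheory.gaussianReal 0
    (Real.toNNReal (if p.1.1 = p.1.2 then 2 * covJ n W p.1.1 p.1.2 else covJ n W p.1.1 p.1.2))

/-- `∏ s, det (l s - H)`. -/
def charPolyProd {n m : ℕ} (l : Fin m → ℂ) (h : UpperIndex n → ℝ) : ℂ :=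
  ∏ s, (Matrix.scalar (Fin (2 * n + 1)) (l s) - (symMatrix h).map ((↑) : ℝ → ℂ)).det

/-- The mixed moment `F_m` of the characteristic polynomials at `l 0, …, l (m - 1)`. -/
def mixedMoment (n : ℕ) (W : ℝ) {m : ℕ} (l : Fin m → ℂ) : ℂ :=
  ∫ h, charPolyProd l h ∂(bandLaw n W)

/-- The density of the semicircle law. -/
def semicircleDensity (x : ℝ) : ℝ := 1 / (2 * Real.pi) * Real.sqrt (4 - x ^ 2)

/-- `N ρ(lam0)` with `N = 2 n + 1`. -/
def scaleN (n : ℕ) (lam0 : ℝ) : ℝ := ((2 * n + 1 : ℕ) : ℝ) * semicircleDensity lam0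

/-! ### Quaternion self-dual Hermitian `4 × 4` matrices -/

/-- Index set of `4 × 4` matrices in `2 × 2` block form, in the order
`inl 0, inl 1, inr 0, inr 1`. -/
abbrev I4 : Type := Fin 2 ⊕ Fin 2

/-- `σ = [[0, 1], [-1, 0]]`. -/
def sigma : Matrix (Fin 2) (Fin 2) ℂ := !![0, 1; -1, 0]

/-- The matrix `diag {u, v, u, v}`. -/
def diag4 (u v : ℂ) : Matrix I4 I4 ℂ := Matrix.diagonal (Sum.elim ![u, v] ![u, v])

/-- The quaternion self-dual Hermitian matrix with the parameters `(x, y, w₁, w₂)`, in block form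
`[[X, w₂ σ], [-w̄₂ σ, Xᵀ]]` with `X = [[x, w₁], [w̄₁, y]]`. -/
def selfDual (p : ℝ × ℝ × ℂ × ℂ) : Matrix I4 I4 ℂ :=
  let X : Matrix (Fin 2) (Fin 2) ℂ :=
    !![(p.1 : ℂ), p.2.2.1; (starRingEnd ℂ) p.2.2.1, (p.2.1 : ℂ)]
  Matrix.fromBlocks X (p.2.2.2 • sigma) (-((starRingEnd ℂ) p.2.2.2) • sigma) Xᵀ

/-- `det^{1/2}` of a quaternion self-dual matrix `[[X, b σ], [c σ, Xᵀ]]`: the quaternion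
determinant `det X + b c`, i.e. the polynomial square root of `det` which is `1` at the identity
(see `sqrtDet_sq`, `sqrtDet_diag4`). -/
def sqrtDet (M : Matrix I4 I4 ℂ) : ℂ :=
  M.toBlocks₁₁.det + M (Sum.inl 0) (Sum.inr 1) * M (Sum.inr 0) (Sum.inl 1)

theorem sqrtDet_sq (X : Matrix (Fin 2) (Fin 2) ℂ) (b c : ℂ) :
    sqrtDet (Matrix.fromBlocks X (b • sigma) (c • sigma) Xᵀ) ^ 2 =
      (Matrix.fromBlocks X (b • sigma) (c • sigma) Xᵀ).det := by
  have h : Matrix.reindex finSumFinEquiv finSumFinEquiv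
      (Matrix.fromBlocks X (b • sigma) (c • sigma) Xᵀ) =
      !![X 0 0, X 0 1, 0, b; X 1 0, X 1 1, -b, 0; 0, c, X 0 0, X 1 0; -c, 0, X 0 1, X 1 1] := by
    have h0 : (finSumFinEquiv (m := 2) (n := 2)).symm 0 = Sum.inl 0 := rfl
    have h1 : (finSumFinEquiv (m := 2) (n := 2)).symm 1 = Sum.inl 1 := rfl
    have h2 : (finSumFinEquiv (m := 2) (n := 2)).symm 2 = Sum.inr 0 := rfl
    have h3 : (finSumFinEquiv (m := 2) (n := 2)).symm 3 = Sum.inr 1 := rfl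
    ext i j
    fin_cases i <;> fin_cases j <;> simp [sigma, h0, h1, h2, h3]
  rw [← Matrix.det_reindex_self finSumFinEquiv, h]
  simp [sqrtDet, sigma, Matrix.det_succ_row_zero, Fin.sum_univ_succ,
    Fin.succAbove]
  ring

theorem sqrtDet_selfDual_sub (p : ℝ × ℝ × ℂ × ℂ) (u v : ℂ) :
    sqrtDet (selfDual p - diag4 u v) ^ 2 = (selfDual p - diag4 u v).det := by
  have h : selfDual p - diag4 u v = Matrix.fromBlocks
      (!![(p.1 : ℂ), p.2.2.1; (starRingEnd ℂ) p.2.2.1, (p.2.1 : ℂ)] - Matrix.diagonal ![u, v])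
      (p.2.2.2 • sigma) (-((starRingEnd ℂ) p.2.2.2) • sigma)
      (!![(p.1 : ℂ), p.2.2.1; (starRingEnd ℂ) p.2.2.1, (p.2.1 : ℂ)]
        - Matrix.diagonal ![u, v])ᵀ := by
    rw [diag4, ← Matrix.fromBlocks_diagonal]
    ext i j
    rcases i with i | i <;> rcases j with j | j <;> fin_cases i <;> fin_cases j <;>
      simp [selfDual]
  rw [h]
  exact sqrtDet_sq _ _ _

theorem sqrtDet_diag4 (u v : ℂ) : sqrtDet (diag4 u v) = u * v := by
  simp [sqrtDet, diag4, Matrix.det_fin_two, Matrix.toBlocks₁₁]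

/-! ### The compact symplectic group and the coset space -/

/-- `Sp(2)`: the unitary `4 × 4` matrices `P` with `P Z Pᵀ = Z` for the standard
skew-symmetric matrix `Z`, as a subgroup of the unitary group. -/
def compactSp : Subgroup (Matrix.unitaryGroup I4 ℂ) where
  __ := (Matrix.symplecticGroup (Fin 2) ℂ).comap (Matrix.unitaryGroup I4 ℂ).subtype
  inv_mem' := by
    intro P hP
    have hP' : (P : Matrix I4 I4 ℂ) ∈ Matrix.symplecticGroup (Fin 2) ℂ := hP
    change ((P⁻¹ : Matrix.unitaryGroup I4 ℂ) : Matrix I4 I4 ℂ) ∈ Matrix.symplecticGroup (Fin 2) ℂ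
    have h1 : ((⟨_, hP'⟩ : Matrix.symplecticGroup (Fin 2) ℂ)⁻¹ :
        Matrix.symplecticGroup (Fin 2) ℂ).1 = (P⁻¹ : Matrix.unitaryGroup I4 ℂ).1 := by
      rw [SymplecticGroup.coe_inv']
      refine Matrix.inv_eq_left_inv ?_
      exact congrArg Subtype.val (inv_mul_cancel P)
    rw [← h1]
    exact Subtype.property _

abbrev Sp2 : Type := compactSp

/-- The `4 × 4` complex matrix of an element of `Sp(2)`. -/
def Sp2.mat (P : Sp2) : Matrix I4 I4 ℂ := P.1.1

instance : CompactSpace Sp2 := by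
  have h : IsCompact (Set.range Sp2.mat) := by
    have hK : IsCompact ({A : Matrix I4 I4 ℂ | ∀ i j, A i j ∈ Metric.closedBall (0 : ℂ) 1}) := by
      have : {A : Matrix I4 I4 ℂ | ∀ i j, A i j ∈ Metric.closedBall (0 : ℂ) 1} =
          Set.pi Set.univ fun _ => Set.pi Set.univ fun _ => Metric.closedBall (0 : ℂ) 1 := by
        ext A
        exact ⟨fun h i _ j _ => h i j, fun h i j => h i trivial j trivial⟩
      rw [this]
      exact isCompact_univ_pi fun _ => isCompact_univ_pi fun _ => isCompact_closedBall _ _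
    refine hK.of_isClosed_subset ?_ ?_
    · have : Set.range Sp2.mat = (unitary (Matrix I4 I4 ℂ) : Set (Matrix I4 I4 ℂ)) ∩
          {A | A * Matrix.J (Fin 2) ℂ * Aᵀ = Matrix.J (Fin 2) ℂ} := by
        ext A
        constructor
        · rintro ⟨P, rfl⟩
          exact ⟨P.1.2, P.2⟩
        · rintro ⟨h1, h2⟩
          exact ⟨⟨⟨A, h1⟩, h2⟩, rfl⟩
      rw [this]
      exact isClosed_unitary.inter (isClosed_eq (by fun_prop) (by fun_prop))
    · rintro _ ⟨P, rfl⟩ i j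
      rw [mem_closedBall_zero_iff]
      exact entry_norm_bound_of_unitary P.1.2 i j
  have hind : Topology.IsInducing Sp2.mat :=
    Topology.IsInducing.subtypeVal.comp Topology.IsInducing.subtypeVal
  rw [← isCompact_univ_iff, hind.isCompact_iff, Set.image_univ]
  exact h

instance : MeasurableSpace Sp2 := borel Sp2

instance : BorelSpace Sp2 := ⟨rfl⟩

/-- The Haar measure of `Sp(2)` of total mass one. -/
def haarSp2 : Measure Sp2 := Measure.haarMeasure ⊤

/-- `Sp(1) × Sp(1) ⊂ Sp(2)`: the matrices in `Sp(2)` that are diagonal as `2 × 2` quaternion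
matrices, i.e. whose four `2 × 2` blocks are diagonal. -/
def spOneSpOne : Subgroup Sp2 where
  carrier := {P | ∀ i j : Fin 2, i ≠ j →
    P.mat (Sum.inl i) (Sum.inl j) = 0 ∧ P.mat (Sum.inl i) (Sum.inr j) = 0 ∧
    P.mat (Sum.inr i) (Sum.inl j) = 0 ∧ P.mat (Sum.inr i) (Sum.inr j) = 0}
  mul_mem' := by
    intro P Q hP hQ i j hij
    have hm : (P * Q).mat = P.mat * Q.mat := rfl
    rw [hm]
    simp only [Matrix.mul_apply, Fintype.sum_sum_type, ← Finset.sum_add_distrib]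
    refine ⟨?_, ?_, ?_, ?_⟩ <;> refine Finset.sum_eq_zero fun k _ => ?_ <;>
      by_cases hk : i = k
    all_goals first
      | (subst hk; simp [hQ i j hij])
      | simp [hP i k hk]
  one_mem' := by
    intro i j hij
    have h1 : (1 : Sp2).mat = 1 := rfl
    rw [h1]
    simp [hij]
  inv_mem' := by
    intro P hP i j hij
    have h1 : (P⁻¹).mat = P.matᴴ := rfl
    rw [h1]
    simp [Matrix.conjTranspose_apply, hP j i hij.symm]

/-- The coset space `Sp(2) / (Sp(1) × Sp(1))`. Two matrices are identified if they differ by a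
factor from `Sp(1) × Sp(1)` on the left, so that `Pᴴ * diag {a, b, a, b} * P` depends on the
coset of `P` only. -/
abbrev SpCoset : Type := Quotient (QuotientGroup.rightRel spOneSpOne)

/-- The coset of a matrix. -/
def toCoset (P : Sp2) : SpCoset := Quotient.mk _ P

/-- The normalized invariant measure `ν` on `Sp(2) / (Sp(1) × Sp(1))`: the image of the normalized
Haar measure. -/
def haarCoset : Measure SpCoset := haarSp2.map toCoset

/-- A measurable choice of a representing matrix in each coset. -/
structure IsMeasurableSection (s : SpCoset → Sp2) : Prop where
  measurable : Measurable s
  toCoset_eq : ∀ q, toCoset (s q) = q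

/-! ### Measurable sections exist

On the matrices whose quaternion diagonal does not vanish, `P` is normalised by multiplying it
on the left by the adjoint of its (rescaled) quaternion diagonal; the remaining matrices form a
single coset. -/

theorem isInducing_mat : Topology.IsInducing Sp2.mat :=
  Topology.IsInducing.subtypeVal.comp Topology.IsInducing.subtypeVal

theorem mat_mul (P Q : Sp2) : (P * Q).mat = P.mat * Q.mat := rfl

theorem mat_inv (P : Sp2) : (P⁻¹).mat = P.matᴴ := rfl

theorem mat_mul_conjTranspose (P : Sp2) : P.mat * P.matᴴ = 1 := P.1.2.2

theorem conjTranspose_mul_mat (P : Sp2) : P.matᴴ * P.mat = 1 := P.1.2.1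

theorem mat_J (P : Sp2) : P.mat * Matrix.J (Fin 2) ℂ * P.matᵀ = Matrix.J (Fin 2) ℂ := P.2

theorem mat_mul_J (P : Sp2) :
    P.mat * Matrix.J (Fin 2) ℂ = Matrix.J (Fin 2) ℂ * P.matᴴᵀ := by
  have h : P.matᵀ * P.matᴴᵀ = 1 := by
    rw [← Matrix.transpose_mul, conjTranspose_mul_mat, Matrix.transpose_one]
  calc P.mat * Matrix.J (Fin 2) ℂ
      = P.mat * Matrix.J (Fin 2) ℂ * (P.matᵀ * P.matᴴᵀ) := by rw [h, Matrix.mul_one]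
    _ = Matrix.J (Fin 2) ℂ * P.matᴴᵀ := by rw [← Matrix.mul_assoc, mat_J]

theorem mat_inr_inr (P : Sp2) (i j : Fin 2) :
    P.mat (Sum.inr i) (Sum.inr j) = star (P.mat (Sum.inl i) (Sum.inl j)) := by
  have h := congrFun (congrFun (mat_mul_J P) (Sum.inr i)) (Sum.inl j)
  simpa [Matrix.mul_apply, Matrix.J, Matrix.fromBlocks, Matrix.one_apply] using h

theorem mat_inr_inl (P : Sp2) (i j : Fin 2) :
    P.mat (Sum.inr i) (Sum.inl j) = -star (P.mat (Sum.inl i) (Sum.inr j)) := by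
  have h := congrFun (congrFun (mat_mul_J P) (Sum.inr i)) (Sum.inr j)
  have h' : -P.mat (Sum.inr i) (Sum.inl j) = star (P.mat (Sum.inl i) (Sum.inr j)) := by
    simpa [Matrix.mul_apply, Matrix.J, Matrix.fromBlocks, Matrix.one_apply] using h
  rw [← h', neg_neg]

/-- The quaternion diagonal of a `4 × 4` matrix. -/
def quatDiag (M : Matrix I4 I4 ℂ) : Matrix I4 I4 ℂ :=
  Matrix.of fun i j => if Sum.elim id id i = Sum.elim id id j then M i j else 0

/-- The norm of the upper left quaternion entry. -/
def quatNorm (M : Matrix I4 I4 ℂ) : ℝ :=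
  Real.sqrt (‖M (Sum.inl 0) (Sum.inl 0)‖ ^ 2 + ‖M (Sum.inl 0) (Sum.inr 0)‖ ^ 2)

theorem quatNorm_sq (M : Matrix I4 I4 ℂ) : quatNorm M ^ 2 =
    ‖M (Sum.inl 0) (Sum.inl 0)‖ ^ 2 + ‖M (Sum.inl 0) (Sum.inr 0)‖ ^ 2 :=
  Real.sq_sqrt (by positivity)

theorem quatNorm_sq_one (P : Sp2) : quatNorm P.mat ^ 2 =
    ‖P.mat (Sum.inl 1) (Sum.inl 1)‖ ^ 2 + ‖P.mat (Sum.inl 1) (Sum.inr 1)‖ ^ 2 := by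
  rw [quatNorm_sq]
  have h1 := congrFun (congrFun (mat_mul_conjTranspose P) (Sum.inl 0)) (Sum.inl 0)
  have h2 := congrFun (congrFun (conjTranspose_mul_mat P) (Sum.inl 1)) (Sum.inl 1)
  simp only [Matrix.mul_apply, Fintype.sum_sum_type, Fin.sum_univ_two, Matrix.conjTranspose_apply,
    mat_inr_inl, Matrix.one_apply_eq, Complex.star_def] at h1 h2
  simp only [Complex.mul_conj', Complex.conj_mul'] at h1 h2
  norm_cast at h1 h2
  simp only [norm_neg, RCLike.norm_conj] at h2
  linarith

theorem quatDiag_mul_conjTranspose (P : Sp2) :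
    quatDiag P.mat * (quatDiag P.mat)ᴴ = ((quatNorm P.mat ^ 2 : ℝ) : ℂ) • 1 := by
  have h0 : (quatNorm P.mat : ℂ) ^ 2 = (‖P.mat (Sum.inl 0) (Sum.inl 0)‖ : ℂ) ^ 2
      + (‖P.mat (Sum.inl 0) (Sum.inr 0)‖ : ℂ) ^ 2 := by exact_mod_cast quatNorm_sq P.mat
  have h1 : (quatNorm P.mat : ℂ) ^ 2 = (‖P.mat (Sum.inl 1) (Sum.inl 1)‖ : ℂ) ^ 2
      + (‖P.mat (Sum.inl 1) (Sum.inr 1)‖ : ℂ) ^ 2 := by exact_mod_cast quatNorm_sq_one P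
  ext i j
  rcases i with i | i <;> rcases j with j | j <;> fin_cases i <;> fin_cases j <;>
    simp [quatDiag, Matrix.mul_apply, mat_inr_inl, mat_inr_inr, Complex.mul_conj']
  all_goals first
    | exact h0.symm
    | exact h1.symm
    | (rw [h0]; ring1)
    | (rw [h1]; ring1)
    | ring1

theorem quatDiag_mul_J (P : Sp2) : quatDiag P.mat * Matrix.J (Fin 2) ℂ =
    Matrix.J (Fin 2) ℂ * (quatDiag P.mat)ᴴᵀ := by
  ext i j
  rcases i with i | i <;> rcases j with j | j <;> fin_cases i <;> fin_cases j <;>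
    simp [quatDiag, Matrix.mul_apply, mat_inr_inl, mat_inr_inr, Matrix.J, Matrix.fromBlocks,
      Matrix.one_apply]

theorem quatDiag_mul {K : Sp2} (hK : K ∈ spOneSpOne) (M : Matrix I4 I4 ℂ) :
    quatDiag (K.mat * M) = K.mat * quatDiag M := by
  have h01 := hK 0 1 (by decide)
  have h10 := hK 1 0 (by decide)
  ext i j
  rcases i with i | i <;> rcases j with j | j <;> fin_cases i <;> fin_cases j <;>
    simp [quatDiag, Matrix.mul_apply, h01, h10]

theorem quatNorm_mul {K : Sp2} (hK : K ∈ spOneSpOne) (P : Sp2) :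
    quatNorm (K * P).mat = quatNorm P.mat := by
  have h1 := quatDiag_mul_conjTranspose (K * P)
  rw [mat_mul, quatDiag_mul hK, Matrix.conjTranspose_mul, Matrix.mul_assoc,
    ← Matrix.mul_assoc (quatDiag P.mat), quatDiag_mul_conjTranspose, Matrix.smul_mul,
    Matrix.one_mul, Matrix.mul_smul, mat_mul_conjTranspose] at h1
  have h2 := congrFun (congrFun h1 (Sum.inl 0)) (Sum.inl 0)
  simp only [Matrix.smul_apply, Matrix.one_apply_eq, smul_eq_mul, mul_one] at h2
  have h3 : quatNorm P.mat ^ 2 = quatNorm (K.mat * P.mat) ^ 2 := by exact_mod_cast h2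
  rw [mat_mul]
  exact ((sq_eq_sq₀ (Real.sqrt_nonneg _) (Real.sqrt_nonneg _)).1 h3).symm

/-- The adjoint of the quaternion diagonal of `P`, rescaled to an element of `Sp(1) × Sp(1)`. -/
def quatUnit (P : Sp2) (h : quatNorm P.mat ≠ 0) : Sp2 :=
  ⟨⟨((quatNorm P.mat : ℂ)⁻¹) • quatDiag P.mat, by
    rw [Matrix.mem_unitaryGroup_iff, Matrix.star_eq_conjTranspose, Matrix.conjTranspose_smul,
      Matrix.smul_mul, Matrix.mul_smul, quatDiag_mul_conjTranspose, smul_smul, smul_smul]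
    have h' : (quatNorm P.mat : ℂ) ≠ 0 := by exact_mod_cast h
    have : (quatNorm P.mat : ℂ)⁻¹ * star (quatNorm P.mat : ℂ)⁻¹ * ((quatNorm P.mat ^ 2 : ℝ) : ℂ)
        = 1 := by
      rw [star_inv₀, Complex.star_def, Complex.conj_ofReal]
      push_cast
      field_simp
    rw [this, one_smul]⟩, by
    change _ * _ * _ = _
    have h' : (quatNorm P.mat : ℂ) ≠ 0 := by exact_mod_cast h
    have h2 : (quatDiag P.mat)ᴴᵀ * (quatDiag P.mat)ᵀ = ((quatNorm P.mat ^ 2 : ℝ) : ℂ) • 1 := by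
      rw [← Matrix.transpose_mul, quatDiag_mul_conjTranspose, Matrix.transpose_smul,
        Matrix.transpose_one]
    change ((quatNorm P.mat : ℂ)⁻¹ • quatDiag P.mat) * Matrix.J (Fin 2) ℂ *
      ((quatNorm P.mat : ℂ)⁻¹ • quatDiag P.mat)ᵀ = Matrix.J (Fin 2) ℂ
    rw [Matrix.transpose_smul, Matrix.smul_mul, Matrix.smul_mul, Matrix.mul_smul,
      quatDiag_mul_J, Matrix.mul_assoc, h2, Matrix.mul_smul, Matrix.mul_one, smul_smul, smul_smul]
    have : (quatNorm P.mat : ℂ)⁻¹ * (quatNorm P.mat : ℂ)⁻¹ * ((quatNorm P.mat ^ 2 : ℝ) : ℂ)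
        = 1 := by
      push_cast
      field_simp
    rw [this, one_smul]⟩⁻¹

theorem quatUnit_mat (P : Sp2) (h : quatNorm P.mat ≠ 0) :
    (quatUnit P h).mat = ((quatNorm P.mat : ℂ)⁻¹) • (quatDiag P.mat)ᴴ := by
  change (((quatNorm P.mat : ℂ)⁻¹) • quatDiag P.mat)ᴴ = _
  rw [Matrix.conjTranspose_smul, star_inv₀, Complex.star_def, Complex.conj_ofReal]

theorem quatUnit_mem (P : Sp2) (h : quatNorm P.mat ≠ 0) : quatUnit P h ∈ spOneSpOne := by
  intro i j hij
  simp [quatUnit_mat, quatDiag, hij.symm]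

/-- The matrix exchanging the two quaternion coordinates. -/
def swapMat : Sp2 :=
  ⟨⟨Matrix.fromBlocks !![0, 1; 1, 0] 0 0 !![0, 1; 1, 0], by
    rw [Matrix.mem_unitaryGroup_iff, Matrix.star_eq_conjTranspose, Matrix.fromBlocks_conjTranspose,
      Matrix.fromBlocks_multiply, ← Matrix.fromBlocks_one]
    congr 1 <;> ext i j <;> fin_cases i <;> fin_cases j <;>
      simp [Matrix.vecMul, dotProduct]⟩, by
    change Matrix.fromBlocks !![0, 1; 1, 0] 0 0 !![0, 1; 1, 0] * Matrix.J (Fin 2) ℂ *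
      (Matrix.fromBlocks !![0, 1; 1, 0] 0 0 !![0, 1; 1, 0])ᵀ = Matrix.J (Fin 2) ℂ
    rw [Matrix.J, Matrix.fromBlocks_transpose, Matrix.fromBlocks_multiply,
      Matrix.fromBlocks_multiply]
    congr 1 <;> ext i j <;> fin_cases i <;> fin_cases j <;>
      simp [Matrix.vecMul, dotProduct]⟩

theorem toCoset_eq_iff (P Q : Sp2) : toCoset P = toCoset Q ↔ Q * P⁻¹ ∈ spOneSpOne := by
  rw [toCoset, toCoset, Quotient.eq, QuotientGroup.rightRel_apply]

theorem toCoset_swapMat (P : Sp2) (h : quatNorm P.mat = 0) : toCoset swapMat = toCoset P := by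
  rw [toCoset_eq_iff]
  have h0 := quatNorm_sq P.mat
  have h1 := quatNorm_sq_one P
  rw [h] at h0 h1
  have e1 : P.mat (Sum.inl 0) (Sum.inl 0) = 0 := by
    rw [← norm_eq_zero]; nlinarith [norm_nonneg (P.mat (Sum.inl 0) (Sum.inl 0))]
  have e2 : P.mat (Sum.inl 0) (Sum.inr 0) = 0 := by
    rw [← norm_eq_zero]; nlinarith [norm_nonneg (P.mat (Sum.inl 0) (Sum.inr 0))]
  have e3 : P.mat (Sum.inl 1) (Sum.inl 1) = 0 := by
    rw [← norm_eq_zero]; nlinarith [norm_nonneg (P.mat (Sum.inl 1) (Sum.inl 1))]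
  have e4 : P.mat (Sum.inl 1) (Sum.inr 1) = 0 := by
    rw [← norm_eq_zero]; nlinarith [norm_nonneg (P.mat (Sum.inl 1) (Sum.inr 1))]
  have hw : swapMat.mat = Matrix.fromBlocks !![0, 1; 1, 0] 0 0 !![0, 1; 1, 0] := rfl
  intro i j hij
  rw [mat_mul, mat_inv, hw]
  fin_cases i <;> fin_cases j <;> first
    | exact absurd rfl hij
    | simp [Matrix.mul_apply, mat_inr_inl, mat_inr_inr, e1, e2, e3, e4]

open Classical in
/-- The representative of the coset of `P`. -/
def representative (P : Sp2) : Sp2 :=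
  if h : quatNorm P.mat = 0 then swapMat else quatUnit P h * P

theorem toCoset_representative (P : Sp2) : toCoset (representative P) = toCoset P := by
  by_cases h : quatNorm P.mat = 0
  · rw [representative, dif_pos h, toCoset_swapMat P h]
  · rw [representative, dif_neg h, toCoset_eq_iff, _root_.mul_inv_rev, mul_inv_cancel_left]
    exact inv_mem (quatUnit_mem P h)

theorem representative_mul {K : Sp2} (hK : K ∈ spOneSpOne) (P : Sp2) :
    representative (K * P) = representative P := by
  have hn := quatNorm_mul hK P
  by_cases h : quatNorm P.mat = 0
  · rw [representative, representative, dif_pos h, dif_pos (hn.trans h)]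
  · have h' : quatNorm (K * P).mat ≠ 0 := by rwa [hn]
    rw [representative, representative, dif_neg h, dif_neg h']
    apply Subtype.ext
    apply Subtype.ext
    change (quatUnit (K * P) h' * (K * P)).mat = (quatUnit P h * P).mat
    rw [mat_mul, mat_mul, mat_mul, quatUnit_mat, quatUnit_mat, hn, mat_mul, quatDiag_mul hK,
      Matrix.conjTranspose_mul, Matrix.smul_mul, Matrix.smul_mul, Matrix.mul_assoc,
      ← Matrix.mul_assoc K.matᴴ, conjTranspose_mul_mat, Matrix.one_mul]

theorem measurable_representative : Measurable representative := by
  classical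
  have hc : Continuous Sp2.mat := isInducing_mat.continuous
  have hentry : ∀ i j, Continuous fun P : Sp2 => P.mat i j := fun i j =>
    (continuous_apply j).comp ((continuous_apply i).comp hc)
  have hn : Continuous fun P : Sp2 => quatNorm P.mat :=
    Real.continuous_sqrt.comp
      (((hentry _ _).norm.pow 2).add ((hentry _ _).norm.pow 2))
  have hd : Continuous fun P : Sp2 => quatDiag P.mat := by
    refine continuous_matrix fun i j => ?_
    by_cases hij : (Sum.elim id id i : Fin 2) = Sum.elim id id j
    · simpa [quatDiag, hij] using hentry i j
    · simpa [quatDiag, hij] using continuous_const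
  let S : Set Sp2 := {P | quatNorm P.mat = 0}
  have hS : MeasurableSet S := (isClosed_eq hn continuous_const).measurableSet
  have heq : representative = S.piecewise (fun _ => swapMat) representative := by
    funext P
    by_cases h : P ∈ S
    · rw [Set.piecewise_eq_of_mem _ _ _ h, representative, dif_pos (show quatNorm P.mat = 0 from h)]
    · rw [Set.piecewise_eq_of_notMem _ _ _ h]
  rw [heq]
  refine ContinuousOn.measurable_piecewise continuousOn_const ?_ hS
  rw [isInducing_mat.continuousOn_iff]
  have hg : ContinuousOn (fun P : Sp2 => ((quatNorm P.mat : ℂ)⁻¹ • (quatDiag P.mat)ᴴ) * P.mat)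
      Sᶜ := by
    have hi : ContinuousOn (fun P : Sp2 => (quatNorm P.mat : ℂ)⁻¹) Sᶜ :=
      ContinuousOn.inv₀ (Complex.continuous_ofReal.comp hn).continuousOn fun P hP => by
        exact_mod_cast hP
    exact (hi.smul hd.matrix_conjTranspose.continuousOn).mul hc.continuousOn
  refine hg.congr fun P hP => ?_
  have hP' : quatNorm P.mat ≠ 0 := hP
  change (representative P).mat = _
  rw [representative, dif_neg hP', mat_mul, quatUnit_mat]

theorem exists_isMeasurableSection : ∃ s, IsMeasurableSection s := by
  refine ⟨Quotient.lift representative ?_, ?_, ?_⟩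
  · intro P Q h
    have h' : Q * P⁻¹ ∈ spOneSpOne := QuotientGroup.rightRel_apply.1 h
    have := representative_mul h' P
    rwa [inv_mul_cancel_right, eq_comm] at this
  · exact measurable_from_quotient.2 measurable_representative
  · intro q
    induction q using Quotient.inductionOn with
    | h P => exact toCoset_representative P

/-! ### The two integrands -/

/-- The integrand of the representation over `F_{-n}, …, F_n`; `p j` are the parameters
`(x_j, y_j, w_{j1}, w_{j2})` of `F_j`. -/
def selfDualIntegrand (n : ℕ) (W lam0 : ℝ) (xi : Fin 2 → ℝ)
    (p : Fin (2 * n + 1) → ℝ × ℝ × ℂ × ℂ) : ℂ :=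
  Complex.exp (-((W : ℂ) ^ 2 / 4) * ∑ j : Fin (2 * n),
      Matrix.trace ((selfDual (p j.succ) - selfDual (p j.castSucc)) ^ 2)) *
  Complex.exp (-(1 / 4 : ℂ) * ∑ j, Matrix.trace
      ((selfDual (p j) + (Complex.I / 2) • diag4 lam0 lam0
        + (Complex.I / (scaleN n lam0 : ℂ)) • diag4 (xi 0) (xi 1)) ^ 2)) *
  ∏ j, sqrtDet (selfDual (p j) - (Complex.I / 2) • diag4 lam0 lam0)

/-- `f(x) = (x + i lam0 / 2)² / 2 - log (x - i lam0 / 2)`. -/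
def actionF (lam0 x : ℝ) : ℂ :=
  ((x : ℂ) + Complex.I * lam0 / 2) ^ 2 / 2 - Complex.log ((x : ℂ) - Complex.I * lam0 / 2)

/-- `R_k = Q_k Q_{k-1} ⋯ Q_{-n+1}`, with `R_{-n} = 1`; here `Q j` stands for the matrix at the
site `j.succ`. -/
def cumProd {n : ℕ} (Q : Fin (2 * n) → Sp2) : Fin (2 * n + 1) → Sp2 :=
  Fin.induction (motive := fun _ => Sp2) 1 fun j R => Q j * R

/-- The integrand of the representation over eigenvalues and symplectic matrices. -/
def angularIntegrand (n : ℕ) (W lam0 : ℝ) (xi : Fin 2 → ℝ) (a b : Fin (2 * n + 1) → ℝ)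
    (P : Sp2) (Q : Fin (2 * n) → Sp2) : ℂ :=
  Complex.exp (-((W : ℂ) ^ 2 / 4) * ∑ j : Fin (2 * n), Matrix.trace
      (((Q j).matᴴ * diag4 (a j.succ) (b j.succ) * (Q j).mat
        - diag4 (a j.castSucc) (b j.castSucc)) ^ 2)) *
  Complex.exp (-(∑ j, (actionF lam0 (a j) + actionF lam0 (b j)))
    - Complex.I / (2 * (scaleN n lam0 : ℂ)) * ∑ j, Matrix.trace
        (((cumProd Q j).mat * P.mat)ᴴ * diag4 (a j) (b j) * ((cumProd Q j).mat * P.mat)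
          * diag4 (xi 0) (xi 1))) *
  ∏ j, ((a j : ℂ) - b j) ^ 4

/-- `C(ξ) = exp (lam0 (ξ₁ + ξ₂) / (2 ρ(lam0)) + (ξ₁² + ξ₂²) / (2 N ρ(lam0)²))`. -/
def constC (n : ℕ) (lam0 : ℝ) (xi : Fin 2 → ℝ) : ℝ :=
  Real.exp (lam0 * (xi 0 + xi 1) / (2 * semicircleDensity lam0)
    + (xi 0 ^ 2 + xi 1 ^ 2) /
      (2 * ((2 * n + 1 : ℕ) : ℝ) * semicircleDensity lam0 ^ 2))

end RBM

end

/-! The proof is Hubbard–Stratonovich duality carried out in a Grassmann algebra, followed by polar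
coordinates on quaternion self-dual matrices.

Formula (1). With four generators per site, two for each determinant, a product of two determinants
is a Berezin integral of an exponential linear in the entries of `H` (`det_mul_det_eq_berezin`).
Only products of two generators occur, so everything lives in a commutative ring where the exponents
are nilpotent and the exponentials are polynomials. The rule E exp(g c) = exp(τ c + v c² / 2) is
then a formal statement about moments (`integral_functional_prod_exp`). Averaging over `H` gives the
exponential of ½ ∑ J i j • `dualForm i j` (`mixedMoment_eq_berezin`), where anticommutation has
turned each term into a bilinear at `i` times a bilinear at `j` (`edgeForm_sq`). The same exponent
arises from averaging an exponential linear in six real coordinates per site with covariance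
proportional to `J` (`sum_coordForm_mul`, `sum_sourceForm_sq`). In that form the Berezin integral
factorises over the sites, each factor being up to sign a quaternion determinant
(`berezin_exp_siteForm`). The imaginary shift of `F` enters as an imaginary mean and restores the
spectral parameters; no contour is moved. This yields `selfDual_representation`.

Formula (2). Write F = t + K with K traceless. Then K ranges over a copy of ℝ⁵ and K² = r², where r
is the Euclidean norm of its coordinates. `Sp(2)` acts by measure-preserving maps, and every F lies
in the orbit of diag(t + r, t - r, t + r, t - r) (`exists_conjParams_eq`). Averaging over the group
and using polar coordinates in ℝ⁵ gives the eigenvalue density (π² / 12)(a - b)⁴ (`weyl_lintegral`).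
The matrix Pᴴ diag(a, b, a, b) P depends only on the coset of P, and right multiplication preserves
the coset measure. So the cosets of R_j P_{-n} at the separate sites are independent and distributed
according to ν (`measurePreserving_unfoldCosets`). The constants combine as (2π³)⁻¹ · π² / 12 =
(24π)⁻¹ per site, and C(ξ) collects the terms of the expanded square that contain no integration
variable. -/

noncomputable section

namespace RBM

open Matrix MeasureTheory

/-! ### The even part of a Grassmann algebra with four generators per site -/

/-- The space spanned by the generators: four for each of `N` sites. -/
abbrev GenSpace (N : ℕ) : Type := Fin N × Fin 4 → ℂ

/-- The products of two vectors in the Grassmann algebra. -/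
def bilinearSet (N : ℕ) : Set (ExteriorAlgebra ℂ (GenSpace N)) :=
  {x | ∃ v w, x = ExteriorAlgebra.ι ℂ v * ExteriorAlgebra.ι ℂ w}

theorem ι_mul_ι_swap {N : ℕ} (v w : GenSpace N) :
    ExteriorAlgebra.ι ℂ v * ExteriorAlgebra.ι ℂ w =
      -(ExteriorAlgebra.ι ℂ w * ExteriorAlgebra.ι ℂ v) :=
  eq_neg_of_add_eq_zero_left (ExteriorAlgebra.ι_add_mul_swap v w)

/-- Moving two vectors past two others costs four sign changes. This makes the generated subalgebra
a commutative ring, so `ring`, `nilradical` and `IsNilpotent.exp` apply to it. -/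
theorem bilinearSet_commute {N : ℕ} : ∀ a ∈ bilinearSet N, ∀ b ∈ bilinearSet N,
    a * b = b * a := by
  rintro _ ⟨v, w, rfl⟩ _ ⟨x, y, rfl⟩
  set e := ExteriorAlgebra.ι ℂ (M := GenSpace N)
  calc e v * e w * (e x * e y) = e v * (e w * e x) * e y := by noncomm_ring
    _ = -(e v * e x * (e w * e y)) := by rw [ι_mul_ι_swap w x]; noncomm_ring
    _ = e x * e v * (e w * e y) := by rw [ι_mul_ι_swap v x]; noncomm_ring
    _ = -(e x * (e v * e y) * e w) := by rw [ι_mul_ι_swap w y]; noncomm_ring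
    _ = e x * e y * (e v * e w) := by rw [ι_mul_ι_swap v y]; noncomm_ring

/-- The subalgebra generated by the products of two vectors, a commutative ring. -/
def EvenGrassmann (N : ℕ) : Type := Algebra.adjoin ℂ (bilinearSet N)

/-- The ring structure of `EvenGrassmann N`. -/
def evenGrassmannCommRing (N : ℕ) : CommRing (EvenGrassmann N) :=
  { (Algebra.adjoin ℂ (bilinearSet N)).toRing with
    mul_comm := (Algebra.isMulCommutative_adjoin ℂ bilinearSet_commute).is_comm.comm }

instance (N : ℕ) : CommRing (EvenGrassmann N) := evenGrassmannCommRing N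

/-- The algebra structure of `EvenGrassmann N`. -/
def evenGrassmannAlgebra (N : ℕ) : Algebra ℂ (EvenGrassmann N) :=
  (Algebra.adjoin ℂ (bilinearSet N)).algebra

instance (N : ℕ) : Algebra ℂ (EvenGrassmann N) := evenGrassmannAlgebra N

instance (N : ℕ) : Module ℚ (EvenGrassmann N) :=
  Module.compHom _ (algebraMap ℚ ℂ)

/-- The inclusion into the Grassmann algebra. -/
def evenIncl (N : ℕ) : EvenGrassmann N →ₐ[ℂ] ExteriorAlgebra ℂ (GenSpace N) :=
  (Algebra.adjoin ℂ (bilinearSet N)).val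

theorem evenIncl_injective (N : ℕ) : Function.Injective (evenIncl N) := Subtype.val_injective

/-- The product of two vectors. -/
def bil {N : ℕ} (v w : GenSpace N) : EvenGrassmann N :=
  ⟨ExteriorAlgebra.ι ℂ v * ExteriorAlgebra.ι ℂ w, Algebra.subset_adjoin ⟨v, w, rfl⟩⟩

theorem evenIncl_bil {N : ℕ} (v w : GenSpace N) :
    evenIncl N (bil v w) = ExteriorAlgebra.ι ℂ v * ExteriorAlgebra.ι ℂ w := rfl

theorem bil_swap {N : ℕ} (v w : GenSpace N) : bil v w = -bil w v :=
  evenIncl_injective N <| by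
    rw [map_neg, evenIncl_bil, evenIncl_bil, ι_mul_ι_swap]

theorem bil_self {N : ℕ} (v : GenSpace N) : bil v v = 0 :=
  evenIncl_injective N <| by
    rw [map_zero, evenIncl_bil, ExteriorAlgebra.ι_sq_zero]

/-- Exchanging the two inner vectors costs one sign. Together with `bil_swap` and `bil_self` this
gives every relation between pairings used below. -/
theorem bil_mul_bil {N : ℕ} (u v w x : GenSpace N) :
    bil u v * bil w x = -(bil u w * bil v x) :=
  evenIncl_injective N <| by
    rw [map_neg, map_mul, map_mul]
    simp only [evenIncl_bil]
    rw [mul_assoc, ← mul_assoc (ExteriorAlgebra.ι ℂ v), ι_mul_ι_swap v w]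
    noncomm_ring

theorem bil_sq {N : ℕ} (v w : GenSpace N) : bil v w * bil v w = 0 := by
  rw [bil_mul_bil, bil_self, zero_mul, neg_zero]

theorem bil_sum_smul {N : ℕ} {κ : Type*} (s : Finset κ) (v : GenSpace N) (r : κ → ℂ)
    (w : κ → GenSpace N) : bil v (∑ k ∈ s, r k • w k) = ∑ k ∈ s, r k • bil v (w k) :=
  evenIncl_injective N <| by
    rw [map_sum]
    simp only [evenIncl_bil, map_sum, map_smul, Finset.mul_sum, mul_smul_comm]

/-- The coefficient of the product of all generators, as a functional on the Grassmann algebra. -/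
def topCoeffAlternating (N k : ℕ) : (GenSpace N) [⋀^Fin k]→ₗ[ℂ] ℂ :=
  -- `liftAlternating` takes one alternating form per degree. Only degree `4N` receives a nonzero
  -- one: the determinant, with the generators ordered site by site.
  if h : N * 4 = k then
    (Pi.basisFun ℂ (Fin N × Fin 4)).det.domDomCongr (finProdFinEquiv.trans (finCongr h))
  else 0

/-- The Berezin integral: the coefficient of the product of all generators. -/
def berezin (N : ℕ) : EvenGrassmann N →ₗ[ℂ] ℂ :=
  (ExteriorAlgebra.liftAlternating (topCoeffAlternating N)) ∘ₗ (evenIncl N).toLinearMap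

/-- The span of the products of at most `k` vectors. -/
def degLE (N k : ℕ) : Submodule ℂ (EvenGrassmann N) :=
  (Submodule.span ℂ {x | ∃ l : List (GenSpace N), l.length ≤ k ∧
    x = (l.map (ExteriorAlgebra.ι ℂ)).prod}).comap (evenIncl N).toLinearMap

theorem degLE_mono {N j k : ℕ} (h : j ≤ k) : degLE N j ≤ degLE N k := by
  refine Submodule.comap_mono (Submodule.span_mono ?_)
  rintro _ ⟨l, hl, rfl⟩
  exact ⟨l, hl.trans h, rfl⟩

theorem mul_mem_degLE {N j k : ℕ} {x y : EvenGrassmann N} (hx : x ∈ degLE N j)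
    (hy : y ∈ degLE N k) : x * y ∈ degLE N (j + k) := by
  have h := Submodule.mul_mem_mul (Submodule.mem_comap.1 hx) (Submodule.mem_comap.1 hy)
  rw [Submodule.span_mul_span] at h
  rw [degLE, Submodule.mem_comap, AlgHom.toLinearMap_apply, map_mul]
  refine Submodule.span_mono ?_ h
  rintro _ ⟨_, ⟨l, hl, rfl⟩, _, ⟨l', hl', rfl⟩, rfl⟩
  refine ⟨l ++ l', ?_, ?_⟩
  · rw [List.length_append]; omega
  · simp

theorem one_mem_degLE (N : ℕ) : (1 : EvenGrassmann N) ∈ degLE N 0 := by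
  change evenIncl N 1 ∈ Submodule.span ℂ _
  rw [map_one]
  exact Submodule.subset_span ⟨[], le_rfl, by simp⟩

theorem bil_mem_degLE {N : ℕ} (v w : GenSpace N) : bil v w ∈ degLE N 2 := by
  change evenIncl N _ ∈ Submodule.span ℂ _
  exact Submodule.subset_span ⟨[v, w], le_rfl, by simp [evenIncl_bil]⟩

theorem berezin_eq_zero {N k : ℕ} (hk : k < N * 4) {x : EvenGrassmann N} (hx : x ∈ degLE N k) :
    berezin N x = 0 := by
  have h : Submodule.span ℂ {x | ∃ l : List (GenSpace N), l.length ≤ k ∧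
      x = (l.map (ExteriorAlgebra.ι ℂ)).prod} ≤
      LinearMap.ker (ExteriorAlgebra.liftAlternating (topCoeffAlternating N)) := by
    rw [Submodule.span_le]
    rintro _ ⟨l, hl, rfl⟩
    have h1 : (l.map (ExteriorAlgebra.ι ℂ)).prod =
        ExteriorAlgebra.ιMulti ℂ l.length l.get := by
      rw [ExteriorAlgebra.ιMulti_apply]
      congr 1
      conv_lhs => rw [← List.ofFn_get l]
      rw [List.map_ofFn]
      rfl
    rw [SetLike.mem_coe, LinearMap.mem_ker, h1, ExteriorAlgebra.liftAlternating_apply_ιMulti,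
      topCoeffAlternating, dif_neg (by omega)]
    rfl
  exact h hx

/-- When the product is expanded, every term except `∏ Y` contains a factor `X j`, which falls short
of the maximal degree 4 by at least one. -/
theorem prod_add_sub_prod_mem {N : ℕ} {κ : Type*} [DecidableEq κ] (X Y : κ → EvenGrassmann N)
    (hX : ∀ j, X j ∈ degLE N 3) (hY : ∀ j, Y j ∈ degLE N 4) (s : Finset κ) :
    ∏ j ∈ s, (X j + Y j) ∈ degLE N (s.card * 4) ∧
      (s.Nonempty → ∏ j ∈ s, (X j + Y j) - ∏ j ∈ s, Y j ∈ degLE N (s.card * 4 - 1)) := by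
  induction s using Finset.induction_on with
  | empty => exact ⟨by simpa using one_mem_degLE N, fun h => absurd h (by simp)⟩
  | insert a s ha ih =>
    rw [Finset.prod_insert ha, Finset.prod_insert ha, Finset.card_insert_of_notMem ha]
    have hXP := mul_mem_degLE (hX a) ih.1
    refine ⟨?_, fun _ => ?_⟩
    · have := mul_mem_degLE (add_mem (degLE_mono (by omega) (hX a)) (hY a)) ih.1
      exact degLE_mono (by omega) this
    · have hsplit : (X a + Y a) * ∏ j ∈ s, (X j + Y j) - Y a * ∏ j ∈ s, Y j =
          X a * ∏ j ∈ s, (X j + Y j) + Y a * (∏ j ∈ s, (X j + Y j) - ∏ j ∈ s, Y j) := by ring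
      rw [hsplit]
      refine add_mem (degLE_mono (by omega) hXP) ?_
      rcases s.eq_empty_or_nonempty with rfl | hs
      · simp
      · have hc := hs.card_pos
        exact degLE_mono (by omega) (mul_mem_degLE (hY a) (ih.2 hs))

/-- The Berezin integral sees only degree `4N`, so each of the `N` factors must supply its full
degree 4. This picks a single term out of each expanded exponential. -/
theorem berezin_prod_add {N : ℕ} (X Y : Fin N → EvenGrassmann N)
    (hX : ∀ j, X j ∈ degLE N 3) (hY : ∀ j, Y j ∈ degLE N 4) :
    berezin N (∏ j, (X j + Y j)) = berezin N (∏ j, Y j) := by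
  rcases isEmpty_or_nonempty (Fin N) with h | h
  · simp
  · have h1 := (prod_add_sub_prod_mem X Y hX hY Finset.univ).2 Finset.univ_nonempty
    have hN : 0 < N := Fin.pos_iff_nonempty.2 h
    have h2 := berezin_eq_zero (by simp; omega) h1
    rwa [map_sub, sub_eq_zero] at h2

theorem berezin_prod_bil {N : ℕ} (v : Fin N → Fin 4 → GenSpace N) :
    berezin N (∏ i, (bil (v i 0) (v i 1) * bil (v i 2) (v i 3))) =
      (Matrix.of fun p : Fin N × Fin 4 => v p.1 p.2).det := by
  have h : evenIncl N (∏ i, (bil (v i 0) (v i 1) * bil (v i 2) (v i 3))) =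
      ExteriorAlgebra.ιMulti ℂ (N * 4) fun k =>
        v (finProdFinEquiv.symm k).1 (finProdFinEquiv.symm k).2 := by
    rw [ExteriorAlgebra.ιMulti_apply, List.ofFn_mul, List.prod_flatten, List.map_ofFn,
      ← List.prod_ofFn, map_list_prod, List.map_ofFn]
    congr 2
    funext i
    have h4 : ∀ j : Fin 4, ∀ hlt, finProdFinEquiv.symm (⟨(i : ℕ) * 4 + j, hlt⟩ : Fin (N * 4)) =
        (i, j) := by
      intro j hlt
      rw [Equiv.symm_apply_eq]
      ext
      simp [finProdFinEquiv]
      ring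
    simp only [Function.comp, map_mul, evenIncl_bil, h4]
    simp [List.ofFn_succ, mul_assoc]
  change ExteriorAlgebra.liftAlternating (topCoeffAlternating N) (evenIncl N _) = _
  rw [h, ExteriorAlgebra.liftAlternating_apply_ιMulti, topCoeffAlternating, dif_pos rfl]
  rw [AlternatingMap.domDomCongr_apply, Module.Basis.det_apply, ← Matrix.det_transpose]
  congr 1
  ext p q
  rw [Matrix.transpose_apply, Module.Basis.toMatrix_apply, Pi.basisFun_repr]
  change v (finProdFinEquiv.symm (finProdFinEquiv p)).1
    (finProdFinEquiv.symm (finProdFinEquiv p)).2 q = v p.1 p.2 q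
  rw [Equiv.symm_apply_apply]

/-! ### Exponentials of nilpotent elements -/

section EvalTrunc

variable {A : Type*} [CommRing A] [Algebra ℂ A]

/-- The value at `c` of a power series truncated at order `K`. -/
def evalTrunc (K : ℕ) (c : A) (f : PowerSeries ℂ) : A :=
  ∑ k ∈ Finset.range K, PowerSeries.coeff k f • c ^ k

theorem evalTrunc_eq_aeval (K : ℕ) (c : A) (f : PowerSeries ℂ) :
    evalTrunc K c f = Polynomial.aeval c (PowerSeries.trunc K f) := by
  rw [Polynomial.aeval_def, PowerSeries.eval₂_trunc_eq_sum_range, evalTrunc]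
  exact Finset.sum_congr rfl fun k _ => Algebra.smul_def _ _

/-- The product of the truncations and the truncation of the product differ by a multiple of `X ^
K`, which vanishes at `c`. -/
theorem evalTrunc_mul {K : ℕ} {c : A} (hc : c ^ K = 0) (f g : PowerSeries ℂ) :
    evalTrunc K c (f * g) = evalTrunc K c f * evalTrunc K c g := by
  have h : (Polynomial.X : Polynomial ℂ) ^ K ∣ PowerSeries.trunc K f * PowerSeries.trunc K g -
      PowerSeries.trunc K (f * g) := by
    rw [Polynomial.X_pow_dvd_iff]
    intro d hd
    rw [Polynomial.coeff_sub, Polynomial.coeff_mul, PowerSeries.coeff_trunc, if_pos hd,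
      PowerSeries.coeff_mul, sub_eq_zero]
    refine Finset.sum_congr rfl fun p hp => ?_
    have hp' := Finset.HasAntidiagonal.mem_antidiagonal.1 hp
    rw [PowerSeries.coeff_trunc, PowerSeries.coeff_trunc, if_pos (by omega), if_pos (by omega)]
  obtain ⟨q, hq⟩ := h
  have h2 := congrArg (Polynomial.aeval c) hq
  rw [map_sub, map_mul, map_mul (Polynomial.aeval c), map_pow, Polynomial.aeval_X, hc, zero_mul, sub_eq_zero] at h2
  rw [evalTrunc_eq_aeval, evalTrunc_eq_aeval, evalTrunc_eq_aeval, h2]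

end EvalTrunc

section NilpotentExp

variable {A : Type*} [CommRing A]

theorem isNilpotent_finset_sum {κ : Type*} {s : Finset κ} {x : κ → A}
    (h : ∀ k ∈ s, IsNilpotent (x k)) : IsNilpotent (∑ k ∈ s, x k) :=
  mem_nilradical.1 (sum_mem fun k hk => mem_nilradical.2 (h k hk))

variable [Module ℚ A]

theorem exp_eq_one_add {x : A} (h : x * x = 0) : IsNilpotent.exp x = 1 + x := by
  rw [IsNilpotent.exp_eq_sum (k := 2) (by rw [pow_two, h])]
  simp [Finset.sum_range_succ]

theorem exp_finset_sum {κ : Type*} (s : Finset κ) (x : κ → A)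
    (h : ∀ k ∈ s, IsNilpotent (x k)) :
    IsNilpotent.exp (∑ k ∈ s, x k) = ∏ k ∈ s, IsNilpotent.exp (x k) := by
  classical
  induction s using Finset.induction_on with
  | empty => simp
  | insert a s ha ih =>
    rw [Finset.sum_insert ha, Finset.prod_insert ha, IsNilpotent.exp_add_of_commute
      (Commute.all _ _) (h a (Finset.mem_insert_self a s))
      (isNilpotent_finset_sum fun k hk => h k (Finset.mem_insert_of_mem hk)),
      ih fun k hk => h k (Finset.mem_insert_of_mem hk)]

variable [Algebra ℂ A]

/-- `IsNilpotent.exp` has rational coefficients, while the functionals applied to it are complex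
linear. -/
theorem inv_natCast_smul (n : ℕ) (x : A) : (n : ℚ)⁻¹ • x = (n : ℂ)⁻¹ • x := by
  have h := smul_assoc ((n : ℚ)⁻¹) (1 : ℂ) x
  rw [one_smul] at h
  rw [← h]
  congr 1
  rw [Algebra.smul_def]
  simp

theorem exp_eq_sum_complex {x : A} {k : ℕ} (h : x ^ k = 0) :
    IsNilpotent.exp x = ∑ i ∈ Finset.range k, ((i.factorial : ℂ)⁻¹) • x ^ i := by
  rw [IsNilpotent.exp_eq_sum h]
  exact Finset.sum_congr rfl fun i _ => inv_natCast_smul _ _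

/-- The series `exp (v X ^ 2 / 2)`. -/
def gaussSeries (v : ℂ) : PowerSeries ℂ :=
  PowerSeries.mk fun k => if Even k then (v / 2) ^ (k / 2) * ((k / 2).factorial : ℂ)⁻¹ else 0

/-- The series `exp (τ X)`. -/
def shiftSeries (τ : ℂ) : PowerSeries ℂ :=
  PowerSeries.mk fun k => τ ^ k * (k.factorial : ℂ)⁻¹

theorem derivative_gaussSeries (v : ℂ) :
    PowerSeries.derivative ℂ (gaussSeries v) =
      PowerSeries.C v * PowerSeries.X * gaussSeries v := by
  ext k
  rw [mul_assoc, PowerSeries.coeff_C_mul, PowerSeries.coeff_derivative]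
  rcases k with _ | k
  · simp [gaussSeries]
  · rw [PowerSeries.coeff_succ_X_mul, gaussSeries, PowerSeries.coeff_mk, PowerSeries.coeff_mk]
    by_cases hk : Even k
    · obtain ⟨j, rfl⟩ := hk
      have h1 : (j + j + 1 + 1) / 2 = j + 1 := by omega
      have h2 : (j + j) / 2 = j := by omega
      rw [if_pos ⟨j + 1, by ring⟩, if_pos ⟨j, rfl⟩, h1, h2, Nat.factorial_succ]
      push_cast
      have h3 : (j : ℂ) + 1 ≠ 0 := by exact_mod_cast j.succ_ne_zero
      have h4 : (j.factorial : ℂ) ≠ 0 := by exact_mod_cast j.factorial_ne_zero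
      field_simp
      ring
    · have h1 : ¬ Even (k + 1 + 1) := by
        rwa [Nat.even_add_one, Nat.even_add_one, not_not]
      rw [if_neg hk, if_neg h1]
      simp

theorem derivative_shiftSeries (τ : ℂ) :
    PowerSeries.derivative ℂ (shiftSeries τ) = PowerSeries.C τ * shiftSeries τ := by
  ext k
  rw [PowerSeries.coeff_C_mul, PowerSeries.coeff_derivative, shiftSeries,
    PowerSeries.coeff_mk, PowerSeries.coeff_mk, Nat.factorial_succ]
  push_cast
  have h3 : (k : ℂ) + 1 ≠ 0 := by exact_mod_cast k.succ_ne_zero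
  have h4 : (k.factorial : ℂ) ≠ 0 := by exact_mod_cast k.factorial_ne_zero
  field_simp
  ring

/-- The sequence `m` satisfies the recursion of the moments of a Gaussian variable of mean `τ` and
variance `v`. -/
structure IsGaussMoments (τ v : ℂ) (m : ℕ → ℂ) : Prop where
  zero : m 0 = 1
  one : m 1 = τ
  add_two : ∀ k, m (k + 2) = τ * m (k + 1) + v * (k + 1) * m k

/-- The series `R` on the left satisfies R' = (τ + vX) R and R(0) = 1. Read coefficientwise, this
differential equation is the moment recursion divided by factorials. -/
theorem IsGaussMoments.coeff_eq {τ v : ℂ} {m : ℕ → ℂ} (h : IsGaussMoments τ v m) (k : ℕ) :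
    PowerSeries.coeff k (shiftSeries τ * gaussSeries v) = m k * (k.factorial : ℂ)⁻¹ := by
  set R := shiftSeries τ * gaussSeries v with hR
  have hd : PowerSeries.derivative ℂ R = PowerSeries.C τ * R +
      PowerSeries.C v * (PowerSeries.X * R) := by
    rw [hR, Derivation.leibniz, derivative_shiftSeries, derivative_gaussSeries, smul_eq_mul,
      smul_eq_mul]
    ring
  have h0 : PowerSeries.coeff 0 R = 1 := by
    simp [hR, shiftSeries, gaussSeries, PowerSeries.coeff_mul]
  have hstep : ∀ k, PowerSeries.coeff (k + 1) R * (k + 1) =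
      τ * PowerSeries.coeff k R + v * PowerSeries.coeff k (PowerSeries.X * R) := by
    intro k
    have := congrArg (PowerSeries.coeff k) hd
    rwa [PowerSeries.coeff_derivative, map_add, PowerSeries.coeff_C_mul,
      PowerSeries.coeff_C_mul] at this
  have h1 : PowerSeries.coeff 1 R = τ := by
    have := hstep 0
    simpa [h0] using this
  -- The recursion has two steps, so two consecutive coefficients are carried through the induction.
  suffices H : PowerSeries.coeff k R = m k * (k.factorial : ℂ)⁻¹ ∧
      PowerSeries.coeff (k + 1) R = m (k + 1) * ((k + 1).factorial : ℂ)⁻¹ from H.1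
  induction k with
  | zero => simp [h0, h1, h.zero, h.one]
  | succ k ih =>
    refine ⟨ih.2, ?_⟩
    have h2 := hstep (k + 1)
    rw [PowerSeries.coeff_succ_X_mul, ih.1, ih.2] at h2
    have h3 : ((k + 1 : ℕ) : ℂ) + 1 ≠ 0 := by exact_mod_cast (k + 1).succ_ne_zero
    have h3' : (k : ℂ) + 1 ≠ 0 := by exact_mod_cast k.succ_ne_zero
    have h4 : (k.factorial : ℂ) ≠ 0 := by exact_mod_cast k.factorial_ne_zero
    refine mul_right_cancel₀ h3 (h2.trans ?_)
    rw [h.add_two, Nat.factorial_succ (k + 1), Nat.factorial_succ k]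
    push_cast at h3 ⊢
    field_simp

theorem evalTrunc_shiftSeries {K : ℕ} {c : A} (hc : c ^ K = 0) (τ : ℂ) :
    evalTrunc K c (shiftSeries τ) = IsNilpotent.exp (τ • c) := by
  rw [exp_eq_sum_complex (k := K) (by rw [smul_pow, hc, smul_zero]), evalTrunc]
  refine Finset.sum_congr rfl fun k _ => ?_
  rw [shiftSeries, PowerSeries.coeff_mk, smul_pow, smul_smul, mul_comm]

theorem evalTrunc_gaussSeries {L : ℕ} {c : A} (hc : c ^ (2 * L) = 0) (v : ℂ) :
    evalTrunc (2 * L) c (gaussSeries v) = IsNilpotent.exp ((v / 2) • c ^ 2) := by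
  rw [exp_eq_sum_complex (k := L) (by rw [smul_pow, ← pow_mul, hc, smul_zero]), evalTrunc]
  clear hc
  induction L with
  | zero => simp
  | succ L ih =>
    rw [show 2 * (L + 1) = 2 * L + 1 + 1 by ring, Finset.sum_range_succ, Finset.sum_range_succ,
      Finset.sum_range_succ, ih]
    have h1 : PowerSeries.coeff (2 * L + 1) (gaussSeries v) = 0 := by
      rw [gaussSeries, PowerSeries.coeff_mk, if_neg (by rw [Nat.not_even_iff_odd]; exact ⟨L, rfl⟩)]
    have h2 : PowerSeries.coeff (2 * L) (gaussSeries v) =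
        (v / 2) ^ L * (L.factorial : ℂ)⁻¹ := by
      rw [gaussSeries, PowerSeries.coeff_mk, if_pos ⟨L, by ring⟩]
      simp
    rw [h1, h2, zero_smul, add_zero, smul_pow, smul_smul, ← pow_mul, mul_comm ((v / 2) ^ L)]

/-- This is the Gaussian moment generating function at a nilpotent argument, where it is a finite
sum and raises no question of convergence. -/
theorem IsGaussMoments.sum_eq_exp {τ v : ℂ} {m : ℕ → ℂ} (h : IsGaussMoments τ v m) {L : ℕ}
    {c : A} (hc : c ^ (2 * L) = 0) :
    ∑ k ∈ Finset.range (2 * L), (m k * (k.factorial : ℂ)⁻¹) • c ^ k =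
      IsNilpotent.exp (τ • c + (v / 2) • c ^ 2) := by
  have hn : IsNilpotent c := ⟨_, hc⟩
  rw [IsNilpotent.exp_add_of_commute (Commute.all _ _) (hn.smul _)
    ((hn.pow_of_pos two_ne_zero).smul _), ← evalTrunc_shiftSeries hc,
    ← evalTrunc_gaussSeries hc, ← evalTrunc_mul hc, evalTrunc]
  exact Finset.sum_congr rfl fun k _ => by rw [h.coeff_eq]

/-- The expectation of the exponential of a linear combination of independent variables with
nilpotent coefficients. -/
theorem integral_functional_prod_exp {κ : Type*} [Fintype κ] (μ : κ → Measure ℝ)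
    [∀ p, SigmaFinite (μ p)] (w : κ → ℝ → ℂ)
    (hw : ∀ p (k : ℕ), Integrable (fun x => w p x * (x : ℂ) ^ k) (μ p)) (Z τ v : κ → ℂ)
    (m : κ → ℕ → ℂ) (hm : ∀ p, IsGaussMoments (τ p) (v p) (m p))
    (hwm : ∀ p k, ∫ x, w p x * (x : ℂ) ^ k ∂μ p = Z p * m p k)
    (c : κ → A) (hc : ∀ p, IsNilpotent (c p)) (X : A) (Φ : A →ₗ[ℂ] ℂ) :
    Integrable (fun g : κ → ℝ => (∏ p, w p (g p)) *
      Φ (X * ∏ p, IsNilpotent.exp ((g p : ℂ) • c p))) (Measure.pi μ) ∧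
    ∫ g : κ → ℝ, (∏ p, w p (g p)) * Φ (X * ∏ p, IsNilpotent.exp ((g p : ℂ) • c p))
      ∂(Measure.pi μ) = (∏ p, Z p) *
        Φ (X * ∏ p, IsNilpotent.exp (τ p • c p + (v p / 2) • c p ^ 2)) := by
  classical
  choose L hL using hc
  -- An even truncation order is what `IsGaussMoments.sum_eq_exp` requires, since the variance term
  -- is a series in `c ^ 2`.
  have hL' : ∀ p, c p ^ (2 * L p) = 0 := fun p => by rw [mul_comm, pow_mul, hL, zero_pow two_ne_zero]
  let S : Finset ((p : κ) → ℕ) := Fintype.piFinset fun p => Finset.range (2 * L p)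
  -- This expansion is used twice: with coefficients `g ^ k / k!` under the integral, and with the
  -- moments `m k / k!` on the other side.
  have expand : ∀ r : κ → ℕ → ℂ, Φ (X * ∏ p, ∑ k ∈ Finset.range (2 * L p), r p k • c p ^ k) =
      ∑ k ∈ S, (∏ p, r p (k p)) * Φ (X * ∏ p, c p ^ k p) := by
    intro r
    rw [Finset.prod_univ_sum, Finset.mul_sum, map_sum]
    refine Finset.sum_congr rfl fun k _ => ?_
    rw [Finset.prod_smul, mul_smul_comm, map_smul, smul_eq_mul]
  have hlhs : (fun g : κ → ℝ => (∏ p, w p (g p)) *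
      Φ (X * ∏ p, IsNilpotent.exp ((g p : ℂ) • c p))) = fun g => ∑ k ∈ S,
        (∏ p, w p (g p) * (g p : ℂ) ^ k p) *
          ((∏ p, ((k p).factorial : ℂ)⁻¹) * Φ (X * ∏ p, c p ^ k p)) := by
    funext g
    have : ∀ p, IsNilpotent.exp ((g p : ℂ) • c p) = ∑ k ∈ Finset.range (2 * L p),
        ((g p : ℂ) ^ k * (k.factorial : ℂ)⁻¹) • c p ^ k := by
      intro p
      rw [exp_eq_sum_complex (k := 2 * L p) (by rw [smul_pow, hL', smul_zero])]
      refine Finset.sum_congr rfl fun k _ => ?_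
      rw [smul_pow, smul_smul, mul_comm]
    simp_rw [this]
    rw [expand, Finset.mul_sum]
    refine Finset.sum_congr rfl fun k _ => ?_
    rw [Finset.prod_mul_distrib, Finset.prod_mul_distrib]
    ring
  have hint : ∀ k : κ → ℕ, Integrable (fun g : κ → ℝ => ∏ p, w p (g p) * (g p : ℂ) ^ k p)
      (Measure.pi μ) := fun k =>
    Integrable.fintype_prod_dep (f := fun p x => w p x * (x : ℂ) ^ k p) fun p => hw p (k p)
  rw [hlhs]
  refine ⟨integrable_finsetSum _ fun k _ => (hint k).mul_const _, ?_⟩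
  rw [integral_finsetSum _ fun k _ => (hint k).mul_const _]
  simp_rw [integral_mul_const]
  have hsum : ∀ p, IsNilpotent.exp (τ p • c p + (v p / 2) • c p ^ 2) =
      ∑ k ∈ Finset.range (2 * L p), (m p k * (k.factorial : ℂ)⁻¹) • c p ^ k :=
    fun p => ((hm p).sum_eq_exp (hL' p)).symm
  simp_rw [hsum]
  rw [expand, Finset.mul_sum]
  refine Finset.sum_congr rfl fun k _ => ?_
  rw [integral_fintype_prod_eq_prod (f := fun p x => w p x * (x : ℂ) ^ k p)]
  simp_rw [hwm]
  rw [Finset.prod_mul_distrib, Finset.prod_mul_distrib]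
  ring

end NilpotentExp

/-! ### Determinants as Berezin integrals -/

section Berezin

variable {N : ℕ}

theorem mul_mem_degLE_four {x y : EvenGrassmann N} (hx : x ∈ degLE N 2) (hy : y ∈ degLE N 2) :
    x * y ∈ degLE N 4 :=
  degLE_mono (show 2 + 2 ≤ 4 by norm_num) (mul_mem_degLE hx hy)

/-- The `k`-th generator at the site `i`. -/
def gen (i : Fin N) (k : Fin 4) : GenSpace N := Pi.single (i, k) 1

theorem gen_apply (i j : Fin N) (k l : Fin 4) :
    gen i k (j, l) = if i = j ∧ k = l then 1 else 0 := by
  rw [gen, Pi.single_apply]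
  simp only [Prod.mk.injEq, eq_comm]

/-- The product of the `k`-th generator at the site `i` and the `l`-th generator at the site `j`. -/
def pairing (k l : Fin 4) (i j : Fin N) : EvenGrassmann N := bil (gen i k) (gen j l)

theorem pairing_mul_self (k l : Fin 4) (i j : Fin N) : pairing k l i j * pairing k l i j = 0 :=
  bil_sq _ _

theorem isNilpotent_pairing (k l : Fin 4) (i j : Fin N) : IsNilpotent (pairing k l i j) :=
  ⟨2, by rw [pow_two, pairing_mul_self]⟩

theorem pairing_mem_degLE (k l : Fin 4) (i j : Fin N) : pairing k l i j ∈ degLE N 2 :=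
  bil_mem_degLE _ _

theorem berezin_prod_pairing :
    berezin N (∏ i, (pairing 0 1 i i * pairing 2 3 i i)) = 1 := by
  have h := berezin_prod_bil (N := N) gen
  unfold pairing
  rw [h, ← Matrix.det_one (n := Fin N × Fin 4)]
  congr 1
  ext p q
  rw [Matrix.of_apply, gen_apply, Matrix.one_apply]
  simp only [Prod.ext_iff]

/-- Grouped by rows, the exponent is a sum of square-zero elements `x i` and `y i`, so the
exponential is `∏ (1 + x i) (1 + y i)`. Only `∏ x i * y i` has top degree, and its coefficient is
the determinant of a block matrix with blocks `1, X, 1, Y`. -/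
theorem det_mul_det_eq_berezin (X Y : Matrix (Fin N) (Fin N) ℂ) :
    X.det * Y.det = berezin N (IsNilpotent.exp (∑ i, ∑ j,
      (X i j • pairing 0 1 i j + Y i j • pairing 2 3 i j))) := by
  let x : Fin N → EvenGrassmann N := fun i => bil (gen i 0) (∑ j, X i j • gen j 1)
  let y : Fin N → EvenGrassmann N := fun i => bil (gen i 2) (∑ j, Y i j • gen j 3)
  have hx : ∀ i, x i * x i = 0 := fun i => bil_sq _ _
  have hy : ∀ i, y i * y i = 0 := fun i => bil_sq _ _
  have hnx : ∀ i, IsNilpotent (x i) := fun i => ⟨2, by rw [pow_two, hx]⟩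
  have hny : ∀ i, IsNilpotent (y i) := fun i => ⟨2, by rw [pow_two, hy]⟩
  have hsum : ∑ i, ∑ j, (X i j • pairing 0 1 i j + Y i j • pairing 2 3 i j) =
      ∑ i, (x i + y i) := by
    refine Finset.sum_congr rfl fun i _ => ?_
    rw [Finset.sum_add_distrib]
    simp only [x, y, bil_sum_smul, pairing]
  have hexp : IsNilpotent.exp (∑ i, (x i + y i)) = ∏ i, ((1 + x i + y i) + x i * y i) := by
    rw [exp_finset_sum _ _ fun i _ => (Commute.all _ _).isNilpotent_add (hnx i) (hny i)]
    refine Finset.prod_congr rfl fun i _ => ?_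
    rw [IsNilpotent.exp_add_of_commute (Commute.all _ _) (hnx i) (hny i),
      exp_eq_one_add (hx i), exp_eq_one_add (hy i)]
    ring
  rw [hsum, hexp, berezin_prod_add]
  · have h := berezin_prod_bil (N := N) fun i =>
      ![gen i 0, ∑ j, X i j • gen j 1, gen i 2, ∑ j, Y i j • gen j 3]
    have hM : (Matrix.of fun p : Fin N × Fin 4 =>
        (![gen p.1 0, ∑ j, X p.1 j • gen j 1, gen p.1 2, ∑ j, Y p.1 j • gen j 3] :
          Fin 4 → GenSpace N) p.2) = Matrix.blockDiagonal ![1, X, 1, Y] := by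
      ext ⟨i, k⟩ ⟨j, l⟩
      rw [Matrix.of_apply, Matrix.blockDiagonal_apply]
      revert k l
      simp only [Fin.forall_fin_succ, IsEmpty.forall_iff, and_true, Matrix.cons_val_zero,
        Matrix.cons_val_succ]
      simp [gen_apply, Matrix.one_apply]
    rw [hM, Matrix.det_blockDiagonal] at h
    simp only [Fin.prod_univ_four] at h
    simpa using h.symm
  · intro i
    exact add_mem (add_mem (degLE_mono (by omega) (one_mem_degLE N))
      (degLE_mono (by omega) (bil_mem_degLE _ _))) (degLE_mono (by omega) (bil_mem_degLE _ _))
  · exact fun i => mul_mem_degLE_four (bil_mem_degLE _ _) (bil_mem_degLE _ _)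

/-- A general linear combination of the products of two generators at one site. -/
def siteForm (z₁ z₂ u u' v v' : ℂ) (j : Fin N) : EvenGrassmann N :=
  z₁ • pairing 0 1 j j + z₂ • pairing 2 3 j j + u • pairing 0 2 j j + u' • pairing 1 3 j j +
    v • pairing 0 3 j j + v' • pairing 2 1 j j

/-- Two pairings of the four generators at a site multiply to the top element up to sign if they are
disjoint, and to zero if they share a generator. -/
theorem site_products (j : Fin N) :
    let t := pairing 0 1 j j * pairing 2 3 j j
    pairing 0 2 j j * pairing 1 3 j j = -t ∧ pairing 0 3 j j * pairing 2 1 j j = -t ∧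
    pairing 0 1 j j * pairing 0 2 j j = 0 ∧ pairing 0 1 j j * pairing 1 3 j j = 0 ∧
    pairing 0 1 j j * pairing 0 3 j j = 0 ∧ pairing 0 1 j j * pairing 2 1 j j = 0 ∧
    pairing 2 3 j j * pairing 0 2 j j = 0 ∧ pairing 2 3 j j * pairing 1 3 j j = 0 ∧
    pairing 2 3 j j * pairing 0 3 j j = 0 ∧ pairing 2 3 j j * pairing 2 1 j j = 0 ∧
    pairing 0 2 j j * pairing 0 3 j j = 0 ∧ pairing 0 2 j j * pairing 2 1 j j = 0 ∧
    pairing 1 3 j j * pairing 0 3 j j = 0 ∧ pairing 1 3 j j * pairing 2 1 j j = 0 := by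
  simp only [pairing]
  generalize gen j 0 = a
  generalize gen j 1 = b
  generalize gen j 2 = c
  generalize gen j 3 = d
  refine ⟨bil_mul_bil _ _ _ _, ?_, ?_, ?_, ?_, ?_, ?_, ?_, ?_, ?_, ?_, ?_, ?_, ?_⟩
  · rw [bil_swap c b, mul_neg, bil_mul_bil, neg_neg, bil_swap d c, mul_neg]
  · rw [bil_mul_bil, bil_self, zero_mul, neg_zero]
  · rw [bil_swap a b, neg_mul, bil_mul_bil, bil_self, zero_mul, neg_zero, neg_zero]
  · rw [bil_mul_bil, bil_self, zero_mul, neg_zero]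
  · rw [bil_swap c b, mul_neg, bil_swap a b, neg_mul, bil_mul_bil, bil_self, zero_mul, neg_zero,
      neg_zero, neg_zero]
  · rw [bil_swap a c, mul_neg, bil_mul_bil, bil_self, zero_mul, neg_zero, neg_zero]
  · rw [bil_mul_bil, bil_self, mul_zero, neg_zero]
  · rw [bil_mul_bil, bil_self, mul_zero, neg_zero]
  · rw [bil_mul_bil, bil_self, zero_mul, neg_zero]
  · rw [bil_mul_bil, bil_self, zero_mul, neg_zero]
  · rw [bil_swap a c, neg_mul, bil_mul_bil, bil_self, zero_mul, neg_zero, neg_zero]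
  · rw [bil_mul_bil, bil_self, mul_zero, neg_zero]
  · rw [bil_swap c b, mul_neg, bil_mul_bil, bil_self, zero_mul, neg_zero, neg_zero]

theorem isNilpotent_siteForm (z₁ z₂ u u' v v' : ℂ) (j : Fin N) :
    IsNilpotent (siteForm z₁ z₂ u u' v v' j) := by
  have hp : ∀ k l, pairing k l j j ∈ nilradical (EvenGrassmann N) := fun k l =>
    mem_nilradical.2 (isNilpotent_pairing k l j j)
  have hs : ∀ (r : ℂ) k l, r • pairing k l j j ∈ nilradical (EvenGrassmann N) := fun r k l =>
    mem_nilradical.2 ((isNilpotent_pairing k l j j).smul r)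
  exact mem_nilradical.1 (add_mem (add_mem (add_mem (add_mem (add_mem (hs _ _ _) (hs _ _ _))
    (hs _ _ _)) (hs _ _ _)) (hs _ _ _)) (hs _ _ _))

/-- The exponent has six square-zero terms, and any product of three pairings at one site has degree
6 in four generators, so the expansion stops at degree 4. The coefficient there is the Pfaffian of
the 4 × 4 skew matrix of the quadratic form. -/
theorem exp_siteForm (z₁ z₂ u u' v v' : ℂ) (j : Fin N) :
    IsNilpotent.exp (siteForm z₁ z₂ u u' v v' j) = (1 + siteForm z₁ z₂ u u' v v' j) +
      (z₁ * z₂ - u * u' - v * v') • (pairing 0 1 j j * pairing 2 3 j j) := by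
  obtain ⟨h1, h2, h3, h4, h5, h6, h7, h8, h9, h10, h11, h12, h13, h14⟩ := site_products j
  have hsq : ∀ (r : ℂ) k l, (r • pairing k l j j) * (r • pairing k l j j) = 0 := fun r k l => by
    rw [smul_mul_smul_comm, pairing_mul_self, smul_zero]
  have hn : ∀ (r : ℂ) k l, IsNilpotent (r • pairing k l j j) := fun r k l =>
    (isNilpotent_pairing k l j j).smul r
  have hC : ∀ {x y : EvenGrassmann N}, Commute x y := Commute.all _ _
  rw [siteForm, IsNilpotent.exp_add_of_commute hC _ (hn _ _ _),
    IsNilpotent.exp_add_of_commute hC _ (hn _ _ _), IsNilpotent.exp_add_of_commute hC _ (hn _ _ _),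
    IsNilpotent.exp_add_of_commute hC _ (hn _ _ _), IsNilpotent.exp_add_of_commute hC (hn _ _ _)
    (hn _ _ _), exp_eq_one_add (hsq _ _ _), exp_eq_one_add (hsq _ _ _), exp_eq_one_add (hsq _ _ _),
    exp_eq_one_add (hsq _ _ _), exp_eq_one_add (hsq _ _ _), exp_eq_one_add (hsq _ _ _)]
  -- With scalars and pairings replaced by free variables, the claim is a polynomial identity modulo
  -- the relations of `site_products`.
  · simp only [Algebra.smul_def, map_sub, map_mul]
    generalize algebraMap ℂ (EvenGrassmann N) z₁ = z₁
    generalize algebraMap ℂ (EvenGrassmann N) z₂ = z₂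
    generalize algebraMap ℂ (EvenGrassmann N) u = u
    generalize algebraMap ℂ (EvenGrassmann N) u' = u'
    generalize algebraMap ℂ (EvenGrassmann N) v = v
    generalize algebraMap ℂ (EvenGrassmann N) v' = v'
    generalize pairing 0 1 j j = α at *
    generalize pairing 2 3 j j = β at *
    generalize pairing 0 2 j j = γ at *
    generalize pairing 1 3 j j = δ at *
    generalize pairing 0 3 j j = ε at *
    generalize pairing 2 1 j j = ζ at *
    have e1 : (1 + z₁ * α) * (1 + z₂ * β) = 1 + z₁ * α + z₂ * β + z₁ * z₂ * (α * β) := by ring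
    have e2 : (1 + u * γ) * (1 + u' * δ) = 1 + u * γ + u' * δ - u * u' * (α * β) := by
      linear_combination u * u' * h1
    have e3 : (1 + v * ε) * (1 + v' * ζ) = 1 + v * ε + v' * ζ - v * v' * (α * β) := by
      linear_combination v * v' * h2
    have e4 : (1 + z₁ * α) * (1 + z₂ * β) * ((1 + u * γ) * (1 + u' * δ)) =
        1 + z₁ * α + z₂ * β + u * γ + u' * δ + (z₁ * z₂ - u * u') * (α * β) := by
      rw [e1, e2]
      have q1 : α * β * γ = 0 := by linear_combination α * h7
      have q2 : α * β * δ = 0 := by linear_combination α * h8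
      have q3 : α * α * β = 0 := by linear_combination α * h1 - δ * h3
      have q4 : α * β * β = 0 := by linear_combination β * h1 - δ * h7
      linear_combination z₁ * u * h3 + z₁ * u' * h4 + z₂ * u * h7 + z₂ * u' * h8 +
        z₁ * z₂ * u * q1 + z₁ * z₂ * u' * q2 - z₁ * u * u' * q3 - z₂ * u * u' * q4 -
        z₁ * z₂ * u * u' * α * q4
    have e5 : (1 + z₁ * α) * (1 + z₂ * β) * ((1 + u * γ) * (1 + u' * δ)) *
        ((1 + v * ε) * (1 + v' * ζ)) = 1 + z₁ * α + z₂ * β + u * γ + u' * δ + v * ε + v' * ζ +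
          (z₁ * z₂ - u * u' - v * v') * (α * β) := by
      rw [e4, e3]
      have q1 : α * β * ε = 0 := by linear_combination α * h9
      have q2 : α * β * ζ = 0 := by linear_combination α * h10
      have q3 : α * α * β = 0 := by linear_combination α * h1 - δ * h3
      have q4 : α * β * β = 0 := by linear_combination β * h1 - δ * h7
      have q5 : α * β * γ = 0 := by linear_combination α * h7
      have q6 : α * β * δ = 0 := by linear_combination α * h8
      linear_combination z₁ * v * h5 + z₁ * v' * h6 + z₂ * v * h9 + z₂ * v' * h10 +
        u * v * h11 + u * v' * h12 + u' * v * h13 + u' * v' * h14 +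
        (z₁ * z₂ - u * u') * (v * q1 + v' * q2) - v * v' * (z₁ * q3 + z₂ * q4 + u * q5 + u' * q6)
        - (z₁ * z₂ - u * u') * v * v' * α * q4
    linear_combination e5
  all_goals
    refine mem_nilradical.1 ?_
    have hs : ∀ (r : ℂ) k l, r • pairing k l j j ∈ nilradical (EvenGrassmann N) := fun r k l =>
      mem_nilradical.2 (hn r k l)
    repeat' apply add_mem
    all_goals exact hs _ _ _

theorem siteForm_mem_degLE (z₁ z₂ u u' v v' : ℂ) (j : Fin N) :
    siteForm z₁ z₂ u u' v v' j ∈ degLE N 2 := by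
  have hs : ∀ (r : ℂ) k l, r • pairing k l j j ∈ degLE N 2 := fun r k l =>
    Submodule.smul_mem _ r (pairing_mem_degLE _ _ _ _)
  exact add_mem (add_mem (add_mem (add_mem (add_mem (hs _ _ _) (hs _ _ _))
    (hs _ _ _)) (hs _ _ _)) (hs _ _ _)) (hs _ _ _)

/-- An exponent without coupling between sites gives a product of one-site Pfaffians. These become
the quaternion determinants in `prod_sqrtDet_eq_berezin`. -/
theorem berezin_exp_siteForm (z₁ z₂ u u' v v' : Fin N → ℂ) :
    berezin N (IsNilpotent.exp
      (∑ j, siteForm (z₁ j) (z₂ j) (u j) (u' j) (v j) (v' j) j)) =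
      ∏ j, (z₁ j * z₂ j - u j * u' j - v j * v' j) := by
  rw [exp_finset_sum _ _ fun j _ => isNilpotent_siteForm _ _ _ _ _ _ j]
  simp_rw [exp_siteForm]
  rw [berezin_prod_add, Finset.prod_smul, map_smul, berezin_prod_pairing, smul_eq_mul, mul_one]
  · exact fun j => add_mem (degLE_mono (by omega) (one_mem_degLE N))
      (degLE_mono (by omega) (siteForm_mem_degLE _ _ _ _ _ _ j))
  · exact fun j => Submodule.smul_mem _ _
      (mul_mem_degLE_four (pairing_mem_degLE _ _ _ _) (pairing_mem_degLE _ _ _ _))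

/-- The element multiplying the entry `H i j` of a symmetric matrix, for `i ≠ j`. -/
def edgeForm (i j : Fin N) : EvenGrassmann N :=
  pairing 0 1 i j + pairing 0 1 j i + pairing 2 3 i j + pairing 2 3 j i

/-- The quadratic form dual to the covariance. -/
def dualForm (i j : Fin N) : EvenGrassmann N :=
  -(pairing 0 1 i i * pairing 0 1 j j + pairing 2 3 i i * pairing 2 3 j j +
    pairing 0 2 i i * pairing 1 3 j j + pairing 0 2 j j * pairing 1 3 i i +
    pairing 0 3 i i * pairing 2 1 j j + pairing 0 3 j j * pairing 2 1 i i)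

theorem dualForm_symm (i j : Fin N) : dualForm i j = dualForm j i := by
  simp only [dualForm]
  ring

/-- This is the duality step. Squaring kills the four individual pairings, and in each of the six
cross terms anticommutation regroups pairings between `i` and `j` into one pairing at `i` times one
at `j`. -/
theorem edgeForm_sq (i j : Fin N) : edgeForm i j ^ 2 = dualForm i j + dualForm j i := by
  rw [dualForm_symm j i]
  simp only [edgeForm, dualForm, pairing]
  generalize gen i 0 = a
  generalize gen i 1 = b
  generalize gen i 2 = c
  generalize gen i 3 = d
  generalize gen j 0 = a'
  generalize gen j 1 = b'
  generalize gen j 2 = c'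
  generalize gen j 3 = d'
  have s1 := bil_sq a b'
  have s2 := bil_sq a' b
  have s3 := bil_sq c d'
  have s4 := bil_sq c' d
  have p1 : bil a b' * bil a' b = -(bil a b * bil a' b') := by
    rw [bil_swap a' b, mul_neg, bil_mul_bil, neg_neg, bil_swap b' a', mul_neg]
  have p2 : bil c d' * bil c' d = -(bil c d * bil c' d') := by
    rw [bil_swap c' d, mul_neg, bil_mul_bil, neg_neg, bil_swap d' c', mul_neg]
  have p3 : bil a b' * bil c d' = -(bil a c * bil b' d') := bil_mul_bil _ _ _ _
  have p4 : bil a' b * bil c' d = -(bil a' c' * bil b d) := bil_mul_bil _ _ _ _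
  have p5 : bil a b' * bil c' d = -(bil a d * bil c' b') := by
    rw [bil_swap c' d, mul_neg, bil_mul_bil, neg_neg, bil_swap b' c', mul_neg]
  have p6 : bil a' b * bil c d' = -(bil a' d' * bil c b) := by
    rw [bil_swap c d', mul_neg, bil_mul_bil, neg_neg, bil_swap b c, mul_neg]
  linear_combination s1 + s2 + s3 + s4 + 2 * (p1 + p2 + p3 + p4 + p5 + p6)

/-- The doubled variance on the diagonal makes the diagonal entries contribute by the same formula
as the off-diagonal ones. -/
theorem diagForm_sq (i : Fin N) :
    2 * (pairing 0 1 i i + pairing 2 3 i i) ^ 2 = dualForm i i := by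
  obtain ⟨h1, h2, -⟩ := site_products i
  have e1 := pairing_mul_self 0 1 i i
  have e2 := pairing_mul_self 2 3 i i
  rw [dualForm]
  linear_combination 3 * e1 + 3 * e2 + 2 * h1 + 2 * h2

end Berezin

/-! ### Gaussian moments -/

/-- The Gaussian weight shifted along the imaginary axis. -/
def shiftedWeight (t x : ℝ) : ℂ := Complex.exp (-(1 / 2 : ℂ) * (x + t * Complex.I) ^ 2)

theorem norm_shiftedWeight (t x : ℝ) :
    ‖shiftedWeight t x‖ = Real.exp (t ^ 2 / 2) * Real.exp (-(1 / 2 : ℝ) * x ^ 2) := by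
  rw [shiftedWeight, Complex.norm_exp, ← Real.exp_add]
  congr 1
  simp [pow_two]
  ring

theorem hasDerivAt_shiftedWeight (t x : ℝ) :
    HasDerivAt (shiftedWeight t) (-(x + t * Complex.I) * shiftedWeight t x) x := by
  have h1 : HasDerivAt (fun y : ℝ => (y : ℂ) + t * Complex.I) 1 x :=
    (Complex.ofRealCLM.hasDerivAt (x := x)).add_const _
  have h2 := ((h1.pow 2).const_mul (-(1 / 2 : ℂ))).cexp
  refine h2.congr_deriv ?_
  simp only [shiftedWeight, Pi.pow_apply]
  push_cast
  ring

theorem continuous_shiftedWeight (t : ℝ) : Continuous (shiftedWeight t) := by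
  unfold shiftedWeight
  fun_prop

theorem integrable_shiftedWeight_mul_pow (t : ℝ) (k : ℕ) :
    Integrable fun x : ℝ => shiftedWeight t x * (x : ℂ) ^ k := by
  have h := (integrable_rpow_mul_exp_neg_mul_sq (b := 1 / 2) (by norm_num) (s := k)
    (by linarith [k.cast_nonneg (α := ℝ)])).norm.const_mul (Real.exp (t ^ 2 / 2))
  refine h.mono' (by have := continuous_shiftedWeight t; fun_prop) (ae_of_all _ fun x => ?_)
  rw [norm_mul, norm_shiftedWeight, norm_mul, Real.rpow_natCast, norm_pow, norm_pow,
    Complex.norm_real, Real.norm_of_nonneg (Real.exp_pos _).le]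
  exact le_of_eq (by ring)

theorem integral_shiftedWeight (t : ℝ) :
    ∫ x, shiftedWeight t x = (Real.sqrt (2 * Real.pi) : ℂ) := by
  have h := GaussianFourier.integral_cexp_neg_mul_sq_add_real_mul_I (b := 1 / 2) (by norm_num) t
  unfold shiftedWeight
  rw [h, Real.sqrt_eq_rpow, Complex.ofReal_cpow (by positivity)]
  push_cast
  congr 1
  ring

/-- Integration by parts: the weight has logarithmic derivative `-(x + t I)`, and the derivative of
weight times `x ^ (k + 1)` integrates to zero. -/
theorem integral_shiftedWeight_add_two (t : ℝ) (k : ℕ) :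
    ∫ x, shiftedWeight t x * (x : ℂ) ^ (k + 2) =
      -(t * Complex.I) * (∫ x, shiftedWeight t x * (x : ℂ) ^ (k + 1)) +
        (k + 1) * ∫ x, shiftedWeight t x * (x : ℂ) ^ k := by
  have hd : ∀ x : ℝ, HasDerivAt (fun x : ℝ => shiftedWeight t x * (x : ℂ) ^ (k + 1))
      ((k + 1) * (shiftedWeight t x * (x : ℂ) ^ k) - shiftedWeight t x * (x : ℂ) ^ (k + 2) -
        (t * Complex.I) * (shiftedWeight t x * (x : ℂ) ^ (k + 1))) x := by
    intro x
    have h1 : HasDerivAt (fun y : ℝ => (y : ℂ)) 1 x := Complex.ofRealCLM.hasDerivAt (x := x)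
    refine ((hasDerivAt_shiftedWeight t x).mul (h1.pow (k + 1))).congr_deriv ?_
    simp only [Nat.add_sub_cancel, Pi.pow_apply]
    push_cast
    ring
  have hi := integrable_shiftedWeight_mul_pow t
  have hA : Integrable fun x : ℝ => (k + 1) * (shiftedWeight t x * (x : ℂ) ^ k) -
      shiftedWeight t x * (x : ℂ) ^ (k + 2) := ((hi k).const_mul _).sub (hi (k + 2))
  have hB := (hi (k + 1)).const_mul (t * Complex.I)
  have h0 := integral_eq_zero_of_hasDerivAt_of_integrable hd (hA.sub hB) (hi (k + 1))
  rw [integral_sub hA hB, integral_sub ((hi k).const_mul _) (hi (k + 2)), integral_const_mul,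
    integral_const_mul] at h0
  linear_combination -h0

theorem integral_shiftedWeight_one (t : ℝ) :
    ∫ x, shiftedWeight t x * (x : ℂ) ^ 1 = -(t * Complex.I) * Real.sqrt (2 * Real.pi) := by
  have hi := integrable_shiftedWeight_mul_pow t
  have hi0 : Integrable (shiftedWeight t) := by simpa using hi 0
  have hi1 : Integrable fun x : ℝ => shiftedWeight t x * (x : ℂ) ^ 1 := hi 1
  have hd : ∀ x : ℝ, HasDerivAt (shiftedWeight t)
      (-(shiftedWeight t x * (x : ℂ) ^ 1) - (t * Complex.I) * shiftedWeight t x) x := by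
    intro x
    refine (hasDerivAt_shiftedWeight t x).congr_deriv ?_
    ring
  have hi2 : Integrable fun x : ℝ => -(shiftedWeight t x * (x : ℂ) ^ 1) := hi1.neg
  have h0 := integral_eq_zero_of_hasDerivAt_of_integrable hd
    (hi2.sub (hi0.const_mul _)) hi0
  rw [integral_sub hi2 (hi0.const_mul _), integral_neg, integral_const_mul,
    integral_shiftedWeight] at h0
  linear_combination -h0

/-- The normalised moments of the shifted Gaussian weight. -/
def shiftedMoment (t : ℝ) (k : ℕ) : ℂ :=
  (Real.sqrt (2 * Real.pi) : ℂ)⁻¹ * ∫ x, shiftedWeight t x * (x : ℂ) ^ k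

theorem sqrt_two_pi_ne_zero : (Real.sqrt (2 * Real.pi) : ℂ) ≠ 0 := by
  have : 0 < Real.sqrt (2 * Real.pi) := Real.sqrt_pos.2 (by positivity)
  exact_mod_cast this.ne'

/-- The shift by `t I` acts as the imaginary mean `-t I`. It is kept in the moments, so the
integration stays on the real line. -/
theorem isGaussMoments_shiftedMoment (t : ℝ) :
    IsGaussMoments (-(t * Complex.I)) 1 (shiftedMoment t) where
  zero := by
    simp only [shiftedMoment, pow_zero, mul_one, integral_shiftedWeight]
    exact inv_mul_cancel₀ sqrt_two_pi_ne_zero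
  one := by
    rw [shiftedMoment, integral_shiftedWeight_one]
    field_simp [sqrt_two_pi_ne_zero]
  add_two k := by
    simp only [shiftedMoment]
    rw [integral_shiftedWeight_add_two, mul_add]
    ring

theorem integral_shiftedWeight_mul_pow (t : ℝ) (k : ℕ) :
    ∫ x, shiftedWeight t x * (x : ℂ) ^ k = Real.sqrt (2 * Real.pi) * shiftedMoment t k := by
  rw [shiftedMoment, mul_inv_cancel_left₀ sqrt_two_pi_ne_zero]

theorem gaussianPDFReal_zero_one (x : ℝ) : (ProbabilityTheory.gaussianPDFReal 0 1 x : ℂ) =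
    (Real.sqrt (2 * Real.pi) : ℂ)⁻¹ * shiftedWeight 0 x := by
  rw [ProbabilityTheory.gaussianPDFReal, shiftedWeight]
  push_cast
  simp only [mul_one, sub_zero, zero_mul, add_zero]
  congr 2
  ring

theorem integrable_pow_gaussianReal (v : NNReal) (k : ℕ) :
    Integrable (fun x : ℝ => (x : ℂ) ^ k) (ProbabilityTheory.gaussianReal 0 v) := by
  have h := (ProbabilityTheory.memLp_id_gaussianReal (μ := 0) (v := v) (k : NNReal))
  have h2 : MemLp id (k : ENNReal) (ProbabilityTheory.gaussianReal 0 v) := by simpa using h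
  refine h2.integrable_norm_pow'.mono' (by fun_prop) (ae_of_all _ fun x => ?_)
  simp

/-- Rescaling from unit variance also covers `v = 0`, where the law has no density. -/
theorem integral_pow_gaussianReal (v : NNReal) (k : ℕ) :
    ∫ x : ℝ, (x : ℂ) ^ k ∂(ProbabilityTheory.gaussianReal 0 v) =
      (Real.sqrt v : ℂ) ^ k * shiftedMoment 0 k := by
  have h1 : ProbabilityTheory.gaussianReal 0 v =
      (ProbabilityTheory.gaussianReal 0 1).map (Real.sqrt v * ·) := by
    rw [ProbabilityTheory.gaussianReal_map_const_mul]
    congr 1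
    · simp
    · ext
      simp
  rw [h1, integral_map (by fun_prop) (by fun_prop),
    ProbabilityTheory.integral_gaussianReal_eq_integral_smul one_ne_zero, shiftedMoment,
    ← integral_const_mul, ← integral_const_mul]
  congr 1
  funext x
  rw [Complex.real_smul, gaussianPDFReal_zero_one]
  push_cast
  ring

theorem isGaussMoments_gaussianReal (v : NNReal) : IsGaussMoments 0 (v : ℝ)
    fun k => ∫ x : ℝ, (x : ℂ) ^ k ∂(ProbabilityTheory.gaussianReal 0 v) := by
  have h := isGaussMoments_shiftedMoment 0
  have hs : (Real.sqrt v : ℂ) ^ 2 = ((v : ℝ) : ℂ) := by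
    exact_mod_cast Real.sq_sqrt v.2
  simp_rw [integral_pow_gaussianReal]
  constructor
  · simp [h.zero]
  · simp [h.one]
  · intro k
    rw [h.add_two, ← hs]
    push_cast
    ring

/-! ### The covariance -/

/-- The inverse covariance. -/
def precision (n : ℕ) (W : ℝ) : Matrix (Fin (2 * n + 1)) (Fin (2 * n + 1)) ℝ :=
  -(W ^ 2) • neumannLaplacian n + 1

theorem covJ_eq (n : ℕ) (W : ℝ) : covJ n W = (precision n W)⁻¹ := rfl

open Classical in
theorem precision_eq (n : ℕ) (W : ℝ) :
    precision n W = W ^ 2 • (SimpleGraph.pathGraph (2 * n + 1)).lapMatrix ℝ + 1 := by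
  rw [precision, neumannLaplacian, smul_neg, neg_smul, neg_neg]

theorem posDef_precision (n : ℕ) (W : ℝ) : (precision n W).PosDef := by
  classical
  rw [precision_eq]
  exact PosDef.posSemidef_add ((SimpleGraph.posSemidef_lapMatrix ℝ _).smul (sq_nonneg W))
    PosDef.one

theorem isUnit_det_precision (n : ℕ) (W : ℝ) : IsUnit (precision n W).det :=
  (posDef_precision n W).det_pos.ne'.isUnit

theorem precision_transpose (n : ℕ) (W : ℝ) : (precision n W)ᵀ = precision n W := by
  have := (posDef_precision n W).isHermitian
  rwa [IsHermitian, conjTranspose_eq_transpose_of_trivial] at this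

theorem covJ_symm (n : ℕ) (W : ℝ) (i j : Fin (2 * n + 1)) : covJ n W i j = covJ n W j i := by
  have h : (covJ n W)ᵀ = covJ n W := by
    rw [covJ_eq, Matrix.transpose_nonsing_inv, precision_transpose]
  exact congrFun (congrFun h j) i

theorem precision_mulVec_apply (n : ℕ) (W : ℝ) (u : Fin (2 * n + 1) → ℝ) (i : Fin (2 * n + 1)) :
    ∃ s : Finset (Fin (2 * n + 1)),
      (precision n W *ᵥ u) i = W ^ 2 * ∑ k ∈ s, (u i - u k) + u i := by
  classical
  refine ⟨(SimpleGraph.pathGraph (2 * n + 1)).neighborFinset i, ?_⟩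
  rw [precision_eq, Matrix.add_mulVec, Matrix.smul_mulVec, Matrix.one_mulVec, Pi.add_apply,
    Pi.smul_apply, SimpleGraph.lapMatrix_mulVec_apply, Finset.sum_sub_distrib, Finset.sum_const,
    SimpleGraph.card_neighborFinset_eq_degree, nsmul_eq_mul, smul_eq_mul]

/-- The minimum principle for the inverse covariance. -/
theorem nonneg_of_precision_mulVec_nonneg {n : ℕ} {W : ℝ} {u : Fin (2 * n + 1) → ℝ}
    (h : ∀ i, 0 ≤ (precision n W *ᵥ u) i) (j : Fin (2 * n + 1)) : 0 ≤ u j := by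
  obtain ⟨i, hi⟩ := Finite.exists_min u
  obtain ⟨s, hs⟩ := precision_mulVec_apply n W u i
  have h1 := h i
  -- Where `u` is smallest the Laplacian term is nonpositive, so `u i` is at least the value of
  -- `precision *ᵥ u` there.
  have h2 : ∑ k ∈ s, (u i - u k) ≤ 0 := Finset.sum_nonpos fun k _ => sub_nonpos.2 (hi k)
  rw [hs] at h1
  nlinarith [hi j, mul_nonneg_of_nonpos_of_nonpos (neg_nonpos.2 (sq_nonneg W)) h2]

/-- A column of `J` is mapped by the inverse covariance to a unit vector, so the minimum principle
applies. Hence `Real.toNNReal` in `bandLaw` truncates nothing and the variances are the intended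
ones. -/
theorem covJ_nonneg (n : ℕ) (W : ℝ) (i j : Fin (2 * n + 1)) : 0 ≤ covJ n W i j := by
  refine nonneg_of_precision_mulVec_nonneg (n := n) (W := W) (u := fun i => covJ n W i j)
    (fun k => ?_) i
  have h : precision n W * covJ n W = 1 := Matrix.mul_nonsing_inv _ (isUnit_det_precision n W)
  have h2 : (precision n W *ᵥ fun i => covJ n W i j) k = (precision n W * covJ n W) k j := rfl
  rw [h2, h, Matrix.one_apply]
  split_ifs <;> norm_num

theorem sum_sum_pathGraph_adj {m : ℕ} {R : Type*} [AddCommMonoid R]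
    [DecidableRel (SimpleGraph.pathGraph (m + 1)).Adj] (g : Fin (m + 1) → Fin (m + 1) → R) :
    ∑ i, ∑ j, (if (SimpleGraph.pathGraph (m + 1)).Adj i j then g i j else 0) =
      ∑ j : Fin m, (g j.castSucc j.succ + g j.succ j.castSucc) := by
  have key : ∀ g : Fin (m + 1) → Fin (m + 1) → R,
      ∑ i : Fin (m + 1), ∑ j : Fin (m + 1), (if (i : ℕ) + 1 = j then g i j else 0) =
        ∑ j : Fin m, g j.castSucc j.succ := by
    intro g
    rw [Fin.sum_univ_castSucc]
    have hlast : ∑ j : Fin (m + 1),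
        (if ((Fin.last m : Fin (m + 1)) : ℕ) + 1 = j then g (Fin.last m) j else 0) = 0 := by
      refine Finset.sum_eq_zero fun j _ => if_neg ?_
      have := j.2
      simp only [Fin.val_last]
      omega
    rw [hlast, add_zero]
    refine Finset.sum_congr rfl fun i _ => ?_
    rw [Finset.sum_eq_single i.succ, if_pos (by simp)]
    · intro j _ hj
      refine if_neg fun h => hj ?_
      ext
      simpa using h.symm
    · simp
  have hsplit : ∀ i j : Fin (m + 1),
      (if (SimpleGraph.pathGraph (m + 1)).Adj i j then g i j else 0) =
        (if (i : ℕ) + 1 = j then g i j else 0) + (if (j : ℕ) + 1 = i then g i j else 0) := by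
    intro i j
    by_cases h1 : (i : ℕ) + 1 = j
    · have h2 : ¬ (j : ℕ) + 1 = i := by omega
      rw [if_pos h1, if_neg h2, if_pos (SimpleGraph.pathGraph_adj.2 (Or.inl h1)), add_zero]
    · by_cases h2 : (j : ℕ) + 1 = i
      · rw [if_neg h1, if_pos h2, if_pos (SimpleGraph.pathGraph_adj.2 (Or.inr h2)), zero_add]
      · rw [if_neg h1, if_neg h2, if_neg, add_zero]
        rw [SimpleGraph.pathGraph_adj]
        exact fun h => h.elim h1 h2
  simp_rw [hsplit, Finset.sum_add_distrib]
  rw [key, Finset.sum_comm, key fun i j => g j i]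

/-- Summation by parts on the path. It identifies the two Gaussian exponents of the integrand with
the single quadratic form of the inverse covariance. -/
theorem sum_precision_mul (n : ℕ) (W : ℝ) (x y : Fin (2 * n + 1) → ℂ) :
    ∑ i, ∑ j, (precision n W i j : ℂ) * (x i * y j) =
      (W : ℂ) ^ 2 * ∑ j : Fin (2 * n),
        (x j.succ - x j.castSucc) * (y j.succ - y j.castSucc) + ∑ j, x j * y j := by
  classical
  have hlap : ∀ i, ∑ j, (((SimpleGraph.pathGraph (2 * n + 1)).lapMatrix ℝ i j : ℝ) : ℂ) * y j =
      ∑ j, if (SimpleGraph.pathGraph (2 * n + 1)).Adj i j then y i - y j else 0 := by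
    intro i
    have h := SimpleGraph.lapMatrix_mulVec_apply (R := ℂ) (G := SimpleGraph.pathGraph (2 * n + 1))
      i y
    have hc : ∀ j, (((SimpleGraph.pathGraph (2 * n + 1)).lapMatrix ℝ i j : ℝ) : ℂ) =
        (SimpleGraph.pathGraph (2 * n + 1)).lapMatrix ℂ i j := by
      intro j
      simp only [SimpleGraph.lapMatrix, SimpleGraph.degMatrix, Matrix.sub_apply,
        Matrix.diagonal_apply, SimpleGraph.adjMatrix_apply]
      push_cast
      split_ifs <;> simp
    simp_rw [hc]
    refine Eq.trans h ?_
    rw [← Finset.sum_filter, Finset.sum_sub_distrib, Finset.sum_const, nsmul_eq_mul,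
      ← SimpleGraph.card_neighborFinset_eq_degree, SimpleGraph.neighborFinset_eq_filter]
  have h1 : ∀ i, ∑ j, (precision n W i j : ℂ) * (x i * y j) = (W : ℂ) ^ 2 *
      (∑ j, if (SimpleGraph.pathGraph (2 * n + 1)).Adj i j then x i * (y i - y j) else 0) +
        x i * y i := by
    intro i
    have h2 : ∀ j, (precision n W i j : ℂ) * (x i * y j) = (W : ℂ) ^ 2 * x i *
        ((((SimpleGraph.pathGraph (2 * n + 1)).lapMatrix ℝ i j : ℝ) : ℂ) * y j) +
          if i = j then x i * y j else 0 := by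
      intro j
      rw [precision_eq, Matrix.add_apply, Matrix.smul_apply, Matrix.one_apply, smul_eq_mul]
      push_cast
      split_ifs <;> push_cast <;> ring
    simp_rw [h2, Finset.sum_add_distrib, ← Finset.mul_sum, hlap]
    rw [Finset.sum_ite_eq, if_pos (Finset.mem_univ i), mul_assoc, Finset.mul_sum]
    simp only [mul_ite, mul_zero]
  simp_rw [h1, Finset.sum_add_distrib, ← Finset.mul_sum]
  rw [sum_sum_pathGraph_adj]
  congr 2
  refine Finset.sum_congr rfl fun j _ => ?_
  ring

/-! ### The mixed moment as a Berezin integral -/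

theorem sum_upperIndex {n : ℕ} {R : Type*} [AddCommMonoid R]
    (g : Fin (2 * n + 1) → Fin (2 * n + 1) → R) :
    ∑ i, ∑ j, g i j = ∑ p : UpperIndex n,
      if p.1.1 = p.1.2 then g p.1.1 p.1.1 else g p.1.1 p.1.2 + g p.1.2 p.1.1 := by
  have h1 : ∑ p : UpperIndex n,
      (if p.1.1 = p.1.2 then g p.1.1 p.1.1 else g p.1.1 p.1.2 + g p.1.2 p.1.1) =
      ∑ i, ∑ j, if i ≤ j then (if i = j then g i i else g i j + g j i) else 0 := by
    rw [← Fintype.sum_prod_type', ← Finset.sum_filter]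
    exact (Finset.sum_subtype (Finset.univ.filter fun p : Fin (2 * n + 1) × Fin (2 * n + 1) =>
      p.1 ≤ p.2) (by simp)
      fun p => if p.1 = p.2 then g p.1 p.1 else g p.1 p.2 + g p.2 p.1).symm
  have h2 : ∀ i j, (if i ≤ j then (if i = j then g i i else g i j + g j i) else 0) =
      (if i ≤ j then g i j else 0) + (if i < j then g j i else 0) := by
    intro i j
    rcases lt_trichotomy i j with h | h | h
    · rw [if_pos h.le, if_neg h.ne, if_pos h.le, if_pos h]
    · subst h
      simp
    · rw [if_neg h.not_ge, if_neg h.not_ge, if_neg h.not_gt, add_zero]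
  rw [h1]
  simp_rw [h2, Finset.sum_add_distrib]
  rw [Finset.sum_comm (f := fun i j => if i < j then g j i else 0)]
  simp_rw [← Finset.sum_add_distrib]
  refine Finset.sum_congr rfl fun i _ => Finset.sum_congr rfl fun j _ => ?_
  rcases le_or_gt i j with h | h
  · rw [if_pos h, if_neg h.not_gt, add_zero]
  · rw [if_neg h.not_ge, if_pos h, zero_add]

/-- The element multiplying the entry at `p` of a symmetric matrix. -/
def entryForm {n : ℕ} (p : UpperIndex n) : EvenGrassmann (2 * n + 1) :=
  if p.1.1 = p.1.2 then pairing 0 1 p.1.1 p.1.1 + pairing 2 3 p.1.1 p.1.1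
  else edgeForm p.1.1 p.1.2

theorem isNilpotent_entryForm {n : ℕ} (p : UpperIndex n) : IsNilpotent (entryForm p) := by
  have h : ∀ k l i j, pairing k l i j ∈ nilradical (EvenGrassmann (2 * n + 1)) :=
    fun k l i j => mem_nilradical.2 (isNilpotent_pairing k l i j)
  refine mem_nilradical.1 ?_
  rw [entryForm]
  split_ifs
  · exact add_mem (h _ _ _ _) (h _ _ _ _)
  · exact add_mem (add_mem (add_mem (h _ _ _ _) (h _ _ _ _)) (h _ _ _ _)) (h _ _ _ _)

/-- The part of the exponent that contains the spectral parameters. -/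
def spectralForm (N : ℕ) (l₁ l₂ : ℂ) : EvenGrassmann N :=
  ∑ j, (l₁ • pairing 0 1 j j + l₂ • pairing 2 3 j j)

theorem isNilpotent_spectralForm (N : ℕ) (l₁ l₂ : ℂ) : IsNilpotent (spectralForm N l₁ l₂) :=
  isNilpotent_finset_sum fun j _ => (Commute.all _ _).isNilpotent_add
    ((isNilpotent_pairing 0 1 j j).smul _) ((isNilpotent_pairing 2 3 j j).smul _)

/-- The exponent of `det_mul_det_eq_berezin` is affine in `H`. Collecting the two places where an
off-diagonal entry occurs leaves one exponential per independent variable. -/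
theorem charPolyProd_eq_berezin {n : ℕ} (l : Fin 2 → ℂ) (h : UpperIndex n → ℝ) :
    charPolyProd l h = berezin (2 * n + 1) (IsNilpotent.exp (spectralForm _ (l 0) (l 1)) *
      ∏ p, IsNilpotent.exp ((h p : ℂ) • (-entryForm p))) := by
  have hn : ∀ p : UpperIndex n, IsNilpotent ((h p : ℂ) • (-entryForm p)) := fun p =>
    (isNilpotent_entryForm p).neg.smul _
  rw [charPolyProd, Fin.prod_univ_two, det_mul_det_eq_berezin,
    ← exp_finset_sum _ _ fun p _ => hn p, ← IsNilpotent.exp_add_of_commute (Commute.all _ _)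
      (isNilpotent_spectralForm _ _ _) (isNilpotent_finset_sum fun p _ => hn p)]
  congr 2
  have hX : ∀ (z : ℂ) i j, (Matrix.scalar (Fin (2 * n + 1)) z -
      (symMatrix h).map ((↑) : ℝ → ℂ)) i j =
      (if i = j then z else 0) - (symMatrix h i j : ℂ) := by
    intro z i j
    rw [Matrix.sub_apply, Matrix.scalar_apply, Matrix.diagonal_apply, Matrix.map_apply]
  have hsplit : ∀ i j : Fin (2 * n + 1),
      (Matrix.scalar (Fin (2 * n + 1)) (l 0) - (symMatrix h).map ((↑) : ℝ → ℂ)) i j •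
        pairing 0 1 i j + (Matrix.scalar (Fin (2 * n + 1)) (l 1) -
          (symMatrix h).map ((↑) : ℝ → ℂ)) i j • pairing 2 3 i j =
      (if i = j then l 0 • pairing 0 1 i j + l 1 • pairing 2 3 i j else 0) -
        (symMatrix h i j : ℂ) • (pairing 0 1 i j + pairing 2 3 i j) := by
    intro i j
    rw [hX, hX]
    split_ifs
    · rw [sub_smul, sub_smul, smul_add]
      abel
    · rw [sub_smul, sub_smul, smul_add, zero_smul, zero_smul]
      abel
  have hsplit' : ∀ i : Fin (2 * n + 1), (∑ j,
      ((if i = j then l 0 • pairing 0 1 i j + l 1 • pairing 2 3 i j else 0) -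
        (symMatrix h i j : ℂ) • (pairing 0 1 i j + pairing 2 3 i j))) =
      (l 0 • pairing 0 1 i i + l 1 • pairing 2 3 i i) -
        ∑ j, (symMatrix h i j : ℂ) • (pairing 0 1 i j + pairing 2 3 i j) := by
    intro i
    rw [Finset.sum_sub_distrib, Finset.sum_ite_eq, if_pos (Finset.mem_univ i)]
  rw [Finset.sum_congr rfl fun i _ =>
    (Finset.sum_congr rfl fun j _ => hsplit i j).trans (hsplit' i), Finset.sum_sub_distrib,
    sub_eq_add_neg, spectralForm, sum_upperIndex, ← Finset.sum_neg_distrib]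
  congr 1
  refine Finset.sum_congr rfl fun p _ => ?_
  obtain ⟨⟨i, j⟩, hij⟩ := p
  have e1 : ∀ q : UpperIndex n, symMatrix h q.1.1 q.1.2 = h q := by
    rintro ⟨⟨a, b⟩, hab⟩
    have hab' : a ≤ b := hab
    simp [symMatrix, min_eq_left hab', max_eq_right hab']
  have e2 : symMatrix h i j = h ⟨(i, j), hij⟩ := e1 ⟨(i, j), hij⟩
  have e3 : symMatrix h j i = h ⟨(i, j), hij⟩ := by
    rw [← e2]
    simp only [symMatrix, Matrix.of_apply, min_comm, max_comm]
  rw [entryForm, edgeForm]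
  by_cases hd : i = j
  · subst hd
    simp only [if_true]
    rw [e2, smul_neg]
  · simp only [if_neg hd]
    rw [e2, e3, smul_neg, ← smul_add]
    congr 2
    abel

/-- Centred entries contribute only the variance term, and `diagForm_sq` and `edgeForm_sq` convert
the squares into the full double sum over sites. -/
theorem mixedMoment_eq_berezin (n : ℕ) (W : ℝ) (l : Fin 2 → ℂ) :
    Integrable (charPolyProd (n := n) l) (bandLaw n W) ∧
    mixedMoment n W l = berezin (2 * n + 1) (IsNilpotent.exp (spectralForm _ (l 0) (l 1)) *
      IsNilpotent.exp (∑ i, ∑ j, ((covJ n W i j : ℂ) / 2) • dualForm i j)) := by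
  set v : UpperIndex n → NNReal := fun p =>
    Real.toNNReal (if p.1.1 = p.1.2 then 2 * covJ n W p.1.1 p.1.2 else covJ n W p.1.1 p.1.2)
    with hv
  have hv' : ∀ p, ((v p : ℝ) : ℂ) =
      if p.1.1 = p.1.2 then 2 * (covJ n W p.1.1 p.1.2 : ℂ) else (covJ n W p.1.1 p.1.2 : ℂ) := by
    intro p
    rw [hv, Real.coe_toNNReal]
    · split_ifs <;> push_cast <;> rfl
    · have := covJ_nonneg n W p.1.1 p.1.2
      split_ifs <;> positivity
  have key := integral_functional_prod_exp
    (fun p : UpperIndex n => ProbabilityTheory.gaussianReal 0 (v p)) (fun _ _ => 1)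
    (fun p k => by simpa using integrable_pow_gaussianReal (v p) k) (fun _ => 1) (fun _ => 0)
    (fun p => ((v p : ℝ) : ℂ))
    (fun p k => ∫ x : ℝ, (x : ℂ) ^ k ∂(ProbabilityTheory.gaussianReal 0 (v p)))
    (fun p => isGaussMoments_gaussianReal (v p)) (fun p k => by simp)
    (fun p => -entryForm p) (fun p => (isNilpotent_entryForm p).neg)
    (IsNilpotent.exp (spectralForm _ (l 0) (l 1))) (berezin (2 * n + 1))
  simp only [Finset.prod_const_one, one_mul, zero_smul, zero_add] at key
  simp_rw [← charPolyProd_eq_berezin] at key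
  refine ⟨key.1, key.2.trans ?_⟩
  have hn : ∀ p : UpperIndex n, IsNilpotent ((((v p : ℝ) : ℂ) / 2) • (-entryForm p) ^ 2) :=
    fun p => ((isNilpotent_entryForm p).neg.pow_of_pos two_ne_zero).smul _
  rw [← exp_finset_sum _ _ fun p _ => hn p, sum_upperIndex]
  congr 3
  refine Finset.sum_congr rfl fun p _ => ?_
  obtain ⟨⟨i, j⟩, hij⟩ := p
  rw [hv', entryForm, neg_sq]
  by_cases hd : i = j
  · subst hd
    simp only [if_true]
    rw [← diagForm_sq, two_mul ((_ : EvenGrassmann (2 * n + 1)) ^ 2), smul_add, ← add_smul]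
    congr 1
    ring
  · simp only [if_neg hd]
    rw [edgeForm_sq, covJ_symm n W j i, smul_add]

/-! ### Real coordinates for self-dual matrices -/

theorem measurePreserving_uncurry (ι κ : Type*) [Fintype ι] [Fintype κ] :
    MeasurePreserving (fun (f : ι → κ → ℝ) (p : ι × κ) => f p.1 p.2) := by
  refine ⟨by fun_prop, ?_⟩
  refine (Measure.pi_eq fun s hs => ?_).symm
  rw [Measure.map_apply (by fun_prop) (MeasurableSet.univ_pi hs)]
  have h : (fun (f : ι → κ → ℝ) (p : ι × κ) => f p.1 p.2) ⁻¹' Set.univ.pi s =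
      Set.univ.pi fun i => Set.univ.pi fun k => s (i, k) := by
    ext f
    simp [Set.mem_pi]
  rw [h, volume_pi, Measure.pi_pi, Fintype.prod_prod_type]
  refine Finset.prod_congr rfl fun i _ => ?_
  rw [volume_pi, Measure.pi_pi]

theorem measurePreserving_curry (ι κ : Type*) [Fintype ι] [Fintype κ] :
    MeasurePreserving (fun (x : ι × κ → ℝ) (i : ι) (k : κ) => x (i, k)) :=
  (measurePreserving_uncurry ι κ).symm (MeasurableEquiv.curry ι κ ℝ).symm

theorem measurePreserving_headTail (m : ℕ) :
    MeasurePreserving fun v : Fin (m + 1) → ℝ => (v 0, fun i : Fin m => v i.succ) :=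
  volume_preserving_piFinSuccAbove (fun _ => ℝ) 0

theorem measurePreserving_complexTail (m : ℕ) :
    MeasurePreserving fun v : Fin (m + 2) → ℝ =>
      ((⟨v 0, v 1⟩ : ℂ), fun i : Fin m => v i.succ.succ) := by
  have h1 := (MeasurePreserving.id (volume : Measure ℝ)).prod (measurePreserving_headTail m)
  have h2 : MeasurePreserving (MeasurableEquiv.prodAssoc (α := ℝ) (β := ℝ) (γ := Fin m → ℝ)).symm :=
    volume_preserving_prodAssoc.symm _
  have h3 := (Complex.volume_preserving_equiv_real_prod.symm _).prod
    (MeasurePreserving.id (volume : Measure (Fin m → ℝ)))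
  exact h3.comp (h2.comp (h1.comp (measurePreserving_headTail (m + 1))))

theorem measurePreserving_complexPair :
    MeasurePreserving fun v : Fin 4 → ℝ => ((⟨v 0, v 1⟩ : ℂ), (⟨v 2, v 3⟩ : ℂ)) :=
  ((MeasurePreserving.id (volume : Measure ℂ)).prod
    ((Complex.volume_preserving_equiv_real_prod.symm _).comp
      (volume_preserving_finTwoArrow ℝ))).comp (measurePreserving_complexTail 2)

/-- The parameters of a self-dual matrix with the given real coordinates. -/
def siteParams (v : Fin 6 → ℝ) : ℝ × ℝ × ℂ × ℂ := (v 0, v 1, ⟨v 2, v 3⟩, ⟨v 4, v 5⟩)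

theorem measurePreserving_siteParams : MeasurePreserving siteParams := by
  have hid := MeasurePreserving.id (volume : Measure ℝ)
  exact (hid.prod ((hid.prod measurePreserving_complexPair).comp (measurePreserving_headTail 4))).comp
    (measurePreserving_headTail 5)

/-- The parameters of a family of self-dual matrices with the given real coordinates. -/
def familyParams {N : ℕ} (x : Fin N × Fin 6 → ℝ) (j : Fin N) : ℝ × ℝ × ℂ × ℂ :=
  siteParams fun k => x (j, k)

theorem measurePreserving_familyParams (N : ℕ) :
    MeasurePreserving (familyParams (N := N)) :=
  (volume_preserving_pi fun _ : Fin N => measurePreserving_siteParams).comp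
    (measurePreserving_curry (Fin N) (Fin 6))

theorem measurableEmbedding_familyParams (N : ℕ) : MeasurableEmbedding (familyParams (N := N)) := by
  let g : (Fin N → ℝ × ℝ × ℂ × ℂ) → Fin N × Fin 6 → ℝ := fun p q =>
    (![(p q.1).1, (p q.1).2.1, (p q.1).2.2.1.re, (p q.1).2.2.1.im, (p q.1).2.2.2.re,
      (p q.1).2.2.2.im] : Fin 6 → ℝ) q.2
  have hg : Measurable g := by
    refine measurable_pi_iff.2 fun ⟨j, k⟩ => ?_
    have hj : Measurable fun p : Fin N → ℝ × ℝ × ℂ × ℂ => p j := measurable_pi_apply j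
    fin_cases k
    · exact hj.fst
    · exact hj.snd.fst
    · exact Complex.measurable_re.comp hj.snd.snd.fst
    · exact Complex.measurable_im.comp hj.snd.snd.fst
    · exact Complex.measurable_re.comp hj.snd.snd.snd
    · exact Complex.measurable_im.comp hj.snd.snd.snd
  have hl : Function.LeftInverse g familyParams := by
    intro x
    funext ⟨j, k⟩
    fin_cases k <;> rfl
  have hr : Function.RightInverse g familyParams := fun p => rfl
  exact MeasurableEmbedding.of_measurable_inverse (measurePreserving_familyParams N).measurable
    (by rw [hr.surjective.range_eq]; exact MeasurableSet.univ) hg hl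

/-! ### Traces and determinants in coordinates -/

theorem trace_selfDual_add_sq (p : ℝ × ℝ × ℂ × ℂ) (u v : ℂ) :
    Matrix.trace ((selfDual p + diag4 u v) ^ 2) =
      2 * (((p.1 : ℂ) + u) ^ 2 + ((p.2.1 : ℂ) + v) ^ 2 +
        2 * (p.2.2.1 * (starRingEnd ℂ) p.2.2.1) + 2 * (p.2.2.2 * (starRingEnd ℂ) p.2.2.2)) := by
  rw [pow_two, Matrix.trace]
  simp only [Matrix.diag_apply, Matrix.mul_apply, Fintype.sum_sum_type, Fin.sum_univ_two,
    Matrix.add_apply, selfDual, diag4, sigma]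
  simp
  ring

theorem sqrtDet_selfDual_sub_diag4 (p : ℝ × ℝ × ℂ × ℂ) (u v : ℂ) :
    sqrtDet (selfDual p - diag4 u v) = ((p.1 : ℂ) - u) * ((p.2.1 : ℂ) - v) -
      p.2.2.1 * (starRingEnd ℂ) p.2.2.1 - p.2.2.2 * (starRingEnd ℂ) p.2.2.2 := by
  simp only [sqrtDet, Matrix.det_fin_two, Matrix.toBlocks₁₁, Matrix.of_apply, Matrix.sub_apply,
    selfDual, diag4, sigma]
  simp
  ring

theorem selfDual_sub (p q : ℝ × ℝ × ℂ × ℂ) : selfDual p - selfDual q = selfDual (p - q) := by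
  ext i j
  rcases i with i | i <;> rcases j with j | j <;> fin_cases i <;> fin_cases j <;>
    simp [selfDual, sigma]
  all_goals ring

theorem smul_diag4 (r u v : ℂ) : r • diag4 u v = diag4 (r * u) (r * v) := by
  rw [diag4, diag4, ← Matrix.diagonal_smul]
  congr 1
  ext i
  rcases i with i | i <;> fin_cases i <;> simp

theorem diag4_add (u v u' v' : ℂ) : diag4 u v + diag4 u' v' = diag4 (u + u') (v + v') := by
  rw [diag4, diag4, diag4, Matrix.diagonal_add]
  congr 1
  ext i
  rcases i with i | i <;> fin_cases i <;> simp

theorem diag4_zero : diag4 0 0 = 0 := by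
  rw [← zero_mul (0 : ℂ), ← smul_diag4, zero_smul]

/-- The weights of the real coordinates in the trace of a square. -/
def coordWeight : Fin 6 → ℝ := ![1, 1, 2, 2, 2, 2]

/-- The imaginary shifts of the real coordinates. -/
def coordShift (s₁ s₂ : ℝ) : Fin 6 → ℝ := ![s₁, s₂, 0, 0, 0, 0]

theorem trace_siteParams_sq (v : Fin 6 → ℝ) (s₁ s₂ : ℝ) :
    Matrix.trace ((selfDual (siteParams v) + diag4 (Complex.I * s₁) (Complex.I * s₂)) ^ 2) =
      2 * ∑ k, (coordWeight k : ℂ) * ((v k : ℂ) + coordShift s₁ s₂ k * Complex.I) ^ 2 := by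
  rw [trace_selfDual_add_sq]
  simp only [siteParams, Complex.mul_conj, Complex.normSq_mk, Fin.sum_univ_six, coordWeight,
    coordShift]
  simp
  ring

theorem trace_siteParams_sub_sq (v w : Fin 6 → ℝ) :
    Matrix.trace ((selfDual (siteParams v) - selfDual (siteParams w)) ^ 2) =
      2 * ∑ k, (coordWeight k : ℂ) * ((v k : ℂ) - w k) ^ 2 := by
  have h : siteParams v - siteParams w = siteParams (v - w) := by
    simp only [siteParams, Prod.mk_sub_mk, Pi.sub_apply]
    rfl
  have h2 := trace_siteParams_sq (v - w) 0 0
  have h3 : coordShift 0 0 = 0 := by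
    ext k
    fin_cases k <;> rfl
  simp only [Complex.ofReal_zero, mul_zero, diag4_zero, add_zero, h3, Pi.zero_apply, zero_mul] at h2
  rw [selfDual_sub, h, h2]
  simp

/-- The spectral shifts `lam0 / 2 + xi / (N ρ)`. -/
def spectralShift (n : ℕ) (lam0 : ℝ) (xi : Fin 2 → ℝ) (l : Fin 2) : ℝ :=
  lam0 / 2 + xi l / scaleN n lam0

/-- The imaginary shift is the same at all sites, so it drops out of the differences between
neighbours. Both exponents can therefore be written in the shifted coordinates and merged. -/
theorem selfDualIntegrand_familyParams (n : ℕ) (W lam0 : ℝ) (xi : Fin 2 → ℝ)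
    (x : Fin (2 * n + 1) × Fin 6 → ℝ) :
    selfDualIntegrand n W lam0 xi (familyParams x) =
      Complex.exp (-(1 / 2 : ℂ) * ∑ k, (coordWeight k : ℂ) *
        ∑ i, ∑ j, (precision n W i j : ℂ) *
          (((x (i, k) : ℂ) + coordShift (spectralShift n lam0 xi 0) (spectralShift n lam0 xi 1) k *
              Complex.I) *
            ((x (j, k) : ℂ) + coordShift (spectralShift n lam0 xi 0) (spectralShift n lam0 xi 1) k *
              Complex.I))) *
      ∏ j, sqrtDet (selfDual (familyParams x j) - (Complex.I / 2) • diag4 lam0 lam0) := by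
  rw [selfDualIntegrand, ← Complex.exp_add]
  congr 2
  set S := coordShift (spectralShift n lam0 xi 0) (spectralShift n lam0 xi 1) with hS
  have h1 : ∀ j, Matrix.trace ((selfDual (familyParams x j) + (Complex.I / 2) • diag4 lam0 lam0
      + (Complex.I / (scaleN n lam0 : ℂ)) • diag4 (xi 0) (xi 1)) ^ 2) =
      2 * ∑ k, (coordWeight k : ℂ) * ((x (j, k) : ℂ) + S k * Complex.I) ^ 2 := by
    intro j
    rw [hS, ← trace_siteParams_sq, add_assoc, smul_diag4, smul_diag4, diag4_add]
    congr 5 <;> simp only [spectralShift] <;> push_cast <;> ring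
  have h2 : ∀ j : Fin (2 * n), Matrix.trace ((selfDual (familyParams x j.succ) -
      selfDual (familyParams x j.castSucc)) ^ 2) =
      2 * ∑ k, (coordWeight k : ℂ) * ((x (j.succ, k) : ℂ) - x (j.castSucc, k)) ^ 2 :=
    fun j => trace_siteParams_sub_sq _ _
  simp_rw [h1, h2, sum_precision_mul, add_sub_add_right_eq_sub, ← pow_two]
  simp only [mul_add, Finset.mul_sum, Finset.sum_add_distrib]
  congr 1 <;> rw [Finset.sum_comm]
  · refine Finset.sum_congr rfl fun k _ => Finset.sum_congr rfl fun j _ => ?_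
    ring
  · refine Finset.sum_congr rfl fun k _ => Finset.sum_congr rfl fun j _ => ?_
    ring

/-! ### Diagonalisation of the quadratic form -/

open scoped MatrixOrder Matrix.Norms.L2Operator in
theorem exists_precision_factor (n : ℕ) (W : ℝ) :
    ∃ M : Matrix (Fin (2 * n + 1)) (Fin (2 * n + 1)) ℝ, precision n W = Mᵀ * M ∧ IsUnit M.det := by
  obtain ⟨M, hM⟩ := CStarAlgebra.nonneg_iff_eq_star_mul_self.mp
    (posDef_precision n W).posSemidef.nonneg
  have hM' : precision n W = Mᵀ * M := by
    rw [hM, Matrix.star_eq_conjTranspose, conjTranspose_eq_transpose_of_trivial]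
  refine ⟨M, hM', ?_⟩
  have h := isUnit_det_precision n W
  rw [hM', Matrix.det_mul] at h
  exact isUnit_of_mul_isUnit_right h

/-- The square root of the covariance and the vector that is mapped to the constant vector. -/
theorem exists_covJ_factor (n : ℕ) (W : ℝ) :
    ∃ (B : Matrix (Fin (2 * n + 1)) (Fin (2 * n + 1)) ℝ) (t : Fin (2 * n + 1) → ℝ),
      Bᵀ * precision n W * B = 1 ∧ B * Bᵀ = covJ n W ∧ B *ᵥ t = (fun _ => 1) := by
  obtain ⟨M, hM, hu⟩ := exists_precision_factor n W
  have hut : IsUnit Mᵀ.det := by rwa [Matrix.det_transpose]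
  -- With the precision equal to `Mᵀ * M`, the matrix `B = M⁻¹` whitens it, and `t` is the preimage
  -- of the constant shift.
  refine ⟨M⁻¹, M *ᵥ (fun _ => 1), ?_, ?_, ?_⟩
  · rw [hM, Matrix.transpose_nonsing_inv, Matrix.mul_assoc, Matrix.mul_assoc,
      Matrix.mul_nonsing_inv _ hu, Matrix.mul_one, Matrix.nonsing_inv_mul _ hut]
  · rw [covJ_eq, hM, Matrix.mul_inv_rev, Matrix.transpose_nonsing_inv]
  · rw [Matrix.mulVec_mulVec, Matrix.nonsing_inv_mul _ hu, Matrix.one_mulVec]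

/-- The scale of the real coordinates. -/
def coordScale (k : Fin 6) : ℝ := (Real.sqrt (coordWeight k))⁻¹

theorem coordWeight_mul_coordScale_sq (k : Fin 6) : coordWeight k * coordScale k ^ 2 = 1 := by
  have h : 0 < coordWeight k := by fin_cases k <;> norm_num [coordWeight]
  rw [coordScale, inv_pow, Real.sq_sqrt h.le, mul_inv_cancel₀ h.ne']

/-- Only the two diagonal coordinates are shifted, and their scale is 1. -/
theorem coordScale_mul_coordShift (s₁ s₂ : ℝ) (k : Fin 6) :
    coordScale k * coordShift s₁ s₂ k = coordShift s₁ s₂ k := by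
  fin_cases k <;> simp [coordScale, coordWeight, coordShift]

/-- The matrix of the linear substitution. -/
def coordMatrix {N : ℕ} (B : Matrix (Fin N) (Fin N) ℝ) : Matrix (Fin N × Fin 6) (Fin N × Fin 6) ℝ :=
  Matrix.blockDiagonal fun k => coordScale k • B

theorem coordMatrix_mulVec {N : ℕ} (B : Matrix (Fin N) (Fin N) ℝ) (g : Fin N × Fin 6 → ℝ)
    (j : Fin N) (k : Fin 6) :
    (coordMatrix B *ᵥ g) (j, k) = coordScale k * ∑ i, B j i * g (i, k) := by
  rw [Matrix.mulVec, dotProduct, Fintype.sum_prod_type, Finset.mul_sum]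
  refine Finset.sum_congr rfl fun i _ => ?_
  rw [Finset.sum_eq_single k]
  · rw [coordMatrix, Matrix.blockDiagonal_apply, if_pos rfl, Matrix.smul_apply, smul_eq_mul,
      mul_assoc]
  · intro l _ hl
    rw [coordMatrix, Matrix.blockDiagonal_apply, if_neg (Ne.symm hl), zero_mul]
  · simp

/-- Six blocks give the sixth power of `det B`. The four off-diagonal coordinates have scale `1 /
√2`, which contributes `1 / 4` per site. -/
theorem det_coordMatrix {N : ℕ} (B : Matrix (Fin N) (Fin N) ℝ) :
    (coordMatrix B).det = (4 ^ N)⁻¹ * (B.det ^ 2) ^ 3 := by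
  rw [coordMatrix, Matrix.det_blockDiagonal]
  simp only [Matrix.det_smul, Fintype.card_fin, Finset.prod_mul_distrib, Finset.prod_const,
    Finset.card_univ, Finset.prod_pow]
  have h : ∏ k, coordScale k = 4⁻¹ := by
    simp only [Fin.prod_univ_six, coordScale, coordWeight]
    have h2 : Real.sqrt 2 * Real.sqrt 2 = 2 := Real.mul_self_sqrt (by norm_num)
    have h3 : (Real.sqrt 2)⁻¹ * (Real.sqrt 2)⁻¹ = 2⁻¹ := by rw [← mul_inv, h2]
    simp
    linear_combination ((Real.sqrt 2)⁻¹ * (Real.sqrt 2)⁻¹ + 2⁻¹) * h3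
  rw [h, inv_pow]
  ring

theorem sum_precision_coord {N : ℕ} {A B : Matrix (Fin N) (Fin N) ℝ} (hB : Bᵀ * A * B = 1)
    (h : Fin N → ℂ) :
    ∑ i, ∑ j, (A i j : ℂ) * ((∑ p, (B i p : ℂ) * h p) * (∑ q, (B j q : ℂ) * h q)) =
      ∑ p, h p ^ 2 := by
  have hent : ∀ p q, ∑ i, ∑ j, (B i p : ℂ) * (A i j : ℂ) * (B j q : ℂ) =
      if p = q then 1 else 0 := by
    intro p q
    have h1 := congrFun (congrFun hB p) q
    simp only [Matrix.mul_apply, Matrix.transpose_apply, Finset.sum_mul, Matrix.one_apply] at h1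
    rw [Finset.sum_comm] at h1
    have h2 := congrArg (fun r : ℝ => (r : ℂ)) h1
    push_cast at h2
    rw [h2]
    split_ifs <;> simp
  have hrhs : ∑ p, h p ^ 2 = ∑ p, ∑ q, (if p = q then (1 : ℂ) else 0) * (h p * h q) := by
    refine Finset.sum_congr rfl fun p _ => ?_
    simp [pow_two]
  rw [hrhs]
  simp_rw [← hent, Finset.sum_mul, Finset.mul_sum]
  calc ∑ i, ∑ j, ∑ p, ∑ q, (A i j : ℂ) * ((B i p : ℂ) * h p * ((B j q : ℂ) * h q))
      = ∑ i, ∑ p, ∑ j, ∑ q, (A i j : ℂ) * ((B i p : ℂ) * h p * ((B j q : ℂ) * h q)) :=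
        Finset.sum_congr rfl fun i _ => Finset.sum_comm
    _ = ∑ i, ∑ p, ∑ q, ∑ j, (A i j : ℂ) * ((B i p : ℂ) * h p * ((B j q : ℂ) * h q)) :=
        Finset.sum_congr rfl fun i _ => Finset.sum_congr rfl fun p _ => Finset.sum_comm
    _ = ∑ p, ∑ i, ∑ q, ∑ j, (A i j : ℂ) * ((B i p : ℂ) * h p * ((B j q : ℂ) * h q)) :=
        Finset.sum_comm
    _ = ∑ p, ∑ q, ∑ i, ∑ j, (A i j : ℂ) * ((B i p : ℂ) * h p * ((B j q : ℂ) * h q)) :=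
        Finset.sum_congr rfl fun p _ => Finset.sum_comm
    _ = _ := by
        refine Finset.sum_congr rfl fun p _ => Finset.sum_congr rfl fun q _ =>
          Finset.sum_congr rfl fun i _ => Finset.sum_congr rfl fun j _ => ?_
        ring

/-- The product of the shifted Gaussian weights of the substituted exponent. -/
theorem exp_quadratic_eq_prod_shiftedWeight {n : ℕ} {W : ℝ}
    {B : Matrix (Fin (2 * n + 1)) (Fin (2 * n + 1)) ℝ} {t : Fin (2 * n + 1) → ℝ}
    (hB : Bᵀ * precision n W * B = 1) (ht : B *ᵥ t = fun _ => 1) (s₁ s₂ : ℝ)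
    (g : Fin (2 * n + 1) × Fin 6 → ℝ) :
    Complex.exp (-(1 / 2 : ℂ) * ∑ k, (coordWeight k : ℂ) *
        ∑ i, ∑ j, (precision n W i j : ℂ) *
          ((((coordMatrix B *ᵥ g) (i, k) : ℂ) + coordShift s₁ s₂ k * Complex.I) *
            (((coordMatrix B *ᵥ g) (j, k) : ℂ) + coordShift s₁ s₂ k * Complex.I))) =
      ∏ p : Fin (2 * n + 1) × Fin 6, shiftedWeight (coordShift s₁ s₂ p.2 * t p.1) (g p) := by
  -- Since `B t` is the constant vector 1, the constant shift is moved through `B` and becomes a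
  -- shift of the independent variables.
  have hx : ∀ i k, ((coordMatrix B *ᵥ g) (i, k) : ℂ) + coordShift s₁ s₂ k * Complex.I =
      coordScale k * ∑ p, (B i p : ℂ) *
        ((g (p, k) : ℂ) + ((coordShift s₁ s₂ k * t p : ℝ) : ℂ) * Complex.I) := by
    intro i k
    have h1 : ∑ p, B i p * t p = 1 := congrFun ht i
    have h1' : ∑ p, (B i p : ℂ) * (t p : ℂ) = 1 := by exact_mod_cast h1
    have h2 : (coordScale k : ℂ) * coordShift s₁ s₂ k = coordShift s₁ s₂ k := by
      exact_mod_cast coordScale_mul_coordShift s₁ s₂ k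
    rw [coordMatrix_mulVec]
    push_cast
    have h3 : ∀ p, (B i p : ℂ) * ((g (p, k) : ℂ) + coordShift s₁ s₂ k * t p * Complex.I) =
        (B i p : ℂ) * g (p, k) + coordShift s₁ s₂ k * Complex.I * ((B i p : ℂ) * t p) :=
      fun p => by ring
    simp_rw [h3, Finset.sum_add_distrib, ← Finset.mul_sum, h1']
    linear_combination -Complex.I * h2
  simp only [shiftedWeight]
  rw [← Complex.exp_sum, ← Finset.mul_sum, Fintype.sum_prod_type, Finset.sum_comm]
  congr 2
  refine Finset.sum_congr rfl fun k _ => ?_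
  simp_rw [hx]
  have h4 : (coordWeight k : ℂ) * (coordScale k : ℂ) ^ 2 = 1 := by
    exact_mod_cast coordWeight_mul_coordScale_sq k
  have h5 := sum_precision_coord hB fun p =>
    (g (p, k) : ℂ) + ((coordShift s₁ s₂ k * t p : ℝ) : ℂ) * Complex.I
  rw [← h5]
  have h6 : ∀ a b c : ℂ, a * ((coordScale k : ℂ) * b * ((coordScale k : ℂ) * c)) =
      (coordScale k : ℂ) ^ 2 * (a * (b * c)) := fun a b c => by ring
  simp_rw [h6, ← Finset.mul_sum]
  rw [← mul_assoc, h4, one_mul]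

/-! ### The integral over self-dual matrices as a Berezin integral -/

/-- The element multiplying the `k`-th real coordinate at the site `j`. -/
def coordForm {N : ℕ} (k : Fin 6) (j : Fin N) : EvenGrassmann N :=
  (![Complex.I • pairing 0 1 j j, Complex.I • pairing 2 3 j j,
    Complex.I • (pairing 0 2 j j + pairing 1 3 j j), -(pairing 0 2 j j - pairing 1 3 j j),
    Complex.I • (pairing 0 3 j j + pairing 2 1 j j), -(pairing 0 3 j j - pairing 2 1 j j)] :
    Fin 6 → EvenGrassmann N) k

theorem isNilpotent_coordForm {N : ℕ} (k : Fin 6) (j : Fin N) : IsNilpotent (coordForm k j) := by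
  have h : ∀ k l, pairing k l j j ∈ nilradical (EvenGrassmann N) :=
    fun k l => mem_nilradical.2 (isNilpotent_pairing k l j j)
  have hs : ∀ x ∈ nilradical (EvenGrassmann N), Complex.I • x ∈ nilradical (EvenGrassmann N) :=
    fun x hx => mem_nilradical.2 ((mem_nilradical.1 hx).smul _)
  refine mem_nilradical.1 ?_
  fin_cases k
  · exact hs _ (h _ _)
  · exact hs _ (h _ _)
  · exact hs _ (add_mem (h _ _) (h _ _))
  · exact neg_mem (sub_mem (h _ _) (h _ _))
  · exact hs _ (add_mem (h _ _) (h _ _))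
  · exact neg_mem (sub_mem (h _ _) (h _ _))

theorem sum_coordForm_eq_siteForm {N : ℕ} (lam : ℂ) (v : Fin 6 → ℝ) (j : Fin N) :
    (lam • pairing 0 1 j j + lam • pairing 2 3 j j) + ∑ k, (v k : ℂ) • coordForm k j =
      siteForm (lam + Complex.I * v 0) (lam + Complex.I * v 1)
        (Complex.I * (⟨v 2, v 3⟩ : ℂ)) (Complex.I * (starRingEnd ℂ) ⟨v 2, v 3⟩)
        (Complex.I * (⟨v 4, v 5⟩ : ℂ)) (Complex.I * (starRingEnd ℂ) ⟨v 4, v 5⟩) j := by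
  have hz : ∀ a b : ℝ, Complex.I * (⟨a, b⟩ : ℂ) = a * Complex.I - b := by
    intro a b
    apply Complex.ext <;> simp
  have hz' : ∀ a b : ℝ, Complex.I * (starRingEnd ℂ) ⟨a, b⟩ = a * Complex.I + b := by
    intro a b
    apply Complex.ext <;> simp
  rw [hz (v 2) (v 3), hz (v 4) (v 5), hz' (v 2) (v 3), hz' (v 4) (v 5), siteForm, Fin.sum_univ_six]
  simp only [coordForm, Matrix.cons_val]
  simp only [smul_add, smul_neg, smul_sub, add_smul, sub_smul, smul_smul,
    mul_comm Complex.I]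
  abel

/-- The Hubbard–Stratonovich identity. The factors `I` produce the minus sign of `dualForm`, and for
each complex coordinate the real and imaginary parts combine by polarisation, -(c + d)(c' + d') + (c
- d)(c' - d') = -2(c d' + d c'). -/
theorem sum_coordForm_mul {N : ℕ} (i j : Fin N) :
    ∑ k, ((coordScale k ^ 2 : ℝ) : ℂ) • (coordForm k i * coordForm k j) = dualForm i j := by
  have hw : ∀ k, ((coordScale k ^ 2 : ℝ) : ℂ) = (![1, 1, 1 / 2, 1 / 2, 1 / 2, 1 / 2] : Fin 6 → ℂ) k := by
    intro k
    have h1 := coordWeight_mul_coordScale_sq k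
    have h2 : ((coordWeight k : ℝ) : ℂ) * ((coordScale k ^ 2 : ℝ) : ℂ) = 1 := by exact_mod_cast h1
    fin_cases k <;> simp [coordWeight] at h2 ⊢ <;> first | exact h2 | (linear_combination (1 / 2 : ℂ) * h2)
  simp only [hw]
  rw [Fin.sum_univ_six]
  simp only [coordForm, Matrix.cons_val, dualForm]
  simp only [Algebra.smul_def]
  have hI : algebraMap ℂ (EvenGrassmann N) Complex.I * algebraMap ℂ (EvenGrassmann N) Complex.I =
      -1 := by
    rw [← map_mul, Complex.I_mul_I, map_neg, map_one]
  have hh : algebraMap ℂ (EvenGrassmann N) (1 / 2) + algebraMap ℂ (EvenGrassmann N) (1 / 2) = 1 := by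
    rw [← map_add]
    norm_num
  rw [map_one]
  generalize algebraMap ℂ (EvenGrassmann N) Complex.I = I at *
  generalize algebraMap ℂ (EvenGrassmann N) (1 / 2) = r at *
  generalize pairing 0 1 i i = a
  generalize pairing 2 3 i i = b
  generalize pairing 0 2 i i = c
  generalize pairing 1 3 i i = d
  generalize pairing 0 3 i i = e
  generalize pairing 2 1 i i = f
  generalize pairing 0 1 j j = a'
  generalize pairing 2 3 j j = b'
  generalize pairing 0 2 j j = c'
  generalize pairing 1 3 j j = d'
  generalize pairing 0 3 j j = e'
  generalize pairing 2 1 j j = f'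
  linear_combination (a * a' + b * b' + r * ((c + d) * (c' + d') + (e + f) * (e' + f'))) * hI -
    (c * d' + d * c' + e * f' + f * e') * hh

/-- Multiplying F - iΛ/2 by `I` gives the coefficients of the site form and changes the sign of the
quaternion determinant. The number of sites is odd, so one minus sign survives: the sign in front of
both formulas. -/
theorem prod_sqrtDet_eq_berezin {n : ℕ} (lam0 : ℝ) (x : Fin (2 * n + 1) × Fin 6 → ℝ) :
    ∏ j, sqrtDet (selfDual (familyParams x j) - (Complex.I / 2) • diag4 lam0 lam0) =
      -berezin (2 * n + 1) (IsNilpotent.exp (spectralForm _ (lam0 / 2) (lam0 / 2) +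
        ∑ p : Fin (2 * n + 1) × Fin 6, (x p : ℂ) • coordForm p.2 p.1)) := by
  rw [spectralForm, Fintype.sum_prod_type, ← Finset.sum_add_distrib]
  simp_rw [sum_coordForm_eq_siteForm (lam0 / 2 : ℂ) (fun k => x (_, k))]
  rw [berezin_exp_siteForm]
  have h : ∀ j, sqrtDet (selfDual (familyParams x j) - (Complex.I / 2) • diag4 lam0 lam0) =
      -((lam0 / 2 + Complex.I * x (j, 0)) * (lam0 / 2 + Complex.I * x (j, 1)) -
        (Complex.I * (⟨x (j, 2), x (j, 3)⟩ : ℂ)) *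
          (Complex.I * (starRingEnd ℂ) ⟨x (j, 2), x (j, 3)⟩) -
        (Complex.I * (⟨x (j, 4), x (j, 5)⟩ : ℂ)) *
          (Complex.I * (starRingEnd ℂ) ⟨x (j, 4), x (j, 5)⟩)) := by
    intro j
    rw [smul_diag4, sqrtDet_selfDual_sub_diag4]
    simp only [familyParams, siteParams]
    have hI := Complex.I_sq
    linear_combination (lam0 ^ 2 / 4 + x (j, 0) * x (j, 1) -
      (⟨x (j, 2), x (j, 3)⟩ : ℂ) * (starRingEnd ℂ) ⟨x (j, 2), x (j, 3)⟩ -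
      (⟨x (j, 4), x (j, 5)⟩ : ℂ) * (starRingEnd ℂ) ⟨x (j, 4), x (j, 5)⟩ : ℂ) * hI
  simp_rw [h]
  rw [Finset.prod_neg, Finset.card_univ, Fintype.card_fin, Odd.neg_one_pow ⟨n, rfl⟩, neg_one_mul]

/-- The element multiplying an independent Gaussian coordinate. -/
def sourceForm {N : ℕ} (B : Matrix (Fin N) (Fin N) ℝ) (p : Fin N × Fin 6) : EvenGrassmann N :=
  ∑ j, ((coordScale p.2 : ℂ) * (B j p.1 : ℂ)) • coordForm p.2 j

theorem isNilpotent_sourceForm {N : ℕ} (B : Matrix (Fin N) (Fin N) ℝ) (p : Fin N × Fin 6) :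
    IsNilpotent (sourceForm B p) :=
  isNilpotent_finset_sum fun _ _ => (isNilpotent_coordForm _ _).smul _

theorem sum_mulVec_smul_coordForm {N : ℕ} (B : Matrix (Fin N) (Fin N) ℝ) (g : Fin N × Fin 6 → ℝ) :
    ∑ p, ((coordMatrix B *ᵥ g) p : ℂ) • coordForm p.2 p.1 = ∑ p, (g p : ℂ) • sourceForm B p := by
  rw [Fintype.sum_prod_type_right, Fintype.sum_prod_type_right]
  refine Finset.sum_congr rfl fun k _ => ?_
  simp only [coordMatrix_mulVec, sourceForm]
  push_cast
  simp only [Finset.mul_sum, Finset.sum_smul, Finset.smul_sum, smul_smul]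
  rw [Finset.sum_comm]
  refine Finset.sum_congr rfl fun i _ => Finset.sum_congr rfl fun j _ => ?_
  congr 1
  ring

theorem sum_sourceForm_sq {N : ℕ} {B J : Matrix (Fin N) (Fin N) ℝ} (hB : B * Bᵀ = J) :
    ∑ p, ((1 : ℂ) / 2) • sourceForm B p ^ 2 = ∑ i, ∑ j, ((J i j : ℂ) / 2) • dualForm i j := by
  have hJ : ∀ i j, (J i j : ℂ) = ∑ p, (B i p : ℂ) * (B j p : ℂ) := by
    intro i j
    rw [← hB]
    simp [Matrix.mul_apply]
  have hl : ∀ (k : Fin 6) (p : Fin N), ((1 : ℂ) / 2) • sourceForm B (p, k) ^ 2 =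
      ∑ i, ∑ j, ((1 : ℂ) / 2 * ((coordScale k : ℂ) ^ 2 * ((B i p : ℂ) * (B j p : ℂ)))) •
        (coordForm k i * coordForm k j) := by
    intro k p
    rw [sourceForm, pow_two, Finset.sum_mul_sum, Finset.smul_sum]
    refine Finset.sum_congr rfl fun i _ => ?_
    rw [Finset.smul_sum]
    refine Finset.sum_congr rfl fun j _ => ?_
    rw [smul_mul_smul_comm, smul_smul]
    congr 1
    ring
  have hr : ∀ i j : Fin N, ((J i j : ℂ) / 2) • dualForm i j =
      ∑ k, ∑ p, ((1 : ℂ) / 2 * ((coordScale k : ℂ) ^ 2 * ((B i p : ℂ) * (B j p : ℂ)))) •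
        (coordForm k i * coordForm k j) := by
    intro i j
    rw [hJ, ← sum_coordForm_mul, Finset.smul_sum]
    refine Finset.sum_congr rfl fun k _ => ?_
    rw [← Finset.sum_smul, smul_smul]
    congr 1
    push_cast
    rw [← Finset.mul_sum, ← Finset.mul_sum]
    ring
  rw [Fintype.sum_prod_type_right]
  simp_rw [hl, hr]
  rw [Finset.sum_congr rfl fun k _ => Finset.sum_comm, Finset.sum_comm]
  refine Finset.sum_congr rfl fun i _ => ?_
  rw [Finset.sum_congr rfl fun k _ => Finset.sum_comm, Finset.sum_comm]

/-- The means `-s t I`, paired with coefficients containing `I`, give real spectral shifts; `B t =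
1` makes them equal at all sites. Added to `lam0 / 2` from the determinants they yield the spectral
parameters of the moment. -/
theorem sum_shift_smul_sourceForm {N : ℕ} {B : Matrix (Fin N) (Fin N) ℝ} {t : Fin N → ℝ}
    (ht : B *ᵥ t = fun _ => 1) (s₁ s₂ : ℝ) :
    ∑ p : Fin N × Fin 6, (-(((coordShift s₁ s₂ p.2 * t p.1 : ℝ) : ℂ) * Complex.I)) •
      sourceForm B p = spectralForm N s₁ s₂ := by
  have h1 : ∀ (k : Fin 6) , ∑ i, (-(((coordShift s₁ s₂ k * t i : ℝ) : ℂ) * Complex.I)) •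
      sourceForm B (i, k) = ∑ j, (-((coordShift s₁ s₂ k : ℂ) * Complex.I)) • coordForm k j := by
    intro k
    simp only [sourceForm, Finset.smul_sum, smul_smul]
    rw [Finset.sum_comm]
    refine Finset.sum_congr rfl fun j _ => ?_
    rw [← Finset.sum_smul]
    congr 1
    have h2 : ∑ p, B j p * t p = 1 := congrFun ht j
    have h2' : ∑ p, (B j p : ℂ) * (t p : ℂ) = 1 := by exact_mod_cast h2
    have h3 : (coordScale k : ℂ) * coordShift s₁ s₂ k = coordShift s₁ s₂ k := by
      exact_mod_cast coordScale_mul_coordShift s₁ s₂ k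
    calc _ = ∑ i, (-((coordScale k * coordShift s₁ s₂ k : ℂ) * Complex.I)) *
          ((B j i : ℂ) * (t i : ℂ)) := Finset.sum_congr rfl fun i _ => by push_cast; ring
      _ = _ := by rw [← Finset.mul_sum, h2', mul_one, h3]
  rw [Fintype.sum_prod_type_right]
  simp only [h1]
  rw [Finset.sum_comm, spectralForm]
  refine Finset.sum_congr rfl fun j _ => ?_
  rw [Fin.sum_univ_six]
  simp [coordShift, coordForm, smul_smul, mul_assoc]

theorem spectralForm_add {N : ℕ} (a b c d : ℂ) :
    spectralForm N a b + spectralForm N c d = spectralForm N (a + c) (b + d) := by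
  simp only [spectralForm, ← Finset.sum_add_distrib, add_smul]
  refine Finset.sum_congr rfl fun j _ => ?_
  abel

/-- In whitened coordinates the integrand is a product of shifted Gaussian weights times a Berezin
integral. Integrating produces the Berezin integral already found for the mixed moment. -/
theorem coordShift_integrals {n : ℕ} {W : ℝ} (lam0 : ℝ) (xi : Fin 2 → ℝ)
    {B : Matrix (Fin (2 * n + 1)) (Fin (2 * n + 1)) ℝ} {t : Fin (2 * n + 1) → ℝ}
    (hB : Bᵀ * precision n W * B = 1) (hJ : B * Bᵀ = covJ n W) (ht : B *ᵥ t = fun _ => 1) :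
    Integrable (fun g => selfDualIntegrand n W lam0 xi (familyParams (coordMatrix B *ᵥ g))) ∧
    ∫ g, selfDualIntegrand n W lam0 xi (familyParams (coordMatrix B *ᵥ g)) =
      -(∏ _p : Fin (2 * n + 1) × Fin 6, (Real.sqrt (2 * Real.pi) : ℂ)) *
        mixedMoment n W (fun l : Fin 2 => (lam0 : ℂ) + (xi l : ℂ) / (scaleN n lam0 : ℂ)) := by
  set s₁ := spectralShift n lam0 xi 0 with hs₁
  set s₂ := spectralShift n lam0 xi 1 with hs₂
  have key := integral_functional_prod_exp
    (fun _ : Fin (2 * n + 1) × Fin 6 => (volume : Measure ℝ))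
    (fun p => shiftedWeight (coordShift s₁ s₂ p.2 * t p.1))
    (fun p k => integrable_shiftedWeight_mul_pow _ k) (fun _ => (Real.sqrt (2 * Real.pi) : ℂ))
    (fun p => -(((coordShift s₁ s₂ p.2 * t p.1 : ℝ) : ℂ) * Complex.I)) (fun _ => 1)
    (fun p => shiftedMoment (coordShift s₁ s₂ p.2 * t p.1))
    (fun p => isGaussMoments_shiftedMoment _) (fun p k => integral_shiftedWeight_mul_pow _ k)
    (sourceForm B) (isNilpotent_sourceForm B)
    (IsNilpotent.exp (spectralForm _ (lam0 / 2) (lam0 / 2))) (berezin (2 * n + 1))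
  have hint : ∀ g : Fin (2 * n + 1) × Fin 6 → ℝ,
      selfDualIntegrand n W lam0 xi (familyParams (coordMatrix B *ᵥ g)) =
      -((∏ p, shiftedWeight (coordShift s₁ s₂ p.2 * t p.1) (g p)) *
        berezin (2 * n + 1) (IsNilpotent.exp (spectralForm _ (lam0 / 2) (lam0 / 2)) *
          ∏ p, IsNilpotent.exp ((g p : ℂ) • sourceForm B p))) := by
    intro g
    rw [selfDualIntegrand_familyParams, exp_quadratic_eq_prod_shiftedWeight hB ht,
      prod_sqrtDet_eq_berezin, sum_mulVec_smul_coordForm, mul_neg]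
    rw [IsNilpotent.exp_add_of_commute (Commute.all _ _) (isNilpotent_spectralForm _ _ _)
      (isNilpotent_finset_sum fun p _ => (isNilpotent_sourceForm B p).smul _),
      exp_finset_sum _ _ fun p _ => (isNilpotent_sourceForm B p).smul _]
  simp_rw [hint]
  refine ⟨key.1.neg, ?_⟩
  rw [integral_neg, neg_mul]
  congr 1
  refine key.2.trans ?_
  congr 1
  rw [(mixedMoment_eq_berezin n W _).2]
  have hn : ∀ p, IsNilpotent ((-(((coordShift s₁ s₂ p.2 * t p.1 : ℝ) : ℂ) * Complex.I)) •
      sourceForm B p) := fun p => (isNilpotent_sourceForm B p).smul _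
  have hn2 : ∀ p, IsNilpotent (((1 : ℂ) / 2) • sourceForm B p ^ 2) :=
    fun p => ((isNilpotent_sourceForm B p).pow_of_pos two_ne_zero).smul _
  have hsplit : ∀ p, IsNilpotent.exp ((-(((coordShift s₁ s₂ p.2 * t p.1 : ℝ) : ℂ) * Complex.I)) •
      sourceForm B p + ((1 : ℂ) / 2) • sourceForm B p ^ 2) =
      IsNilpotent.exp ((-(((coordShift s₁ s₂ p.2 * t p.1 : ℝ) : ℂ) * Complex.I)) •
      sourceForm B p) * IsNilpotent.exp (((1 : ℂ) / 2) • sourceForm B p ^ 2) :=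
    fun p => IsNilpotent.exp_add_of_commute (Commute.all _ _) (hn p) (hn2 p)
  simp only [hsplit]
  rw [Finset.prod_mul_distrib, ← exp_finset_sum _ _ fun p _ => hn p,
    ← exp_finset_sum _ _ fun p _ => hn2 p, sum_sourceForm_sq hJ, sum_shift_smul_sourceForm ht,
    ← mul_assoc, ← IsNilpotent.exp_add_of_commute (Commute.all _ _)
      (isNilpotent_spectralForm _ _ _) (isNilpotent_spectralForm _ _ _), spectralForm_add]
  congr 4 <;> simp only [hs₁, hs₂, spectralShift] <;> push_cast <;> ring

/-- The representation of the mixed moment over self-dual matrices. -/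
theorem selfDual_representation (n : ℕ) (W lam0 : ℝ) (xi : Fin 2 → ℝ) :
    Integrable (selfDualIntegrand n W lam0 xi) ∧
      mixedMoment n W (fun l : Fin 2 => (lam0 : ℂ) + (xi l : ℂ) / (scaleN n lam0 : ℂ)) =
        -((2 * (Real.pi : ℂ) ^ 3) ^ (2 * n + 1))⁻¹ * (((covJ n W).det : ℂ) ^ 3)⁻¹ *
          ∫ p : Fin (2 * n + 1) → ℝ × ℝ × ℂ × ℂ, selfDualIntegrand n W lam0 xi p := by
  obtain ⟨B, t, hB, hJ, ht⟩ := exists_covJ_factor n W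
  obtain ⟨h1, h2⟩ := coordShift_integrals lam0 xi hB hJ ht
  have hdetB : B.det ^ 2 = (covJ n W).det := by
    rw [← hJ, Matrix.det_mul, Matrix.det_transpose, pow_two]
  have hdet0 : (covJ n W).det ≠ 0 := by
    rw [covJ_eq, Matrix.det_nonsing_inv]
    exact (isUnit_det_precision n W).ringInverse.ne_zero
  have hpos : 0 < (covJ n W).det := by
    rw [← hdetB] at hdet0 ⊢
    positivity
  have hdet : (coordMatrix B).det = (4 ^ (2 * n + 1))⁻¹ * (covJ n W).det ^ 3 := by
    rw [det_coordMatrix, hdetB]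
  have hdpos : 0 < (coordMatrix B).det := by
    rw [hdet]
    positivity
  have hmap := Real.map_matrix_volume_pi_eq_smul_volume_pi hdpos.ne'
  set T : (Fin (2 * n + 1) × Fin 6 → ℝ) ≃L[ℝ] (Fin (2 * n + 1) × Fin 6 → ℝ) :=
    (LinearEquiv.ofIsUnitDet (f := Matrix.toLin' (coordMatrix B))
      (v := Pi.basisFun ℝ _) (v' := Pi.basisFun ℝ _) (by
        rw [LinearMap.toMatrix_eq_toMatrix', LinearMap.toMatrix'_toLin']
        exact isUnit_iff_ne_zero.2 hdpos.ne')).toContinuousLinearEquiv with hT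
  have hTe : ∀ g, T g = coordMatrix B *ᵥ g := fun g => rfl
  have hTm : MeasurableEmbedding (fun g => coordMatrix B *ᵥ g) :=
    T.toHomeomorph.measurableEmbedding
  have hmap' : Measure.map (fun g => coordMatrix B *ᵥ g) volume =
      ENNReal.ofReal |(coordMatrix B).det⁻¹| • volume := hmap
  have hI : Integrable (fun x => selfDualIntegrand n W lam0 xi (familyParams x)) := by
    have h3 : Integrable (fun x => selfDualIntegrand n W lam0 xi (familyParams x))
        (Measure.map (fun g => coordMatrix B *ᵥ g) volume) :=
      hTm.integrable_map_iff.2 h1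
    rw [hmap'] at h3
    refine (integrable_smul_measure ?_ ENNReal.ofReal_ne_top).1 h3
    simp [hdpos.ne']
  have hval : ∫ x, selfDualIntegrand n W lam0 xi (familyParams x) =
      ((coordMatrix B).det : ℂ) *
        ∫ g, selfDualIntegrand n W lam0 xi (familyParams (coordMatrix B *ᵥ g)) := by
    have h3 := hTm.integral_map (μ := volume)
      (fun x => selfDualIntegrand n W lam0 xi (familyParams x))
    rw [hmap', integral_smul_measure, ENNReal.toReal_ofReal (abs_nonneg _),
      abs_of_pos (inv_pos.2 hdpos)] at h3
    rw [← h3, Complex.real_smul, ← mul_assoc, Complex.ofReal_inv, mul_inv_cancel₀, one_mul]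
    exact_mod_cast hdpos.ne'
  have hfp := measurePreserving_familyParams (2 * n + 1)
  have hfe := measurableEmbedding_familyParams (2 * n + 1)
  refine ⟨(hfp.integrable_comp_emb hfe).1 hI, ?_⟩
  rw [← hfp.integral_comp hfe, hval, h2, hdet]
  have hsq : (Real.sqrt (2 * Real.pi) : ℂ) ^ 2 = 2 * Real.pi := by
    exact_mod_cast Real.sq_sqrt (by positivity)
  -- The `6N` Gaussian normalisations give (2π)³ = 4 · 2π³ per site, and the 4 cancels against the
  -- Jacobian.
  have hprod : ∏ _p : Fin (2 * n + 1) × Fin 6, (Real.sqrt (2 * Real.pi) : ℂ) =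
      4 ^ (2 * n + 1) * (2 * (Real.pi : ℂ) ^ 3) ^ (2 * n + 1) := by
    rw [Finset.prod_const, Finset.card_univ, Fintype.card_prod, Fintype.card_fin, Fintype.card_fin,
      mul_comm (2 * n + 1) 6, pow_mul, show 6 = 2 * 3 from rfl, pow_mul, hsq, ← mul_pow]
    congr 1
    ring
  rw [hprod]
  have hd0 : ((covJ n W).det : ℂ) ≠ 0 := by exact_mod_cast hpos.ne'
  have hpi : (Real.pi : ℂ) ≠ 0 := by exact_mod_cast Real.pi_ne_zero
  push_cast
  field_simp

/-! ### The action of the symplectic group on self-dual matrices -/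

theorem selfDual_add (p q : ℝ × ℝ × ℂ × ℂ) : selfDual (p + q) = selfDual p + selfDual q := by
  ext i j
  rcases i with i | i <;> rcases j with j | j <;> fin_cases i <;> fin_cases j <;>
    simp [selfDual, sigma]
  all_goals ring

theorem selfDual_smul (r : ℝ) (p : ℝ × ℝ × ℂ × ℂ) : selfDual (r • p) = (r : ℂ) • selfDual p := by
  ext i j
  rcases i with i | i <;> rcases j with j | j <;> fin_cases i <;> fin_cases j <;>
    simp [selfDual, sigma]

theorem selfDual_conjTranspose (p : ℝ × ℝ × ℂ × ℂ) : (selfDual p)ᴴ = selfDual p := by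
  ext i j
  rcases i with i | i <;> rcases j with j | j <;> fin_cases i <;> fin_cases j <;>
    simp [selfDual, sigma]

theorem selfDual_mul_J (p : ℝ × ℝ × ℂ × ℂ) :
    selfDual p * Matrix.J (Fin 2) ℂ = Matrix.J (Fin 2) ℂ * (selfDual p)ᵀ := by
  ext i j
  rcases i with i | i <;> rcases j with j | j <;> fin_cases i <;> fin_cases j <;>
    simp [selfDual, sigma, Matrix.mul_apply, Matrix.J, Matrix.fromBlocks, Matrix.one_apply]

/-- The parameters read off from the entries of a self-dual matrix. -/
def matParams (M : Matrix I4 I4 ℂ) : ℝ × ℝ × ℂ × ℂ :=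
  ((M (Sum.inl 0) (Sum.inl 0)).re, (M (Sum.inl 1) (Sum.inl 1)).re,
    M (Sum.inl 0) (Sum.inl 1), M (Sum.inl 0) (Sum.inr 1))

theorem matParams_selfDual (p : ℝ × ℝ × ℂ × ℂ) : matParams (selfDual p) = p := by
  simp [matParams, selfDual, sigma]

theorem selfDual_matParams {M : Matrix I4 I4 ℂ} (h1 : Mᴴ = M)
    (h2 : M * Matrix.J (Fin 2) ℂ = Matrix.J (Fin 2) ℂ * Mᵀ) : selfDual (matParams M) = M := by
  have e1 : ∀ i j, (starRingEnd ℂ) (M j i) = M i j := fun i j => congrFun (congrFun h1 i) j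
  have hre : ∀ i, ((M i i).re : ℂ) = M i i := fun i => Complex.conj_eq_iff_re.1 (e1 i i)
  have e2 : ∀ i j : Fin 2, M (Sum.inl i) (Sum.inr j) = -M (Sum.inl j) (Sum.inr i) := by
    intro i j
    have h := congrFun (congrFun h2 (Sum.inl i)) (Sum.inl j)
    simpa [Matrix.mul_apply, Matrix.J, Matrix.fromBlocks, Matrix.one_apply] using h
  have e3 : ∀ i j : Fin 2, M (Sum.inr i) (Sum.inr j) = M (Sum.inl j) (Sum.inl i) := by
    intro i j
    have h := congrFun (congrFun h2 (Sum.inr i)) (Sum.inl j)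
    simpa [Matrix.mul_apply, Matrix.J, Matrix.fromBlocks, Matrix.one_apply] using h
  have e4 : ∀ i : Fin 2, M (Sum.inl i) (Sum.inr i) = 0 := fun i => by
    have h := e2 i i
    linear_combination h / 2
  have e5 : ∀ i j : Fin 2, M (Sum.inr i) (Sum.inl j) = (starRingEnd ℂ) (M (Sum.inl j) (Sum.inr i)) :=
    fun i j => (e1 _ _).symm
  have e6 := e2 1 0
  have e7 := e1 (Sum.inl 1) (Sum.inl 0)
  ext i j
  rcases i with i | i <;> rcases j with j | j <;> fin_cases i <;> fin_cases j <;>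
    simp [selfDual, sigma, matParams, hre, e3, e4, e5, e6, e7]

/-- Unitarity preserves Hermitian symmetry; the symplectic relation, used for `P` and for its
inverse `Pᴴ`, preserves self-duality. -/
theorem conj_selfDual_eq (P : Sp2) (p : ℝ × ℝ × ℂ × ℂ) :
    selfDual (matParams (P.matᴴ * selfDual p * P.mat)) = P.matᴴ * selfDual p * P.mat := by
  refine selfDual_matParams ?_ ?_
  · rw [Matrix.conjTranspose_mul, Matrix.conjTranspose_mul, selfDual_conjTranspose,
      Matrix.conjTranspose_conjTranspose, Matrix.mul_assoc]
  · have h1 := mat_mul_J P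
    have h2 := mat_mul_J P⁻¹
    rw [mat_inv, Matrix.conjTranspose_conjTranspose] at h2
    rw [Matrix.mul_assoc, h1, ← Matrix.mul_assoc, Matrix.mul_assoc P.matᴴ, selfDual_mul_J,
      ← Matrix.mul_assoc P.matᴴ, h2, Matrix.transpose_mul, Matrix.transpose_mul]
    simp only [Matrix.mul_assoc]

/-- The action `F ↦ Pᴴ F P` on the parameters of self-dual matrices. -/
def conjParams (P : Sp2) : (ℝ × ℝ × ℂ × ℂ) →ₗ[ℝ] (ℝ × ℝ × ℂ × ℂ) where
  toFun p := matParams (P.matᴴ * selfDual p * P.mat)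
  map_add' p q := by
    rw [selfDual_add, Matrix.mul_add, Matrix.add_mul]
    simp [matParams]
  map_smul' r p := by
    rw [selfDual_smul, Matrix.mul_smul, Matrix.smul_mul]
    simp [matParams]

theorem selfDual_conjParams (P : Sp2) (p : ℝ × ℝ × ℂ × ℂ) :
    selfDual (conjParams P p) = P.matᴴ * selfDual p * P.mat := conj_selfDual_eq P p

theorem selfDual_injective : Function.Injective selfDual :=
  Function.LeftInverse.injective matParams_selfDual

theorem conjParams_mul (P Q : Sp2) (p : ℝ × ℝ × ℂ × ℂ) :
    conjParams (P * Q) p = conjParams Q (conjParams P p) := by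
  apply selfDual_injective
  simp only [selfDual_conjParams, mat_mul, Matrix.conjTranspose_mul, Matrix.mul_assoc]

theorem conjParams_one (p : ℝ × ℝ × ℂ × ℂ) : conjParams 1 p = p := by
  apply selfDual_injective
  have h1 : (1 : Sp2).mat = 1 := rfl
  rw [selfDual_conjParams, h1, Matrix.conjTranspose_one, Matrix.one_mul, Matrix.mul_one]

theorem selfDual_diag (a b : ℝ) : selfDual (a, b, 0, 0) = diag4 a b := by
  ext i j
  rcases i with i | i <;> rcases j with j | j <;> fin_cases i <;> fin_cases j <;>
    simp [selfDual, sigma, diag4]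

theorem conjParams_diag_of_mem {K : Sp2} (hK : K ∈ spOneSpOne) (a b : ℝ) :
    conjParams K (a, b, 0, 0) = (a, b, 0, 0) := by
  apply selfDual_injective
  rw [selfDual_conjParams, selfDual_diag]
  have h01 := hK 0 1 (by decide)
  have h10 := hK 1 0 (by decide)
  have hc : diag4 a b * K.mat = K.mat * diag4 a b := by
    ext i j
    rw [diag4, Matrix.diagonal_mul, Matrix.mul_diagonal]
    rcases i with i | i <;> rcases j with j | j <;> fin_cases i <;> fin_cases j <;>
      simp [h01, h10, mul_comm]
  rw [Matrix.mul_assoc, hc, ← Matrix.mul_assoc, conjTranspose_mul_mat, Matrix.one_mul]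

/-- Elements of `Sp(1) × Sp(1)` commute with diag(a, b, a, b). This is why the choice of sections is
immaterial. -/
theorem conjParams_diag_eq_of_toCoset_eq {P Q : Sp2} (h : toCoset P = toCoset Q) (a b : ℝ) :
    conjParams P (a, b, 0, 0) = conjParams Q (a, b, 0, 0) := by
  have h1 := conjParams_diag_of_mem ((toCoset_eq_iff P Q).1 h) a b
  have h2 : Q = (Q * P⁻¹) * P := by group
  rw [h2, conjParams_mul, h1]

theorem conjParams_swapMat (a b : ℝ) : conjParams swapMat (a, b, 0, 0) = (b, a, 0, 0) := by
  apply selfDual_injective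
  have hw : swapMat.mat = Matrix.fromBlocks !![0, 1; 1, 0] 0 0 !![0, 1; 1, 0] := rfl
  rw [selfDual_conjParams, selfDual_diag, selfDual_diag, hw]
  ext i j
  rcases i with i | i <;> rcases j with j | j <;> fin_cases i <;> fin_cases j <;>
    simp [Matrix.mul_apply, diag4, Matrix.diagonal_apply]

/-- Half the trace of the square of a self-dual matrix. -/
def frobSq (p : ℝ × ℝ × ℂ × ℂ) : ℝ :=
  p.1 ^ 2 + p.2.1 ^ 2 + 2 * Complex.normSq p.2.2.1 + 2 * Complex.normSq p.2.2.2

theorem trace_selfDual_sq (p : ℝ × ℝ × ℂ × ℂ) :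
    Matrix.trace (selfDual p ^ 2) = 2 * (frobSq p : ℂ) := by
  have h := trace_selfDual_add_sq p 0 0
  rw [diag4_zero, add_zero, add_zero, add_zero, Complex.mul_conj, Complex.mul_conj] at h
  rw [h, frobSq]
  push_cast
  ring

theorem trace_conj_sq (P : Sp2) (M : Matrix I4 I4 ℂ) :
    Matrix.trace ((P.matᴴ * M * P.mat) ^ 2) = Matrix.trace (M ^ 2) := by
  have h : (P.matᴴ * M * P.mat) ^ 2 = P.matᴴ * (M * M * P.mat) := by
    rw [pow_two]
    calc P.matᴴ * M * P.mat * (P.matᴴ * M * P.mat)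
        = P.matᴴ * M * (P.mat * P.matᴴ) * M * P.mat := by simp only [Matrix.mul_assoc]
      _ = _ := by rw [mat_mul_conjTranspose, Matrix.mul_one]; simp only [Matrix.mul_assoc]
  rw [h, Matrix.trace_mul_comm, Matrix.mul_assoc, mat_mul_conjTranspose, Matrix.mul_one, pow_two]

theorem frobSq_conjParams (P : Sp2) (p : ℝ × ℝ × ℂ × ℂ) : frobSq (conjParams P p) = frobSq p := by
  have h := trace_selfDual_sq (conjParams P p)
  rw [selfDual_conjParams, trace_conj_sq, trace_selfDual_sq] at h
  have h2 := mul_left_cancel₀ two_ne_zero h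
  exact_mod_cast h2.symm

theorem continuous_frobSq : Continuous frobSq := by
  unfold frobSq
  have : Continuous Complex.normSq := Complex.continuous_normSq
  fun_prop

theorem det_conjParams_mul_inv (P : Sp2) :
    LinearMap.det (conjParams P) * LinearMap.det (conjParams P⁻¹) = 1 := by
  rw [← LinearMap.det_comp]
  have h : conjParams P ∘ₗ conjParams P⁻¹ = LinearMap.id := by
    refine LinearMap.ext fun p => ?_
    rw [LinearMap.comp_apply, ← conjParams_mul, inv_mul_cancel, conjParams_one, LinearMap.id_apply]
  rw [h, LinearMap.det_id]

instance : (volume : Measure (ℝ × ℝ × ℂ × ℂ)).IsAddHaarMeasure := by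
  have h1 : (volume : Measure (ℂ × ℂ)).IsAddHaarMeasure :=
    Measure.prod.instIsAddHaarMeasure volume volume
  have h2 : (volume : Measure (ℝ × ℂ × ℂ)).IsAddHaarMeasure :=
    Measure.prod.instIsAddHaarMeasure volume volume
  exact Measure.prod.instIsAddHaarMeasure volume volume

/-- An invertible linear map scales Lebesgue measure by a constant. Here the set `frobSq < 1` is
invariant and has finite positive volume, so the constant is 1. -/
theorem measurePreserving_conjParams (P : Sp2) : MeasurePreserving (conjParams P) := by
  have hdet : LinearMap.det (conjParams P) ≠ 0 :=
    left_ne_zero_of_mul_eq_one (det_conjParams_mul_inv P)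
  have hc : Continuous (conjParams P) := LinearMap.continuous_of_finiteDimensional _
  refine ⟨hc.measurable, ?_⟩
  have hmap := Measure.map_linearMap_addHaar_eq_smul_addHaar
    (volume : Measure (ℝ × ℝ × ℂ × ℂ)) hdet
  set S : Set (ℝ × ℝ × ℂ × ℂ) := {p | frobSq p < 1} with hS
  have hSo : IsOpen S := isOpen_lt continuous_frobSq continuous_const
  have hpre : conjParams P ⁻¹' S = S := by
    ext p
    simp [hS, frobSq_conjParams]
  have hS0 : volume S ≠ 0 := (hSo.measure_pos volume ⟨0, by simp [hS, frobSq]⟩).ne'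
  have hSt : volume S ≠ ⊤ := by
    refine (lt_of_le_of_lt (measure_mono ?_) (measure_closedBall_lt_top (x := 0) (r := 1))).ne
    rintro ⟨x, y, w, z⟩ (hp : frobSq _ < 1)
    simp only [frobSq, Complex.normSq_eq_norm_sq] at hp
    simp only [mem_closedBall_zero_iff, Prod.norm_mk, Real.norm_eq_abs, sup_le_iff]
    refine ⟨abs_le_one_iff_mul_self_le_one.2 ?_, abs_le_one_iff_mul_self_le_one.2 ?_, ?_, ?_⟩
    all_goals nlinarith [sq_nonneg x, sq_nonneg y, sq_nonneg ‖w‖, sq_nonneg ‖z‖]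
  have h2 : Measure.map (conjParams P) volume S = volume S := by
    rw [Measure.map_apply hc.measurable hSo.measurableSet, hpre]
  rw [hmap, Measure.smul_apply, smul_eq_mul] at h2
  rw [hmap, (ENNReal.mul_eq_right hS0 hSt).1 h2, one_smul]

/-! ### Haar measure -/

instance : SecondCountableTopology Sp2 := by
  have : SecondCountableTopology (Matrix I4 I4 ℂ) :=
    inferInstanceAs (SecondCountableTopology (I4 → I4 → ℂ))
  exact isInducing_mat.secondCountableTopology

instance : MeasurableMul₂ Sp2 := ContinuousMul.measurableMul₂

instance : Measure.IsHaarMeasure haarSp2 := by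
  unfold haarSp2
  infer_instance

instance : IsProbabilityMeasure haarSp2 := ⟨Measure.haarMeasure_self⟩

theorem measurable_toCoset : Measurable toCoset := measurable_quotient_mk''

instance : IsProbabilityMeasure haarCoset :=
  Measure.isProbabilityMeasure_map measurable_toCoset.aemeasurable

/-- A right translate of Haar measure is again left invariant; uniqueness and equal total mass
identify the two. -/
theorem measurePreserving_mul_right (U : Sp2) :
    MeasurePreserving (fun P => P * U) haarSp2 haarSp2 := by
  refine ⟨measurable_mul_const U, ?_⟩
  have : IsProbabilityMeasure (haarSp2.map fun P => P * U) :=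
    Measure.isProbabilityMeasure_map (measurable_mul_const U).aemeasurable
  have h := Measure.haarMeasure_unique (haarSp2.map fun P => P * U)
    (⊤ : TopologicalSpace.PositiveCompacts Sp2)
  rw [h]
  have h1 : (haarSp2.map fun P => P * U)
      ((⊤ : TopologicalSpace.PositiveCompacts Sp2) : Set Sp2) = 1 := measure_univ
  rw [h1, one_smul, haarSp2]

/-! ### Diagonalisation of self-dual matrices -/

/-- The matrix of unnormalised eigenvectors. -/
def eigenMat (s : ℝ) (w₁ w₂ : ℂ) : Matrix I4 I4 ℂ :=
  Matrix.fromBlocks !![(s : ℂ), w₁; -(starRingEnd ℂ) w₁, (s : ℂ)] !![0, w₂; w₂, 0]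
    !![0, -(starRingEnd ℂ) w₂; -(starRingEnd ℂ) w₂, 0] !![(s : ℂ), (starRingEnd ℂ) w₁; -w₁, (s : ℂ)]

theorem eigenMat_mul_conjTranspose {s m : ℝ} {w₁ w₂ : ℂ}
    (h : (s : ℂ) ^ 2 + w₁ * (starRingEnd ℂ) w₁ + w₂ * (starRingEnd ℂ) w₂ = m) :
    eigenMat s w₁ w₂ * (eigenMat s w₁ w₂)ᴴ = (m : ℂ) • 1 := by
  ext i j
  rcases i with i | i <;> rcases j with j | j <;> fin_cases i <;> fin_cases j <;>
    simp [eigenMat, Matrix.mul_apply]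
  all_goals first | ring1 | linear_combination h

theorem eigenMat_mul_J {s m : ℝ} {w₁ w₂ : ℂ}
    (h : (s : ℂ) ^ 2 + w₁ * (starRingEnd ℂ) w₁ + w₂ * (starRingEnd ℂ) w₂ = m) :
    eigenMat s w₁ w₂ * Matrix.J (Fin 2) ℂ * (eigenMat s w₁ w₂)ᵀ =
      (m : ℂ) • Matrix.J (Fin 2) ℂ := by
  ext i j
  rcases i with i | i <;> rcases j with j | j <;> fin_cases i <;> fin_cases j <;>
    simp [eigenMat, Matrix.mul_apply, Matrix.J, Matrix.fromBlocks, Matrix.one_apply]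
  all_goals first | ring1 | linear_combination h | linear_combination -h

/-- Let K be the traceless part of the self-dual matrix and Σ = diag(1, -1, 1, -1). Then K² = r², ΣK
+ KΣ = 2c, and the eigenvector matrix is U = r + ΣK. These relations give U Uᴴ = 2r(r + c) and Uᴴ
(rΣ) U = 2r(r + c) K. -/
theorem eigenMat_conj {t c r : ℝ} {w₁ w₂ : ℂ}
    (h : (r : ℂ) ^ 2 = (c : ℂ) ^ 2 + w₁ * (starRingEnd ℂ) w₁ + w₂ * (starRingEnd ℂ) w₂) :
    (eigenMat (r + c) w₁ w₂)ᴴ * diag4 (t + r) (t - r) * eigenMat (r + c) w₁ w₂ =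
      ((2 * r * (r + c) : ℝ) : ℂ) • selfDual (t + c, t - c, w₁, w₂) := by
  ext i j
  rcases i with i | i <;> rcases j with j | j <;> fin_cases i <;> fin_cases j <;>
    simp [eigenMat, Matrix.mul_apply, diag4, Matrix.diagonal_apply, selfDual, sigma]
  all_goals first
    | ring1
    | linear_combination -((t : ℂ) - r) * h
    | linear_combination -((t : ℂ) + r) * h

/-- The normalised matrix of eigenvectors. -/
def eigenSp {s m : ℝ} {w₁ w₂ : ℂ} (hm : 0 < m)
    (h : (s : ℂ) ^ 2 + w₁ * (starRingEnd ℂ) w₁ + w₂ * (starRingEnd ℂ) w₂ = m) : Sp2 :=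
  ⟨⟨((Real.sqrt m)⁻¹ : ℝ) • eigenMat s w₁ w₂, by
    rw [Matrix.mem_unitaryGroup_iff, Matrix.star_eq_conjTranspose, Matrix.conjTranspose_smul,
      Matrix.smul_mul, Matrix.mul_smul, eigenMat_mul_conjTranspose h, smul_smul, star_trivial,
      ← Complex.coe_smul, smul_smul, ← Complex.ofReal_mul, ← mul_inv, Real.mul_self_sqrt hm.le,
      inv_mul_cancel₀ hm.ne', Complex.ofReal_one, one_smul]⟩, by
    change (((Real.sqrt m)⁻¹ : ℝ) • eigenMat s w₁ w₂) * Matrix.J (Fin 2) ℂ *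
      (((Real.sqrt m)⁻¹ : ℝ) • eigenMat s w₁ w₂)ᵀ = Matrix.J (Fin 2) ℂ
    rw [Matrix.transpose_smul, Matrix.smul_mul, Matrix.smul_mul, Matrix.mul_smul,
      eigenMat_mul_J h, smul_smul, ← Complex.coe_smul, smul_smul, ← Complex.ofReal_mul, ← mul_inv,
      Real.mul_self_sqrt hm.le, inv_mul_cancel₀ hm.ne', Complex.ofReal_one, one_smul]⟩

theorem exists_conjParams_eq (t c : ℝ) {r : ℝ} (w₁ w₂ : ℂ) (hr : 0 ≤ r)
    (h : r ^ 2 = c ^ 2 + Complex.normSq w₁ + Complex.normSq w₂) :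
    ∃ Q, conjParams Q (t + r, t - r, 0, 0) = (t + c, t - c, w₁, w₂) := by
  have h1 := Complex.normSq_nonneg w₁
  have h2 := Complex.normSq_nonneg w₂
  have hc : |c| ≤ r := abs_le_of_sq_le_sq (by linarith) hr
  have hs : 0 ≤ r + c := by linarith [(abs_le.1 hc).1]
  rcases hs.eq_or_lt with hs | hs
  -- The normalisation 2r(r + c) degenerates here. But then K = -rΣ is already diagonal with the
  -- eigenvalues in the other order; this includes `r = 0`.
  · have hcr : c = -r := by linarith
    rw [hcr, neg_sq] at h
    have e1 : w₁ = 0 := Complex.normSq_eq_zero.1 (by linarith)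
    have e2 : w₂ = 0 := Complex.normSq_eq_zero.1 (by linarith)
    refine ⟨swapMat, ?_⟩
    rw [conjParams_swapMat, e1, e2, hcr, sub_neg_eq_add, sub_eq_add_neg]
  · have hr' : 0 < r := by
      rcases hr.eq_or_lt with h0 | h0
      · rw [← h0] at hc
        have := abs_nonpos_iff.1 hc
        linarith
      · exact h0
    have hm : 0 < 2 * r * (r + c) := by positivity
    have hC : (r : ℂ) ^ 2 = (c : ℂ) ^ 2 + w₁ * (starRingEnd ℂ) w₁ + w₂ * (starRingEnd ℂ) w₂ := by
      rw [Complex.mul_conj, Complex.mul_conj]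
      exact_mod_cast h
    have hm' : ((r + c : ℝ) : ℂ) ^ 2 + w₁ * (starRingEnd ℂ) w₁ + w₂ * (starRingEnd ℂ) w₂ =
        ((2 * r * (r + c) : ℝ) : ℂ) := by
      push_cast
      linear_combination -hC
    refine ⟨eigenSp hm hm', selfDual_injective ?_⟩
    have hmat : (eigenSp hm hm').mat =
        ((Real.sqrt (2 * r * (r + c)))⁻¹ : ℝ) • eigenMat (r + c) w₁ w₂ := rfl
    have hd : diag4 ((t + r : ℝ) : ℂ) ((t - r : ℝ) : ℂ) = diag4 (t + r) (t - r) := by push_cast; rfl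
    rw [selfDual_conjParams, selfDual_diag, hmat, Matrix.conjTranspose_smul, star_trivial,
      Matrix.smul_mul, Matrix.smul_mul, Matrix.mul_smul, hd, eigenMat_conj hC, smul_smul,
      ← Complex.coe_smul, smul_smul, ← Complex.ofReal_mul, ← mul_inv, Real.mul_self_sqrt hm.le,
      inv_mul_cancel₀ hm.ne', Complex.ofReal_one, one_smul]

/-! ### Changes of variables -/

theorem lintegral_comp_const_mul {a : ℝ} (ha : a ≠ 0) {f : ℝ → ENNReal} (hf : Measurable f) :
    ∫⁻ x, f (a * x) = ENNReal.ofReal |a⁻¹| * ∫⁻ x, f x := by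
  rw [← lintegral_map hf (measurable_const_mul a), Real.map_volume_mul_left ha,
    lintegral_smul_measure, smul_eq_mul]

/-- The substitution x = t + r, y = t - r has Jacobian 2; it is done as a translation followed by a
one-dimensional scaling. -/
theorem lintegral_lintegral_eq_sum_diff {f : ℝ → ℝ → ENNReal} (hf : Measurable f.uncurry) :
    ∫⁻ x, ∫⁻ y, f x y = 2 * ∫⁻ t, ∫⁻ r, f (t + r) (t - r) := by
  have h1 : ∫⁻ t, ∫⁻ r, f (t + r) (t - r) = ∫⁻ r, ∫⁻ t, f (t + r) (t - r) :=
    lintegral_lintegral_swap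
      (hf.comp (by fun_prop : Measurable fun p : ℝ × ℝ => (p.1 + p.2, p.1 - p.2))).aemeasurable
  have h2 : ∀ r : ℝ, ∫⁻ t, f (t + r) (t - r) = ∫⁻ a, f a (a - 2 * r) := by
    intro r
    rw [← lintegral_add_right_eq_self (fun a => f a (a - 2 * r)) r]
    refine lintegral_congr fun t => ?_
    congr 1
    ring
  have h3 : ∫⁻ r, ∫⁻ a, f a (a - 2 * r) = ∫⁻ a, ∫⁻ r, f a (a - 2 * r) :=
    lintegral_lintegral_swap
      (hf.comp (by fun_prop : Measurable fun p : ℝ × ℝ => (p.2, p.2 - 2 * p.1))).aemeasurable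
  have h4 : ∀ a : ℝ, ∫⁻ r, f a (a - 2 * r) = ENNReal.ofReal |2⁻¹| * ∫⁻ b, f a b := by
    intro a
    have hm : Measurable (f a) := hf.comp (by fun_prop : Measurable fun b : ℝ => (a, b))
    rw [lintegral_comp_const_mul (f := fun r => f a (a - r)) two_ne_zero (hm.comp (by fun_prop)),
      lintegral_sub_left_eq_self]
  simp_rw [h1, h2, h3, h4]
  have hg : Measurable fun a => ∫⁻ b, f a b := hf.lintegral_prod_right'
  rw [lintegral_const_mul _ hg, ← mul_assoc, abs_of_pos (by norm_num),
    ENNReal.ofReal_inv_of_pos two_pos, ENNReal.ofReal_ofNat,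
    ENNReal.mul_inv_cancel two_ne_zero ENNReal.ofNat_ne_top, one_mul]

theorem lintegral_eq_two_mul_of_even {f : ℝ → ENNReal} (he : ∀ x, f (-x) = f x) :
    ∫⁻ x, f x = 2 * ∫⁻ x in Set.Ioi 0, f x := by
  have h := lintegral_add_compl f (measurableSet_Ioi (a := (0 : ℝ))) (μ := volume)
  have h2 : ∫⁻ x in (Set.Ioi (0 : ℝ))ᶜ, f x = ∫⁻ x in Set.Ioi 0, f x := by
    rw [Set.compl_Ioi, setLIntegral_congr Iio_ae_eq_Iic.symm]
    have h3 := (Measure.measurePreserving_neg (volume : Measure ℝ)).setLIntegral_comp_preimage_emb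
      (MeasurableEquiv.neg ℝ).measurableEmbedding f (Set.Iio 0)
    simp only [he] at h3
    rw [← h3]
    simp
  rw [← h, h2, two_mul]

/-- Polar coordinates for nonnegative functions, so that integrability need not be known in advance.
-/
theorem lintegral_fun_norm {E : Type*} [NormedAddCommGroup E] [NormedSpace ℝ E] [Nontrivial E]
    [FiniteDimensional ℝ E] [MeasurableSpace E] [BorelSpace E] (μ : Measure E)
    [μ.IsAddHaarMeasure] {f : ℝ → ENNReal} (hf : Measurable f) :
    ∫⁻ x, f ‖x‖ ∂μ = Module.finrank ℝ E * μ (Metric.ball 0 1) *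
      ∫⁻ r in Set.Ioi (0 : ℝ), ENNReal.ofReal (r ^ (Module.finrank ℝ E - 1)) * f r := by
  have hf' : Measurable fun r : Set.Ioi (0 : ℝ) => f r := hf.comp measurable_subtype_coe
  calc ∫⁻ x, f ‖x‖ ∂μ = ∫⁻ x in {(0 : E)}ᶜ, f ‖x‖ ∂μ := by rw [restrict_compl_singleton]
    _ = ∫⁻ x : ({(0)}ᶜ : Set E), f ‖x.1‖ ∂(μ.comap (↑)) :=
      (lintegral_subtype_comap (measurableSet_singleton _).compl fun x => f ‖x‖).symm
    _ = ∫⁻ x, f x.2 ∂(μ.toSphere.prod (.volumeIoiPow (Module.finrank ℝ E - 1))) := by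
      have h := μ.measurePreserving_homeomorphUnitSphereProd.lintegral_comp_emb
        (Homeomorph.measurableEmbedding _) (f ∘ Subtype.val ∘ Prod.snd)
      simpa using h
    _ = μ.toSphere Set.univ * ∫⁻ x : Set.Ioi (0 : ℝ), f x ∂.volumeIoiPow (Module.finrank ℝ E - 1) := by
      have h : Measurable fun x : Metric.sphere (0 : E) 1 × Set.Ioi (0 : ℝ) => f x.2 :=
        hf'.comp measurable_snd
      rw [lintegral_prod _ h.aemeasurable, mul_comm]
      dsimp only
      exact lintegral_const _
    _ = _ := by
      rw [μ.toSphere_apply_univ, Measure.volumeIoiPow,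
        lintegral_withDensity_eq_lintegral_mul _ (by fun_prop) hf']
      congr 1
      exact lintegral_subtype_comap measurableSet_Ioi
        fun r => ENNReal.ofReal (r ^ (Module.finrank ℝ E - 1)) * f r

theorem volume_ball_five : (5 : ENNReal) * volume (Metric.ball (0 : EuclideanSpace ℝ (Fin 5)) 1) =
    ENNReal.ofReal (8 * Real.pi ^ 2 / 3) := by
  have hG : Real.Gamma (((5 : ℕ) : ℝ) / 2 + 1) = 15 / 8 * Real.sqrt Real.pi := by
    rw [Real.Gamma_add_one (by norm_num), show ((5 : ℕ) : ℝ) / 2 = 3 / 2 + 1 by norm_num,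
      Real.Gamma_add_one (by norm_num), show (3 / 2 : ℝ) = 1 / 2 + 1 by norm_num,
      Real.Gamma_add_one (by norm_num), Real.Gamma_one_half_eq]
    ring
  have hs : Real.sqrt Real.pi ^ 2 = Real.pi := Real.sq_sqrt Real.pi_pos.le
  have hs0 : Real.sqrt Real.pi ≠ 0 := (Real.sqrt_pos.2 Real.pi_pos).ne'
  rw [EuclideanSpace.volume_ball, Fintype.card_fin, hG, ENNReal.ofReal_one, one_pow, one_mul,
    ← ENNReal.ofReal_ofNat, ← ENNReal.ofReal_mul (by norm_num)]
  congr 1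
  field_simp
  rw [show Real.sqrt Real.pi ^ 4 = (Real.sqrt Real.pi ^ 2) ^ 2 by ring, hs]
  ring

/-! ### The Weyl integration formula -/

theorem measurePreserving_fiveParams :
    MeasurePreserving fun v : EuclideanSpace ℝ (Fin 5) =>
      (v 0, (⟨v 1, v 2⟩ : ℂ), (⟨v 3, v 4⟩ : ℂ)) :=
  (((MeasurePreserving.id (volume : Measure ℝ)).prod measurePreserving_complexPair).comp
    (measurePreserving_headTail 4)).comp (PiLp.volume_preserving_ofLp (Fin 5))

theorem lintegral_params_eq {g : ℝ × ℝ × ℂ × ℂ → ENNReal} (hg : Measurable g) :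
    ∫⁻ p, g p = 2 * ∫⁻ t, ∫⁻ v : EuclideanSpace ℝ (Fin 5),
      g (t + v 0, t - v 0, ⟨v 1, v 2⟩, ⟨v 3, v 4⟩) := by
  have h1 : ∫⁻ p, g p = ∫⁻ x, ∫⁻ y, ∫⁻ w : ℂ × ℂ, g (x, y, w) := by
    rw [Measure.volume_eq_prod, lintegral_prod _ hg.aemeasurable]
    refine lintegral_congr fun x => ?_
    rw [Measure.volume_eq_prod, lintegral_prod _ (by fun_prop)]
  have hm : Measurable (Function.uncurry fun x y => ∫⁻ w : ℂ × ℂ, g (x, y, w)) :=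
    Measurable.lintegral_prod_right' (f := fun q : (ℝ × ℝ) × ℂ × ℂ => g (q.1.1, q.1.2, q.2))
      (by fun_prop)
  rw [h1, lintegral_lintegral_eq_sum_diff hm]
  congr 1
  refine lintegral_congr fun t => ?_
  have h2 : Measurable fun q : ℝ × ℂ × ℂ => g (t + q.1, t - q.1, q.2) := by fun_prop
  have h3 := measurePreserving_fiveParams.lintegral_comp h2
  have h4 : ∫⁻ q : ℝ × ℂ × ℂ, g (t + q.1, t - q.1, q.2) =
      ∫⁻ r, ∫⁻ w : ℂ × ℂ, g (t + r, t - r, w) := by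
    rw [Measure.volume_eq_prod, lintegral_prod _ h2.aemeasurable]
  exact h4.symm.trans h3.symm

theorem continuous_mat : Continuous Sp2.mat := isInducing_mat.continuous

theorem continuous_selfDual : Continuous selfDual := by
  refine continuous_matrix fun i j => ?_
  rcases i with i | i <;> rcases j with j | j <;> fin_cases i <;> fin_cases j <;>
    simp [selfDual, sigma] <;> fun_prop

theorem continuous_matParams : Continuous matParams := by
  unfold matParams
  have h : ∀ i j, Continuous fun M : Matrix I4 I4 ℂ => M i j := fun i j =>
    (continuous_apply j).comp (continuous_apply i)
  exact (Complex.continuous_re.comp (h _ _)).prodMk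
    ((Complex.continuous_re.comp (h _ _)).prodMk ((h _ _).prodMk (h _ _)))

theorem continuous_conjParams :
    Continuous fun q : Sp2 × (ℝ × ℝ × ℂ × ℂ) => conjParams q.1 q.2 := by
  have h1 : Continuous fun q : Sp2 × (ℝ × ℝ × ℂ × ℂ) => q.1.mat := continuous_mat.comp continuous_fst
  exact continuous_matParams.comp
    ((h1.matrix_conjTranspose.mul (continuous_selfDual.comp continuous_snd)).mul h1)

theorem measurable_conjParams_comp {α : Type*} [MeasurableSpace α] {P : α → Sp2}
    {p : α → ℝ × ℝ × ℂ × ℂ} (hP : Measurable P) (hp : Measurable p) :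
    Measurable fun z => conjParams (P z) (p z) :=
  Measurable.comp (g := fun q : Sp2 × (ℝ × ℝ × ℂ × ℂ) => RBM.conjParams q.1 q.2)
    (f := fun z => (P z, p z)) continuous_conjParams.measurable (hP.prodMk hp)

/-- The average over the orbits of the symplectic group. -/
def orbitMean (g : ℝ × ℝ × ℂ × ℂ → ENNReal) (p : ℝ × ℝ × ℂ × ℂ) : ENNReal :=
  ∫⁻ P, g (conjParams P p) ∂haarSp2

theorem measurable_orbitMean {g : ℝ × ℝ × ℂ × ℂ → ENNReal} (hg : Measurable g) :
    Measurable (orbitMean g) :=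
  Measurable.lintegral_prod_left' (f := fun q : Sp2 × (ℝ × ℝ × ℂ × ℂ) => g (conjParams q.1 q.2))
    (hg.comp continuous_conjParams.measurable)

theorem orbitMean_conjParams {g : ℝ × ℝ × ℂ × ℂ → ENNReal} (Q : Sp2) (p : ℝ × ℝ × ℂ × ℂ) :
    orbitMean g (conjParams Q p) = orbitMean g p := by
  simp only [orbitMean, ← conjParams_mul]
  exact lintegral_mul_left_eq_self (fun P => g (conjParams P p)) Q

theorem lintegral_orbitMean {g : ℝ × ℝ × ℂ × ℂ → ENNReal} (hg : Measurable g) :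
    ∫⁻ p, orbitMean g p = ∫⁻ p, g p := by
  have hm : Measurable (Function.uncurry fun (p : ℝ × ℝ × ℂ × ℂ) (P : Sp2) =>
      g (conjParams P p)) := hg.comp (measurable_conjParams_comp measurable_snd measurable_fst)
  unfold orbitMean
  rw [lintegral_lintegral_swap hm.aemeasurable]
  simp_rw [(measurePreserving_conjParams _).lintegral_comp hg]
  rw [lintegral_const, measure_univ, mul_one]

/-- With half of `x + y` fixed at `t`, the point with coordinates `v` in ℝ⁵ lies in the orbit of the
diagonal matrix with eigenvalues t ± ‖v‖, and the mean is constant on orbits. -/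
theorem orbitMean_eq_norm {g : ℝ × ℝ × ℂ × ℂ → ENNReal} (t : ℝ) (v : EuclideanSpace ℝ (Fin 5)) :
    orbitMean g (t + v 0, t - v 0, ⟨v 1, v 2⟩, ⟨v 3, v 4⟩) =
      orbitMean g (t + ‖v‖, t - ‖v‖, 0, 0) := by
  obtain ⟨Q, hQ⟩ := exists_conjParams_eq t (v 0) (r := ‖v‖) ⟨v 1, v 2⟩ ⟨v 3, v 4⟩ (norm_nonneg v)
    (by
      rw [EuclideanSpace.norm_sq_eq, Fin.sum_univ_five]
      simp only [Real.norm_eq_abs, sq_abs, Complex.normSq_mk]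
      ring)
  rw [← hQ, orbitMean_conjParams]

/-- The density of the eigenvalues of a self-dual matrix. -/
def eigenDensity (x : ℝ × ℝ) : ℝ := Real.pi ^ 2 / 12 * (x.1 - x.2) ^ 4

/-- Replacing `g` by its orbit mean does not change the integral and makes it radial in ℝ⁵, where
the volume element supplies r⁴. -/
theorem weyl_lintegral {g : ℝ × ℝ × ℂ × ℂ → ENNReal} (hg : Measurable g) :
    ∫⁻ p, g p = ∫⁻ a, ∫⁻ b, ENNReal.ofReal (eigenDensity (a, b)) * orbitMean g (a, b, 0, 0) := by
  have hG := measurable_orbitMean hg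
  have hm : Measurable (Function.uncurry fun a b =>
      ENNReal.ofReal (eigenDensity (a, b)) * orbitMean g (a, b, 0, 0)) := by
    unfold eigenDensity Function.uncurry
    fun_prop
  rw [lintegral_lintegral_eq_sum_diff hm, ← lintegral_orbitMean hg, lintegral_params_eq hG]
  congr 1
  refine lintegral_congr fun t => ?_
  have hf : Measurable fun r : ℝ => orbitMean g (t + r, t - r, 0, 0) := by fun_prop
  simp_rw [orbitMean_eq_norm]
  rw [lintegral_fun_norm volume hf, finrank_euclideanSpace, Fintype.card_fin]
  -- Polar coordinates use r > 0, while integrating over all (a, b) uses every real r. Exchanging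
  -- the eigenvalues by a group element makes the integrand even.
  have he : ∀ r : ℝ, orbitMean g (t + -r, t - -r, 0, 0) = orbitMean g (t + r, t - r, 0, 0) := by
    intro r
    rw [sub_neg_eq_add, ← sub_eq_add_neg, ← conjParams_swapMat, orbitMean_conjParams]
  rw [lintegral_eq_two_mul_of_even fun r => by
    rw [he]
    congr 2
    simp only [eigenDensity]
    ring]
  rw [← lintegral_const_mul _ (by fun_prop), ← lintegral_const_mul _ (by
    unfold eigenDensity
    fun_prop)]
  refine lintegral_congr fun r => ?_
  -- The constants match because 8π²/3 = 2 · (π²/12) · 2⁴, with 2⁴ coming from a - b = 2r.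
  have h5 : ((5 : ℕ) : ENNReal) = 5 := rfl
  rw [h5, volume_ball_five, ← mul_assoc, ← mul_assoc, ← ENNReal.ofReal_ofNat,
    ← ENNReal.ofReal_mul (by positivity), ← ENNReal.ofReal_mul (by norm_num)]
  congr 2
  simp only [eigenDensity]
  ring

theorem measurable_conjParams_section {s : SpCoset → Sp2} (hs : Measurable s) :
    Measurable fun z : (ℝ × ℝ) × SpCoset => conjParams (s z.2) (z.1.1, z.1.2, 0, 0) := by
  have h1 : Measurable fun z : (ℝ × ℝ) × SpCoset => s z.2 := hs.comp measurable_snd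
  have h2 : Measurable fun z : (ℝ × ℝ) × SpCoset => (z.1.1, z.1.2, (0 : ℂ), (0 : ℂ)) := by
    fun_prop
  exact measurable_conjParams_comp h1 h2

theorem measurable_eigenDensity : Measurable eigenDensity := by
  unfold eigenDensity
  fun_prop

/-- After pulling back to the group, the representative of the coset of `P` may be replaced by `P`
itself. -/
theorem lintegral_coset_eq_orbitMean {s : SpCoset → Sp2} (hs : IsMeasurableSection s)
    {g : ℝ × ℝ × ℂ × ℂ → ENNReal} (hg : Measurable g) (a b : ℝ) :
    ∫⁻ q, g (conjParams (s q) (a, b, 0, 0)) ∂haarCoset = orbitMean g (a, b, 0, 0) := by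
  have hab : Measurable fun q => g (conjParams (s q) (a, b, 0, 0)) :=
    hg.comp (measurable_conjParams_comp hs.measurable measurable_const)
  rw [haarCoset, lintegral_map hab measurable_toCoset, orbitMean]
  refine lintegral_congr fun P => ?_
  rw [conjParams_diag_eq_of_toCoset_eq (hs.toCoset_eq (toCoset P))]

theorem lintegral_eigen {s : SpCoset → Sp2} (hs : IsMeasurableSection s)
    {g : ℝ × ℝ × ℂ × ℂ → ENNReal} (hg : Measurable g) :
    ∫⁻ z : (ℝ × ℝ) × SpCoset, g (conjParams (s z.2) (z.1.1, z.1.2, 0, 0))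
      ∂(((volume : Measure (ℝ × ℝ)).prod haarCoset).withDensity
        fun z => ENNReal.ofReal (eigenDensity z.1)) = ∫⁻ p, g p := by
  have hgm : Measurable fun z : (ℝ × ℝ) × SpCoset =>
      g (conjParams (s z.2) (z.1.1, z.1.2, 0, 0)) :=
    hg.comp (measurable_conjParams_section hs.measurable)
  have hd : Measurable fun z : (ℝ × ℝ) × SpCoset => ENNReal.ofReal (eigenDensity z.1) :=
    (measurable_eigenDensity.comp measurable_fst).ennreal_ofReal
  rw [lintegral_withDensity_eq_lintegral_mul _ hd hgm, weyl_lintegral hg]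
  rw [lintegral_prod _ (hd.mul hgm).aemeasurable]
  have hin : ∀ x : ℝ × ℝ, ∫⁻ q, ((fun z : (ℝ × ℝ) × SpCoset => ENNReal.ofReal (eigenDensity z.1)) *
      fun z : (ℝ × ℝ) × SpCoset => g (conjParams (s z.2) (z.1.1, z.1.2, 0, 0))) (x, q)
        ∂haarCoset = ENNReal.ofReal (eigenDensity x) * orbitMean g (x.1, x.2, 0, 0) := by
    intro x
    rw [← lintegral_coset_eq_orbitMean hs hg]
    have hq : Measurable fun q => g (conjParams (s q) (x.1, x.2, 0, 0)) :=
      hg.comp (measurable_conjParams_comp hs.measurable measurable_const)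
    exact lintegral_const_mul (ENNReal.ofReal (eigenDensity x)) hq
  rw [lintegral_congr hin]
  have hm : Measurable fun x : ℝ × ℝ =>
      ENNReal.ofReal (eigenDensity x) * orbitMean g (x.1, x.2, 0, 0) :=
    measurable_eigenDensity.ennreal_ofReal.mul ((measurable_orbitMean hg).comp (by fun_prop))
  exact lintegral_prod _ hm.aemeasurable

/-- The law of a self-dual matrix in terms of its eigenvalues and eigenvectors. -/
theorem measurePreserving_eigen {s : SpCoset → Sp2} (hs : IsMeasurableSection s) :
    MeasurePreserving (fun z : (ℝ × ℝ) × SpCoset => conjParams (s z.2) (z.1.1, z.1.2, 0, 0))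
      (((volume : Measure (ℝ × ℝ)).prod haarCoset).withDensity
        fun z => ENNReal.ofReal (eigenDensity z.1)) volume := by
  refine ⟨measurable_conjParams_section hs.measurable, Measure.ext_of_lintegral _ fun g hg => ?_⟩
  rw [lintegral_map hg (measurable_conjParams_section hs.measurable)]
  exact lintegral_eigen hs hg

/-! ### Unfolding the angular variables -/

theorem toCoset_mul_right {P Q : Sp2} (h : toCoset P = toCoset Q) (U : Sp2) :
    toCoset (P * U) = toCoset (Q * U) := by
  rw [toCoset_eq_iff] at h ⊢
  rwa [_root_.mul_inv_rev, mul_assoc, mul_inv_cancel_left]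

/-- Cosets identify left factors, so right multiplication descends to them, and it preserves Haar
measure on the group. -/
theorem map_toCoset_mul {s : SpCoset → Sp2} (hs : IsMeasurableSection s) (U : Sp2) :
    Measure.map (fun q => toCoset (s q * U)) haarCoset = haarCoset := by
  have hm : Measurable fun q => toCoset (s q * U) :=
    measurable_toCoset.comp (hs.measurable.mul_const U)
  have h1 : (fun q => toCoset (s q * U)) ∘ toCoset = toCoset ∘ fun P => P * U := by
    funext P
    exact toCoset_mul_right (hs.toCoset_eq (toCoset P)) U
  conv_lhs => rw [haarCoset]
  rw [Measure.map_map hm measurable_toCoset, h1,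
    ← Measure.map_map measurable_toCoset (measurable_mul_const U),
    (measurePreserving_mul_right U).map_eq]
  rfl

/-- The partial products `Q j ⋯ Q 0 U`. -/
def partialProd : {m : ℕ} → (Fin m → Sp2) → Sp2 → Fin m → Sp2
  | 0, _, _ => Fin.elim0
  | _ + 1, Q, U => Fin.cons (Q 0 * U) (partialProd (fun j => Q j.succ) (Q 0 * U))

theorem partialProd_succ_zero {m : ℕ} (Q : Fin (m + 1) → Sp2) (U : Sp2) :
    partialProd Q U 0 = Q 0 * U := rfl

theorem partialProd_succ_succ {m : ℕ} (Q : Fin (m + 1) → Sp2) (U : Sp2) (j : Fin m) :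
    partialProd Q U j.succ = partialProd (fun j => Q j.succ) (Q 0 * U) j := rfl

/-- `partialProd` recurses on the first factor, which suits the skew-product induction; this form
matches the recursion of `cumProd` on the last factor. -/
theorem partialProd_succ {m : ℕ} (Q : Fin (m + 1) → Sp2) (U : Sp2) (j : Fin m) :
    partialProd Q U j.succ = Q j.succ * partialProd Q U j.castSucc := by
  induction m generalizing U with
  | zero => exact j.elim0
  | succ m ih =>
    rw [partialProd_succ_succ]
    refine Fin.cases ?_ (fun i => ?_) j
    · rw [partialProd_succ_zero, Fin.castSucc_zero, partialProd_succ_zero]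
    · rw [ih, ← Fin.succ_castSucc, partialProd_succ_succ]

theorem partialProd_cons_one {n : ℕ} (P : Sp2) (Q : Fin (2 * n) → Sp2) (j : Fin (2 * n + 1)) :
    partialProd (Fin.cons P Q) 1 j = cumProd Q j * P := by
  refine Fin.induction ?_ (fun i hi => ?_) j
  · rw [partialProd_succ_zero, Fin.cons_zero, mul_one]
    exact (one_mul P).symm
  · rw [partialProd_succ, hi, Fin.cons_succ, ← mul_assoc]
    rfl

theorem measurable_partialProd {α : Type*} [MeasurableSpace α] {m : ℕ} {Q : α → Fin m → Sp2}
    {U : α → Sp2} (hQ : Measurable Q) (hU : Measurable U) :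
    Measurable fun a => partialProd (Q a) (U a) := by
  induction m generalizing U with
  | zero => exact measurable_pi_iff.2 fun j => j.elim0
  | succ m ih =>
    have h0 : Measurable fun a => Q a 0 * U a := ((measurable_pi_apply 0).comp hQ).mul hU
    refine measurable_pi_iff.2 fun j => ?_
    refine Fin.cases h0 (fun i => ?_) j
    exact (measurable_pi_apply i).comp
      (ih (Q := fun a j => Q a j.succ) (measurable_pi_iff.2 fun j => (measurable_pi_apply _).comp hQ) h0)

theorem measurePreserving_piHeadTail {α : Type*} [MeasurableSpace α] (μ : Measure α) [SigmaFinite μ]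
    (m : ℕ) : MeasurePreserving (fun q : Fin (m + 1) → α => (q 0, fun j : Fin m => q j.succ))
      (Measure.pi fun _ => μ) (μ.prod (Measure.pi fun _ => μ)) :=
  measurePreserving_piFinSuccAbove (fun _ => μ) 0

theorem measurePreserving_piCons {α : Type*} [MeasurableSpace α] (μ : Measure α) [SigmaFinite μ]
    (m : ℕ) : MeasurePreserving (fun z : α × (Fin m → α) => (Fin.cons z.1 z.2 : Fin (m + 1) → α))
      (μ.prod (Measure.pi fun _ => μ)) (Measure.pi fun _ => μ) := by
  have h := (measurePreserving_piFinSuccAbove (fun _ : Fin (m + 1) => μ) 0).symm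
    (MeasurableEquiv.piFinSuccAbove (fun _ => α) 0)
  refine (congrArg (fun f => MeasurePreserving f _ _) ?_).mp h
  funext z
  exact Fin.insertNth_zero' z.1 z.2

/-- The substitution is triangular: once the earlier cosets are fixed, the next one undergoes a
right multiplication, which preserves the measure. Induction assembles these as skew products. -/
theorem measurePreserving_toCoset_partialProd {m : ℕ} {s : Fin m → SpCoset → Sp2}
    (hs : ∀ j, IsMeasurableSection (s j)) (U : Sp2) :
    MeasurePreserving
      (fun (q : Fin m → SpCoset) j => toCoset (partialProd (fun j => s j (q j)) U j))
      (Measure.pi fun _ => haarCoset) (Measure.pi fun _ => haarCoset) := by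
  induction m generalizing U with
  | zero =>
    have h : (fun (q : Fin 0 → SpCoset) j => toCoset (partialProd (fun j => s j (q j)) U j)) = id := by
      funext q j
      exact j.elim0
    rw [h]
    exact MeasurePreserving.id _
  | succ m ih =>
    have hQ : Measurable fun z : SpCoset × (Fin m → SpCoset) => fun j : Fin m => s j.succ (z.2 j) :=
      measurable_pi_iff.2 fun j =>
        (hs j.succ).measurable.comp ((measurable_pi_apply j).comp measurable_snd)
    have hU : Measurable fun z : SpCoset × (Fin m → SpCoset) => s 0 z.1 * U :=
      ((hs 0).measurable.comp measurable_fst).mul_const U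
    have hg : Measurable (Function.uncurry fun (a : SpCoset) (q : Fin m → SpCoset) (j : Fin m) =>
        toCoset (partialProd (fun j => s j.succ (q j)) (s 0 a * U) j)) :=
      measurable_pi_iff.2 fun j => measurable_toCoset.comp
        ((measurable_pi_apply j).comp (measurable_partialProd hQ hU))
    have h0 : MeasurePreserving (fun q => toCoset (s 0 q * U)) haarCoset haarCoset :=
      ⟨measurable_toCoset.comp ((hs 0).measurable.mul_const U), map_toCoset_mul (hs 0) U⟩
    have h1 := h0.skew_product hg (Filter.Eventually.of_forall fun a =>
      (ih (fun j => hs j.succ) (s 0 a * U)).map_eq)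
    have h2 := (measurePreserving_piCons haarCoset m).comp
      (h1.comp (measurePreserving_piHeadTail haarCoset m))
    refine (congrArg (fun f => MeasurePreserving f _ _) ?_).mp h2
    funext q j
    refine Fin.cases rfl (fun i => rfl) j

/-! ### The integrands in angular variables -/

theorem trace_selfDual (p : ℝ × ℝ × ℂ × ℂ) :
    Matrix.trace (selfDual p) = 2 * ((p.1 : ℂ) + p.2.1) := by
  simp only [Matrix.trace, Matrix.diag_apply, Fintype.sum_sum_type, Fin.sum_univ_two, selfDual]
  simp
  ring

theorem trace_selfDual_mul_diag4 (p : ℝ × ℝ × ℂ × ℂ) (u v : ℂ) :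
    Matrix.trace (selfDual p * diag4 u v) = 2 * ((p.1 : ℂ) * u + p.2.1 * v) := by
  simp only [Matrix.trace, Matrix.diag_apply, Fintype.sum_sum_type, Fin.sum_univ_two, selfDual,
    diag4, Matrix.mul_diagonal]
  simp
  ring

theorem conjParams_diag_fst_add_snd (P : Sp2) (a b : ℝ) :
    (conjParams P (a, b, 0, 0)).1 + (conjParams P (a, b, 0, 0)).2.1 = a + b := by
  have h := trace_selfDual (conjParams P (a, b, 0, 0))
  rw [selfDual_conjParams, Matrix.mul_assoc, Matrix.trace_mul_comm, Matrix.mul_assoc,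
    mat_mul_conjTranspose, Matrix.mul_one, trace_selfDual] at h
  have h2 := mul_left_cancel₀ two_ne_zero h
  exact_mod_cast h2.symm

theorem frobSq_conjParams_diag (P : Sp2) (a b : ℝ) :
    frobSq (conjParams P (a, b, 0, 0)) = a ^ 2 + b ^ 2 := by
  rw [frobSq_conjParams]
  simp [frobSq]

/-- The quaternion determinant is a polynomial in the invariants `x + y` and `frobSq`, so it equals
its value at the diagonal matrix. -/
theorem sqrtDet_conjParams_diag (P : Sp2) (a b lam0 : ℝ) :
    sqrtDet (selfDual (conjParams P (a, b, 0, 0)) - (Complex.I / 2) • diag4 lam0 lam0) =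
      ((a : ℂ) - Complex.I * lam0 / 2) * ((b : ℂ) - Complex.I * lam0 / 2) := by
  have h1 := conjParams_diag_fst_add_snd P a b
  have h2 := frobSq_conjParams_diag P a b
  generalize conjParams P (a, b, 0, 0) = p at *
  rw [smul_diag4, sqrtDet_selfDual_sub_diag4, Complex.mul_conj, Complex.mul_conj]
  have h1' : (p.1 : ℂ) + p.2.1 = a + b := by exact_mod_cast h1
  have h2' : (p.1 : ℂ) ^ 2 + (p.2.1 : ℂ) ^ 2 + 2 * (Complex.normSq p.2.2.1 : ℂ) +
      2 * (Complex.normSq p.2.2.2 : ℂ) = a ^ 2 + b ^ 2 := by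
    rw [frobSq] at h2
    exact_mod_cast h2
  linear_combination (((p.1 : ℂ) + p.2.1 + a + b) / 2 - Complex.I * lam0 / 2) * h1' - h2' / 2

/-- Expanding the square leaves the two invariants, the term coupling `P` to ξ, and a constant whose
sum over the sites is the exponent of `constC`. -/
theorem trace_conjParams_diag (P : Sp2) (a b lam0 s x₁ x₂ : ℝ) :
    -(1 / 4 : ℂ) * Matrix.trace ((selfDual (conjParams P (a, b, 0, 0)) +
        (Complex.I / 2) • diag4 lam0 lam0 + (Complex.I / (s : ℂ)) • diag4 x₁ x₂) ^ 2) =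
      (-(((a : ℂ) + Complex.I * lam0 / 2) ^ 2 / 2 + ((b : ℂ) + Complex.I * lam0 / 2) ^ 2 / 2) -
        Complex.I / (2 * (s : ℂ)) *
          Matrix.trace (P.matᴴ * diag4 a b * P.mat * diag4 x₁ x₂)) +
      ((lam0 * (x₁ + x₂) / (2 * s) + (x₁ ^ 2 + x₂ ^ 2) / (2 * s ^ 2) : ℝ) : ℂ) := by
  have h1 := conjParams_diag_fst_add_snd P a b
  have h2 := frobSq_conjParams_diag P a b
  rw [← selfDual_diag a b, ← selfDual_conjParams]
  generalize conjParams P (a, b, 0, 0) = p at *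
  rw [trace_selfDual_mul_diag4, smul_diag4, smul_diag4, add_assoc, diag4_add, trace_selfDual_add_sq,
    Complex.mul_conj, Complex.mul_conj]
  have h1' : (p.1 : ℂ) + p.2.1 = a + b := by exact_mod_cast h1
  have h2' : (p.1 : ℂ) ^ 2 + (p.2.1 : ℂ) ^ 2 + 2 * (Complex.normSq p.2.2.1 : ℂ) +
      2 * (Complex.normSq p.2.2.2 : ℂ) = a ^ 2 + b ^ 2 := by
    rw [frobSq] at h2
    exact_mod_cast h2
  have hI := Complex.I_sq
  have e1 : Complex.I / (s : ℂ) = Complex.I * (s : ℂ)⁻¹ := div_eq_mul_inv _ _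
  have e2 : Complex.I / (2 * (s : ℂ)) = Complex.I * (s : ℂ)⁻¹ / 2 := by
    rw [div_eq_mul_inv, mul_inv]
    ring
  have e3 : ((lam0 * (x₁ + x₂) / (2 * s) + (x₁ ^ 2 + x₂ ^ 2) / (2 * s ^ 2) : ℝ) : ℂ) =
      lam0 * (x₁ + x₂) * (s : ℂ)⁻¹ / 2 + (x₁ ^ 2 + x₂ ^ 2) * (s : ℂ)⁻¹ ^ 2 / 2 := by
    push_cast
    rw [div_eq_mul_inv _ (2 * (s : ℂ)), div_eq_mul_inv _ (2 * (s : ℂ) ^ 2), mul_inv, mul_inv,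
      inv_pow]
    ring
  rw [e1, e2, e3]
  generalize (s : ℂ)⁻¹ = r
  linear_combination -h2' / 2 - Complex.I * lam0 / 2 * h1' -
    ((lam0 : ℂ) * (x₁ + x₂) * r / 2 + (x₁ ^ 2 + x₂ ^ 2) * r ^ 2 / 2) * hI

/-- Both matrices are conjugated by the common factor `V`, which drops out of the trace. -/
theorem trace_conjParams_step (Q V : Sp2) (a b a' b' : ℝ) :
    Matrix.trace ((selfDual (conjParams (Q * V) (a', b', 0, 0)) -
        selfDual (conjParams V (a, b, 0, 0))) ^ 2) =
      Matrix.trace ((Q.matᴴ * diag4 a' b' * Q.mat - diag4 a b) ^ 2) := by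
  rw [← trace_conj_sq V (Q.matᴴ * diag4 a' b' * Q.mat - diag4 a b)]
  congr 2
  rw [selfDual_conjParams, selfDual_conjParams, selfDual_diag, selfDual_diag, mat_mul,
    Matrix.conjTranspose_mul, Matrix.mul_sub, Matrix.sub_mul]
  simp only [Matrix.mul_assoc]

/-- At a zero of the argument `Complex.log 0 = 0` would give the factor 1 instead of 0. This can
happen only when `lam0 = 0` and `x = 0`, hence on a null set. -/
theorem exp_neg_actionF {lam0 x : ℝ} (h : (x : ℂ) - Complex.I * lam0 / 2 ≠ 0) :
    Complex.exp (-actionF lam0 x) =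
      Complex.exp (-(((x : ℂ) + Complex.I * lam0 / 2) ^ 2 / 2)) * ((x : ℂ) - Complex.I * lam0 / 2) := by
  rw [actionF, neg_sub, sub_eq_add_neg, Complex.exp_add, Complex.exp_log h, mul_comm]

theorem constC_eq (n : ℕ) (lam0 : ℝ) (xi : Fin 2 → ℝ) :
    (constC n lam0 xi : ℂ) = Complex.exp (∑ _j : Fin (2 * n + 1),
      ((lam0 * (xi 0 + xi 1) / (2 * scaleN n lam0) +
        (xi 0 ^ 2 + xi 1 ^ 2) / (2 * scaleN n lam0 ^ 2) : ℝ) : ℂ)) := by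
  have hN : ((2 * n + 1 : ℕ) : ℝ) ≠ 0 := by positivity
  rw [constC, Complex.ofReal_exp, Finset.sum_const, Finset.card_univ, Fintype.card_fin, nsmul_eq_mul,
    ← Complex.ofReal_natCast, ← Complex.ofReal_mul]
  congr 2
  rw [scaleN]
  generalize semicircleDensity lam0 = ρ
  rw [mul_add ((2 * n + 1 : ℕ) : ℝ)]
  congr 1
  · rw [← mul_div_assoc, show 2 * (((2 * n + 1 : ℕ) : ℝ) * ρ) = ((2 * n + 1 : ℕ) : ℝ) * (2 * ρ) by ring,
      mul_div_mul_left _ _ hN]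
  · rw [← mul_div_assoc, show 2 * (((2 * n + 1 : ℕ) : ℝ) * ρ) ^ 2 =
      ((2 * n + 1 : ℕ) : ℝ) * (2 * ((2 * n + 1 : ℕ) : ℝ) * ρ ^ 2) by ring, mul_div_mul_left _ _ hN]

theorem cumProd_succ {n : ℕ} (Q : Fin (2 * n) → Sp2) (j : Fin (2 * n)) :
    cumProd Q j.succ = Q j * cumProd Q j.castSucc := rfl

theorem selfDualIntegrand_conjParams (n : ℕ) (W lam0 : ℝ) (xi : Fin 2 → ℝ)
    {a b : Fin (2 * n + 1) → ℝ} (P : Sp2) (Q : Fin (2 * n) → Sp2)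
    (ha : ∀ j, (a j : ℂ) - Complex.I * lam0 / 2 ≠ 0)
    (hb : ∀ j, (b j : ℂ) - Complex.I * lam0 / 2 ≠ 0) :
    selfDualIntegrand n W lam0 xi (fun j => conjParams (cumProd Q j * P) (a j, b j, 0, 0)) *
        ∏ j, ((a j : ℂ) - b j) ^ 4 =
      constC n lam0 xi * angularIntegrand n W lam0 xi a b P Q := by
  rw [selfDualIntegrand, angularIntegrand, constC_eq,
    Finset.mul_sum _ _ (-(1 / 4 : ℂ))]
  have h0 : ∀ j : Fin (2 * n), Matrix.trace
      ((selfDual (conjParams (cumProd Q j.succ * P) (a j.succ, b j.succ, 0, 0)) -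
        selfDual (conjParams (cumProd Q j.castSucc * P) (a j.castSucc, b j.castSucc, 0, 0))) ^ 2) =
      Matrix.trace (((Q j).matᴴ * diag4 (a j.succ) (b j.succ) * (Q j).mat
        - diag4 (a j.castSucc) (b j.castSucc)) ^ 2) := by
    intro j
    rw [cumProd_succ, mul_assoc, trace_conjParams_step]
  simp_rw [h0, sqrtDet_conjParams_diag, ← mat_mul]
  have h1 := fun j => trace_conjParams_diag (cumProd Q j * P) (a j) (b j) lam0 (scaleN n lam0)
    (xi 0) (xi 1)
  simp_rw [h1]
  have h2 : Complex.exp (-(∑ j, (actionF lam0 (a j) + actionF lam0 (b j))) -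
      Complex.I / (2 * (scaleN n lam0 : ℂ)) * ∑ j, Matrix.trace
        ((cumProd Q j * P).matᴴ * diag4 (a j) (b j) * (cumProd Q j * P).mat
          * diag4 (xi 0) (xi 1))) =
      Complex.exp (∑ j, (-(((a j : ℂ) + Complex.I * lam0 / 2) ^ 2 / 2 +
        ((b j : ℂ) + Complex.I * lam0 / 2) ^ 2 / 2) - Complex.I / (2 * (scaleN n lam0 : ℂ)) *
          Matrix.trace ((cumProd Q j * P).matᴴ * diag4 (a j) (b j) * (cumProd Q j * P).mat
          * diag4 (xi 0) (xi 1)))) *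
        ∏ j, (((a j : ℂ) - Complex.I * lam0 / 2) * ((b j : ℂ) - Complex.I * lam0 / 2)) := by
    rw [Finset.mul_sum, ← Finset.sum_neg_distrib, ← Finset.sum_sub_distrib, Complex.exp_sum,
      Complex.exp_sum, ← Finset.prod_mul_distrib]
    refine Finset.prod_congr rfl fun j _ => ?_
    rw [sub_eq_add_neg, Complex.exp_add, neg_add, Complex.exp_add, exp_neg_actionF (ha j),
      exp_neg_actionF (hb j), sub_eq_add_neg _ (Complex.I / _ * _), Complex.exp_add, neg_add,
      Complex.exp_add]
    ring
  rw [Finset.sum_add_distrib, Complex.exp_add, h2]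
  ring

theorem continuous_selfDualIntegrand (n : ℕ) (W lam0 : ℝ) (xi : Fin 2 → ℝ) :
    Continuous (selfDualIntegrand n W lam0 xi) := by
  have h : ∀ j, Continuous fun p : Fin (2 * n + 1) → ℝ × ℝ × ℂ × ℂ => selfDual (p j) := fun j =>
    continuous_selfDual.comp (continuous_apply j)
  have hd : ∀ j, Continuous fun p : Fin (2 * n + 1) → ℝ × ℝ × ℂ × ℂ =>
      sqrtDet (selfDual (p j) - (Complex.I / 2) • diag4 lam0 lam0) := by
    intro j
    have h1 : Continuous fun p : Fin (2 * n + 1) → ℝ × ℝ × ℂ × ℂ => p j := continuous_apply j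
    simp_rw [smul_diag4, sqrtDet_selfDual_sub_diag4]
    have hc : Continuous (starRingEnd ℂ) := Complex.continuous_conj
    fun_prop
  refine ((Complex.continuous_exp.comp (continuous_const.mul (continuous_finsetSum _ fun j _ =>
    ((h _).sub (h _)).pow 2 |>.matrix_trace))).mul
    (Complex.continuous_exp.comp (continuous_const.mul (continuous_finsetSum _ fun j _ =>
    ((((h _).add continuous_const).add continuous_const).pow 2).matrix_trace)))).mul ?_
  exact continuous_finsetProd _ fun j _ => hd j

/-! ### Products of measures with densities -/

theorem lintegral_fin_pi_prod {α : Type*} [MeasurableSpace α] (μ : Measure α) [SigmaFinite μ] {m : ℕ}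
    {f : Fin m → α → ENNReal} (hf : ∀ j, Measurable (f j)) :
    ∫⁻ x : Fin m → α, ∏ j, f j (x j) ∂(Measure.pi fun _ => μ) = ∏ j, ∫⁻ x, f j x ∂μ := by
  induction m with
  | zero => simp
  | succ m ih =>
    have hm : Measurable fun x : Fin (m + 1) → α => ∏ j, f j (x j) :=
      Finset.measurable_fun_prod _ fun j _ => (hf j).comp (measurable_pi_apply j)
    have hm' : Measurable fun x : Fin m → α => ∏ j, f j.succ (x j) :=
      Finset.measurable_fun_prod _ fun j _ => (hf j.succ).comp (measurable_pi_apply j)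
    rw [← (measurePreserving_piCons μ m).lintegral_comp hm, Fin.prod_univ_succ,
      ← ih fun j => hf j.succ]
    simp only [Fin.prod_univ_succ, Fin.cons_zero, Fin.cons_succ]
    exact lintegral_prod_mul (hf 0).aemeasurable hm'.aemeasurable

theorem pi_withDensity {α : Type*} [MeasurableSpace α] (μ : Measure α) [SigmaFinite μ] (m : ℕ)
    {f : α → ENNReal} (hf : Measurable f) [SigmaFinite (μ.withDensity f)] :
    Measure.pi (fun _ : Fin m => μ.withDensity f) =
      (Measure.pi fun _ : Fin m => μ).withDensity fun x => ∏ j, f (x j) := by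
  refine Measure.pi_eq fun s hs => ?_
  rw [withDensity_apply _ (MeasurableSet.univ_pi hs), ← lintegral_indicator (MeasurableSet.univ_pi hs)]
  have h : ∀ x : Fin m → α, (Set.univ.pi s).indicator (fun x => ∏ j, f (x j)) x =
      ∏ j, (s j).indicator f (x j) := by
    intro x
    by_cases hx : x ∈ Set.univ.pi s
    · rw [Set.indicator_of_mem hx]
      exact Finset.prod_congr rfl fun j _ => (Set.indicator_of_mem (hx j trivial) _).symm
    · rw [Set.indicator_of_notMem hx]
      obtain ⟨j, hj⟩ : ∃ j, x j ∉ s j := by simpa [Set.mem_pi] using hx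
      exact (Finset.prod_eq_zero (Finset.mem_univ j) (Set.indicator_of_notMem hj _)).symm
  simp_rw [h]
  rw [lintegral_fin_pi_prod μ fun j => hf.indicator (hs j)]
  refine Finset.prod_congr rfl fun j _ => ?_
  rw [lintegral_indicator (hs j), withDensity_apply _ (hs j)]

/-! ### The joint change of variables -/

/-- The cosets of the matrices `R_j P`. -/
def unfoldCosets {n : ℕ} (s : Fin (2 * n + 1) → SpCoset → Sp2)
    (z : SpCoset × (Fin (2 * n) → SpCoset)) (j : Fin (2 * n + 1)) : SpCoset :=
  toCoset (cumProd (fun j => s j.succ (z.2 j)) j * s 0 z.1)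

theorem measurePreserving_unfoldCosets {n : ℕ} {s : Fin (2 * n + 1) → SpCoset → Sp2}
    (hs : ∀ j, IsMeasurableSection (s j)) :
    MeasurePreserving (unfoldCosets s) (haarCoset.prod (Measure.pi fun _ => haarCoset))
      (Measure.pi fun _ => haarCoset) := by
  have h := (measurePreserving_toCoset_partialProd hs 1).comp
    (measurePreserving_piCons haarCoset (2 * n))
  refine (congrArg (fun f => MeasurePreserving f _ _) ?_).mp h
  funext z j
  have hc : (fun j => s j ((Fin.cons z.1 z.2 : Fin (2 * n + 1) → SpCoset) j)) =
      (Fin.cons (s 0 z.1) fun j => s j.succ (z.2 j) : Fin (2 * n + 1) → Sp2) := by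
    funext j
    refine Fin.cases rfl (fun i => rfl) j
  change toCoset (partialProd (fun j => s j ((Fin.cons z.1 z.2 : Fin (2 * n + 1) → SpCoset) j)) 1 j) = _
  rw [hc, partialProd_cons_one]
  rfl

/-- Eigenvalues and cosets, site by site. -/
def siteVariables {n : ℕ} (s : Fin (2 * n + 1) → SpCoset → Sp2)
    (z : (Fin (2 * n + 1) → ℝ) × (Fin (2 * n + 1) → ℝ) × SpCoset × (Fin (2 * n) → SpCoset))
    (j : Fin (2 * n + 1)) : (ℝ × ℝ) × SpCoset :=
  ((z.1 j, z.2.1 j), unfoldCosets s z.2.2 j)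

theorem measurePreserving_siteVariables {n : ℕ} {s : Fin (2 * n + 1) → SpCoset → Sp2}
    (hs : ∀ j, IsMeasurableSection (s j)) :
    MeasurePreserving (siteVariables s)
      (volume.prod (volume.prod (haarCoset.prod (Measure.pi fun _ => haarCoset))))
      (Measure.pi fun _ => (volume : Measure (ℝ × ℝ)).prod haarCoset) := by
  have h1 := (measurePreserving_prodAssoc (volume : Measure (Fin (2 * n + 1) → ℝ))
    (volume : Measure (Fin (2 * n + 1) → ℝ))
    (haarCoset.prod (Measure.pi fun _ : Fin (2 * n) => haarCoset))).symm MeasurableEquiv.prodAssoc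
  have h2 := ((measurePreserving_arrowProdEquivProdArrow ℝ ℝ (Fin (2 * n + 1))
    (fun _ => volume) (fun _ => volume)).symm (MeasurableEquiv.arrowProdEquivProdArrow _ _ _)).prod
      (measurePreserving_unfoldCosets hs)
  have h3 := (measurePreserving_arrowProdEquivProdArrow (ℝ × ℝ) SpCoset (Fin (2 * n + 1))
    (fun _ => volume.prod volume) (fun _ => haarCoset)).symm
      (MeasurableEquiv.arrowProdEquivProdArrow _ _ _)
  exact h3.comp (h2.comp h1)

/-- The change of variables uses the one section `s 0` at every site; the product R_j P_{-n} of the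
given representatives lies in the same coset and gives the same matrix. -/
theorem conjParams_section_unfoldCosets {n : ℕ} {s : Fin (2 * n + 1) → SpCoset → Sp2}
    (hs : ∀ j, IsMeasurableSection (s j)) (z : SpCoset × (Fin (2 * n) → SpCoset))
    (j : Fin (2 * n + 1)) (a b : ℝ) :
    conjParams (s 0 (unfoldCosets s z j)) (a, b, 0, 0) =
      conjParams (cumProd (fun j => s j.succ (z.2 j)) j * s 0 z.1) (a, b, 0, 0) :=
  conjParams_diag_eq_of_toCoset_eq ((hs 0).toCoset_eq _) a b

theorem eigenDensity_nonneg (x : ℝ × ℝ) : 0 ≤ eigenDensity x := by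
  unfold eigenDensity
  have : (x.1 - x.2) ^ 4 = ((x.1 - x.2) ^ 2) ^ 2 := by ring
  rw [this]
  positivity

theorem ae_forall_sub_ne_zero (m : ℕ) (c : ℂ) :
    ∀ᵐ a : Fin m → ℝ, ∀ j, (a j : ℂ) - c ≠ 0 := by
  refine ae_all_iff.2 fun j => ?_
  have h : ∀ᵐ x : ℝ, (x : ℂ) - c ≠ 0 := by
    have h1 : ∀ᵐ x : ℝ, x ≠ c.re := by
      simp [ae_iff]
    filter_upwards [h1] with x hx h2
    exact hx (by simpa using congrArg Complex.re (sub_eq_zero.1 h2))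
  exact (Measure.quasiMeasurePreserving_eval (fun _ : Fin m => (volume : Measure ℝ)) j).ae h

/-- Here `Ψ` will be the site-by-site diagonalisation with the eigenvalue density, and `Θ` the
measure-preserving passage from the angular variables to one coset per site. -/
theorem integral_comp_withDensity {α β γ : Type*} [MeasurableSpace α] [MeasurableSpace β]
    [MeasurableSpace γ] {κ : Measure α} {ν : Measure β} {μ : Measure γ} {D : α → ℝ} {Ψ : α → β}
    {Θ : γ → α} (hDm : Measurable D) (hD0 : ∀ z, 0 ≤ D z)
    (hΨ : MeasurePreserving Ψ (κ.withDensity fun z => ENNReal.ofReal (D z)) ν)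
    (hΘ : MeasurePreserving Θ μ κ) {F : β → ℂ} (hF : Measurable F) (hi : Integrable F ν) :
    Integrable (fun z => D (Θ z) • F (Ψ (Θ z))) μ ∧
      ∫ z, D (Θ z) • F (Ψ (Θ z)) ∂μ = ∫ p, F p ∂ν := by
  have hFm : Measurable fun z => F (Ψ z) := hF.comp hΨ.measurable
  have hi1 : Integrable (fun z => F (Ψ z)) (κ.withDensity fun z => ENNReal.ofReal (D z)) :=
    hΨ.integrable_comp_of_integrable hi
  have he1 : ∫ p, F p ∂ν = ∫ z, F (Ψ z) ∂(κ.withDensity fun z => ENNReal.ofReal (D z)) := by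
    rw [← hΨ.map_eq]
    exact integral_map hΨ.measurable.aemeasurable hF.aestronglyMeasurable
  have hlt : ∀ᵐ z ∂κ, ENNReal.ofReal (D z) < ⊤ :=
    Filter.Eventually.of_forall fun z => ENNReal.ofReal_lt_top
  rw [integral_withDensity_eq_integral_toReal_smul hDm.ennreal_ofReal hlt] at he1
  rw [integrable_withDensity_iff_integrable_smul' hDm.ennreal_ofReal hlt] at hi1
  simp only [ENNReal.toReal_ofReal (hD0 _)] at he1 hi1
  have hm2 : Measurable fun z => D z • F (Ψ z) := hDm.smul hFm
  refine ⟨hΘ.integrable_comp_of_integrable hi1, ?_⟩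
  rw [he1, ← hΘ.map_eq]
  exact (integral_map hΘ.measurable.aemeasurable hm2.aestronglyMeasurable).symm

/-- The parameters of the self-dual matrices with the given eigenvalues and cosets. -/
def eigenFamily {m : ℕ} (σ : SpCoset → Sp2) (z : Fin m → (ℝ × ℝ) × SpCoset) (j : Fin m) :
    ℝ × ℝ × ℂ × ℂ :=
  conjParams (σ (z j).2) ((z j).1.1, (z j).1.2, 0, 0)

/-- The joint density of the eigenvalues. -/
def familyDensity {m : ℕ} (z : Fin m → (ℝ × ℝ) × SpCoset) : ℝ := ∏ j, eigenDensity (z j).1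

theorem measurable_eigenDensity_fst :
    Measurable fun z : (ℝ × ℝ) × SpCoset => eigenDensity z.1 :=
  measurable_eigenDensity.comp measurable_fst

theorem measurable_familyDensity {m : ℕ} : Measurable (familyDensity (m := m)) :=
  Finset.measurable_fun_prod _ fun j _ => measurable_eigenDensity_fst.comp (measurable_pi_apply j)

theorem familyDensity_nonneg {m : ℕ} (z : Fin m → (ℝ × ℝ) × SpCoset) : 0 ≤ familyDensity z :=
  Finset.prod_nonneg fun _ _ => eigenDensity_nonneg _

theorem measurePreserving_eigenFamily {m : ℕ} {σ : SpCoset → Sp2} (hσ : IsMeasurableSection σ) :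
    MeasurePreserving (eigenFamily (m := m) σ)
      ((Measure.pi fun _ => (volume : Measure (ℝ × ℝ)).prod haarCoset).withDensity
        fun z => ENNReal.ofReal (familyDensity z)) volume := by
  have hf : SigmaFinite (((volume : Measure (ℝ × ℝ)).prod haarCoset).withDensity
      fun z => ENNReal.ofReal (eigenDensity z.1)) :=
    SigmaFinite.withDensity_ofReal _
  have h1 := measurePreserving_pi (fun _ : Fin m =>
    ((volume : Measure (ℝ × ℝ)).prod haarCoset).withDensity
      fun z => ENNReal.ofReal (eigenDensity z.1)) (fun _ => volume)
    fun _ => measurePreserving_eigen hσ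
  rw [pi_withDensity _ _ measurable_eigenDensity_fst.ennreal_ofReal] at h1
  have hD : (fun z : Fin m → (ℝ × ℝ) × SpCoset => ∏ j, ENNReal.ofReal (eigenDensity (z j).1)) =
      fun z => ENNReal.ofReal (familyDensity z) := by
    funext z
    rw [familyDensity, ENNReal.ofReal_prod_of_nonneg fun j _ => eigenDensity_nonneg _]
  rw [hD] at h1
  exact h1

/-- The representation of the mixed moment over eigenvalues and cosets. -/
theorem angular_representation (n : ℕ) (W lam0 : ℝ) (xi : Fin 2 → ℝ)
    {s : Fin (2 * n + 1) → SpCoset → Sp2} (hs : ∀ j, IsMeasurableSection (s j)) :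
    Integrable
        (fun z : (Fin (2 * n + 1) → ℝ) × (Fin (2 * n + 1) → ℝ) × SpCoset × (Fin (2 * n) → SpCoset) =>
          angularIntegrand n W lam0 xi z.1 z.2.1 (s 0 z.2.2.1) (fun j => s j.succ (z.2.2.2 j)))
        (volume.prod (volume.prod (haarCoset.prod (Measure.pi fun _ => haarCoset)))) ∧
      mixedMoment n W (fun l : Fin 2 => (lam0 : ℂ) + (xi l : ℂ) / (scaleN n lam0 : ℂ)) =
        -((constC n lam0 xi : ℂ) * (((covJ n W).det : ℂ) ^ 3)⁻¹ / (24 * (Real.pi : ℂ)) ^ (2 * n + 1)) *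
          ∫ z : (Fin (2 * n + 1) → ℝ) × (Fin (2 * n + 1) → ℝ) × SpCoset × (Fin (2 * n) → SpCoset),
            angularIntegrand n W lam0 xi z.1 z.2.1 (s 0 z.2.2.1) (fun j => s j.succ (z.2.2.2 j))
            ∂(volume.prod (volume.prod (haarCoset.prod (Measure.pi fun _ => haarCoset)))) := by
  obtain ⟨hi, hrep⟩ := selfDual_representation n W lam0 xi
  obtain ⟨h1, h2⟩ := integral_comp_withDensity measurable_familyDensity familyDensity_nonneg
    (measurePreserving_eigenFamily (hs 0)) (measurePreserving_siteVariables hs)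
    (continuous_selfDualIntegrand n W lam0 xi).measurable hi
  set μ : Measure ((Fin (2 * n + 1) → ℝ) × (Fin (2 * n + 1) → ℝ) × SpCoset ×
    (Fin (2 * n) → SpCoset)) :=
      volume.prod (volume.prod (haarCoset.prod (Measure.pi fun _ => haarCoset))) with hμ
  set K : ℂ := ((Real.pi : ℂ) ^ 2 / 12) ^ (2 * n + 1) * constC n lam0 xi with hK
  have hpi : (Real.pi : ℂ) ≠ 0 := by exact_mod_cast Real.pi_ne_zero
  have hC : (constC n lam0 xi : ℂ) ≠ 0 := by
    rw [constC]
    exact_mod_cast (Real.exp_pos _).ne'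
  have hK0 : K ≠ 0 := by
    rw [hK]
    exact mul_ne_zero (pow_ne_zero _ (div_ne_zero (pow_ne_zero _ hpi) (by norm_num))) hC
  -- The equality holds only almost everywhere because of the value of the logarithm at zero in
  -- `actionF`.
  have hae : (fun z => familyDensity (siteVariables s z) •
        selfDualIntegrand n W lam0 xi (eigenFamily (s 0) (siteVariables s z))) =ᵐ[μ]
      fun z => K * angularIntegrand n W lam0 xi z.1 z.2.1 (s 0 z.2.2.1)
        (fun j => s j.succ (z.2.2.2 j)) := by
    have ha := (Measure.quasiMeasurePreserving_fst
      (μ := (volume : Measure (Fin (2 * n + 1) → ℝ))) (ν := (volume : Measure (Fin (2 * n + 1) → ℝ)).prod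
      (haarCoset.prod (Measure.pi fun _ : Fin (2 * n) => haarCoset)))).ae
        (ae_forall_sub_ne_zero (2 * n + 1) (Complex.I * lam0 / 2))
    have hb := ((Measure.quasiMeasurePreserving_fst
      (μ := (volume : Measure (Fin (2 * n + 1) → ℝ)))
      (ν := haarCoset.prod (Measure.pi fun _ : Fin (2 * n) => haarCoset))).comp
        (Measure.quasiMeasurePreserving_snd (μ := (volume : Measure (Fin (2 * n + 1) → ℝ)))
          (ν := (volume : Measure (Fin (2 * n + 1) → ℝ)).prod
            (haarCoset.prod (Measure.pi fun _ : Fin (2 * n) => haarCoset))))).ae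
        (ae_forall_sub_ne_zero (2 * n + 1) (Complex.I * lam0 / 2))
    filter_upwards [ha, hb] with z hza hzb
    rw [Function.comp_apply] at hzb
    have hfam : eigenFamily (s 0) (siteVariables s z) = fun j =>
        conjParams (cumProd (fun j => s j.succ (z.2.2.2 j)) j * s 0 z.2.2.1)
          (z.1 j, z.2.1 j, 0, 0) := by
      funext j
      exact conjParams_section_unfoldCosets hs z.2.2 j _ _
    rw [hfam, hK, mul_assoc, ← selfDualIntegrand_conjParams n W lam0 xi (s 0 z.2.2.1)
      (fun j => s j.succ (z.2.2.2 j)) hza hzb, Complex.real_smul]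
    simp only [familyDensity, siteVariables, eigenDensity]
    push_cast
    rw [Finset.prod_mul_distrib, Finset.prod_const, Finset.card_univ, Fintype.card_fin]
    ring
  have hint := (integrable_congr hae).1 h1
  rw [integral_congr_ae hae, integral_const_mul] at h2
  refine ⟨(integrable_const_mul_iff (isUnit_iff_ne_zero.2 hK0) _).1 hint, ?_⟩
  rw [hrep, ← h2, hK]
  -- The eigenvalue density contributes π²/12 per site, which turns 2π³ into 24π.
  have h24 : (24 * (Real.pi : ℂ)) ^ (2 * n + 1) * ((Real.pi : ℂ) ^ 2 / 12) ^ (2 * n + 1) =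
      (2 * (Real.pi : ℂ) ^ 3) ^ (2 * n + 1) := by
    rw [← mul_pow]
    congr 1
    ring
  rw [← h24]
  have h12 : ((Real.pi : ℂ) ^ 2 / 12) ^ (2 * n + 1) ≠ 0 :=
    pow_ne_zero _ (div_ne_zero (pow_ne_zero _ hpi) (by norm_num))
  have h24' : (24 * (Real.pi : ℂ)) ^ (2 * n + 1) ≠ 0 :=
    pow_ne_zero _ (mul_ne_zero (by norm_num) hpi)
  generalize ((Real.pi : ℂ) ^ 2 / 12) ^ (2 * n + 1) = u at *
  generalize (24 * (Real.pi : ℂ)) ^ (2 * n + 1) = v at *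
  rw [mul_inv, div_eq_mul_inv]
  field_simp

end RBM

end

theorem mainTheorem2 (n : ℕ) (W : ℝ) (hW : 0 < W) (lam0 : ℝ) (hlam0 : lam0 ∈ Set.Ioo (-2 : ℝ) 2)
    (xi : Fin 2 → ℝ) :
    MeasureTheory.Integrable (RBM.charPolyProd (n := n)
      (fun l : Fin 2 => (lam0 : ℂ) + (xi l : ℂ) / (RBM.scaleN n lam0 : ℂ))) (RBM.bandLaw n W) ∧
    (MeasureTheory.Integrable (RBM.selfDualIntegrand n W lam0 xi) ∧
      RBM.mixedMoment n W (fun l : Fin 2 => (lam0 : ℂ) + (xi l : ℂ) / (RBM.scaleN n lam0 : ℂ)) =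
        -((2 * (Real.pi : ℂ) ^ 3) ^ (2 * n + 1))⁻¹ * (((RBM.covJ n W).det : ℂ) ^ 3)⁻¹ *
          ∫ p : Fin (2 * n + 1) → ℝ × ℝ × ℂ × ℂ, RBM.selfDualIntegrand n W lam0 xi p) ∧
    (∀ s : Fin (2 * n + 1) → RBM.SpCoset → RBM.Sp2, (∀ j, RBM.IsMeasurableSection (s j)) →
      MeasureTheory.Integrable
        (fun z : (Fin (2 * n + 1) → ℝ) × (Fin (2 * n + 1) → ℝ) ×
            RBM.SpCoset × (Fin (2 * n) → RBM.SpCoset) =>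
          RBM.angularIntegrand n W lam0 xi z.1 z.2.1 (s 0 z.2.2.1)
            (fun j => s j.succ (z.2.2.2 j)))
        (MeasureTheory.volume.prod (MeasureTheory.volume.prod
          (RBM.haarCoset.prod (MeasureTheory.Measure.pi fun _ => RBM.haarCoset)))) ∧
      RBM.mixedMoment n W (fun l : Fin 2 => (lam0 : ℂ) + (xi l : ℂ) / (RBM.scaleN n lam0 : ℂ)) =
        -((RBM.constC n lam0 xi : ℂ) * (((RBM.covJ n W).det : ℂ) ^ 3)⁻¹ /
            (24 * (Real.pi : ℂ)) ^ (2 * n + 1)) *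
          ∫ z : (Fin (2 * n + 1) → ℝ) × (Fin (2 * n + 1) → ℝ) ×
              RBM.SpCoset × (Fin (2 * n) → RBM.SpCoset),
            RBM.angularIntegrand n W lam0 xi z.1 z.2.1 (s 0 z.2.2.1)
              (fun j => s j.succ (z.2.2.2 j))
            ∂(MeasureTheory.volume.prod (MeasureTheory.volume.prod
              (RBM.haarCoset.prod (MeasureTheory.Measure.pi fun _ => RBM.haarCoset))))) := by
  exact ⟨(RBM.mixedMoment_eq_berezin n W _).1, RBM.selfDual_representation n W lam0 xi,
    fun _ hs => RBM.angular_representation n W lam0 xi hs⟩
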